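/- Let $\mathbb S\subset\mathbb R^3$ be the unit sphere with surface measure $d\xi=\sin\theta\,d\theta\,d\varphi$, let $(Y_{\ell m})_{\ell\ge 0,\,-\ell\le m\le \ell}$ be the usual complex spherical harmonics (orthonormal in $\mathbb H=L^2(\mathbb S)$; put $Y_{\ell m}=0$ for $|m|>\ell$), and write $f_{\ell m}=\int_{\mathbb S} fY_{\ell m}^*\,d\xi$ and $\Pi_\ell f=\sum_{|m|\le\ell}f_{\ell m}Y_{\ell m}$. Let $X$ be a real-valued, zero-mean, Gaussian, isotropic random element of $L^2(\mathbb S)$ (its law on $L^2(\mathbb S)$ is a centered Gaussian measure invariant under rotations), with power spectrum $C_\ell=\frac1{2\ell+1}\sum_{|m|\le \ell}\mathbb E|X_{\ell m}|^2$ (equivalently, the common value of $\mathbb E|X_{\ell m}|^2$, $|m|\le\ell$). Let $W,D\in\mathbb H$ be deterministic, $\bar W=1-W$, $\bar w_{\ell m}=\bar W_{\ell m}$, $d_{\ell m}=D_{\ell m}$, $\sigma_\ell^2=(2\ell+1)C_\ell$, $\boldsymbol\sigma=\mathrm{diag}(\sigma_\ell^2)$. For a real window $\mathbf b=(b_\ell)_{\ell_{\min}\le\ell\le\ell_{\max}}$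 let $\Phi=\sum_{\ell=\ell_{\min}}^{\ell_{\max}}b_\ell\Pi_\ell$. Write $$G\begin{pmatrix}\ell_1&\ell_2&\ell_3\\m_1&m_2&m_3\end{pmatrix}=\int_{\mathbb S}Y_{\ell_1m_1}Y_{\ell_2m_2}Y_{\ell_3m_3}^*\,d\xi ,$$ $$Q_{\ell\ell'}=\sum_{|m|\le\ell}\sum_{|m'|\le\ell'}\ \sum_{(\ell_i,m_i)_{i=1,\dots,4}} C_{\ell_1}\bar w_{\ell_2m_2}\bar w_{\ell_3m_3}^*d_{\ell_4m_4}\,G\begin{pmatrix}\ell_1&\ell_2&\ell\\m_1&m_2&m\end{pmatrix}G\begin{pmatrix}\ell_1&\ell_3&\ell'\\m_1&m_3&m'\end{pmatrix}^{*}G\begin{pmatrix}\ell&\ell_4&\ell'\\m&m_4&m'\end{pmatrix},$$ the inner sum being over $\ell_i\ge0$, $|m_i|\le\ell_i$; let $\mathbf Q=(Q_{\ell\ell'})$. 1. The series defining every $Q_{\ell\ell'}$ converge absolutely. 2. Let $\mathbf b'\boldsymbol\sigma\mathbf b=\sum_\ell\sigma_\ell^2b_\ell^2\neq0$. Then $\mathbb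 E[\Phi X(\xi)^2]=(4\pi)^{-1}\,\mathbf b'\boldsymbol\sigma\mathbf b$ for every $\xi\in\mathbb S$. With the normalized difference field $\epsilon(\xi)=\dfrac{\Phi X(\xi)-\Phi(XW)(\xi)}{\mathbb E^{1/2}[\Phi X(\xi)^2]}$, the mean integrated square error $R(\mathbf b)=\mathbb E\int_{\mathbb S}D(\xi)|\epsilon(\xi)|^2\,d\xi$ is well defined (both integrals converge absolutely) and $$R(\mathbf b)=4\pi\,\frac{\mathbf b'\mathbf Q\mathbf b}{\mathbf b'\boldsymbol\sigma\mathbf b}.$$ Equivalently, if $\epsilon$ is normalized as $\epsilon=(\mathbf b'\boldsymbol\sigma\mathbf b)^{-1/2}\,\Phi(X\bar W)$, then $\mathbb E\int_{\mathbb S}D|\epsilon|^2\,d\xi=\dfrac{\mathbf b'\mathbf Q\mathbf b}{\mathbf b'\boldsymbol\sigma\mathbf b}$. 3. If $W$ and $D$ are axisymmetric (functions of $\theta$ only) and $W$ is real-valued, then for all $\ell,\ell'$ $$Q_{\ell\ell'}=\sum_{|m|\le\ell}\ \sum_{\ell_1,\ell_2,\ell_3,\ell_4}C_{\ell_1}\bar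 w_{\ell_20}\bar w_{\ell_30}d_{\ell_40}\,G\begin{pmatrix}\ell_1&\ell_2&\ell\\m&0&m\end{pmatrix}G\begin{pmatrix}\ell_1&\ell_3&\ell'\\m&0&m\end{pmatrix}G\begin{pmatrix}\ell&\ell_4&\ell'\\m&0&m\end{pmatrix}=\sum_{|m|\le\ell}A_{\ell\ell'm}D_{\ell\ell'm},$$ where $$A_{\ell\ell'm}=\sum_{\ell_1,\ell_2,\ell_3}C_{\ell_1}\bar w_{\ell_20}\bar w_{\ell_30}\,G\begin{pmatrix}\ell_1&\ell_2&\ell\\m&0&m\end{pmatrix}G\begin{pmatrix}\ell_1&\ell_3&\ell'\\m&0&m\end{pmatrix},\qquad D_{\ell\ell'm}=\sum_{\ell_4}d_{\ell_40}\,G\begin{pmatrix}\ell&\ell_4&\ell'\\m&0&m\end{pmatrix},$$ and all these series converge absolutely. -/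

import Mathlib

open MeasureTheory ProbabilityTheory
open scoped ComplexConjugate Matrix

namespace NeedletMask

noncomputable section

/-! ### The sphere, its surface measure and the rotations -/

/-- Euclidean space `ℝ³`. -/
abbrev R3 : Type := EuclideanSpace ℝ (Fin 3)

/-- The unit sphere of `ℝ³`. -/
abbrev S2 : Type := Metric.sphere (0 : R3) 1

/-- The surface measure on the sphere, `sin θ dθ dφ` in polar coordinates (total mass `4π`). -/
abbrev surf : Measure S2 := (volume : Measure R3).toSphere

/-- The action on the sphere of a linear isometry of `ℝ³`. -/
def rotate (g : R3 ≃ₗᵢ[ℝ] R3) (ξ : S2) : S2 :=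
  ⟨g ξ.1, by
    have h := ξ.2
    rw [mem_sphere_zero_iff_norm] at h ⊢
    rw [LinearIsometryEquiv.norm_map, h]⟩

open scoped Pointwise in
theorem measurePreserving_rotate (g : R3 ≃ₗᵢ[ℝ] R3) :
    MeasurePreserving (rotate g) surf surf := by
  have hc : Continuous (rotate g) :=
    Continuous.subtype_mk (g.continuous.comp continuous_subtype_val) _
  refine ⟨hc.measurable, ?_⟩
  ext s hs
  rw [Measure.map_apply hc.measurable hs, Measure.toSphere_apply' _ hs,
    Measure.toSphere_apply' _ (hc.measurable hs)]
  have key : Set.Ioo (0 : ℝ) 1 • ((↑) '' (rotate g ⁻¹' s) : Set R3)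
      = g ⁻¹' (Set.Ioo (0 : ℝ) 1 • ((↑) '' s : Set R3)) := by
    ext x
    simp only [Set.mem_smul, Set.mem_image, Set.mem_preimage]
    constructor
    · rintro ⟨r, hr, _, ⟨ξ, hξ, rfl⟩, rfl⟩
      exact ⟨r, hr, _, ⟨rotate g ξ, hξ, rfl⟩, by simp [rotate]⟩
    · rintro ⟨r, hr, _, ⟨η, hη, rfl⟩, h⟩
      have e : rotate g (rotate g.symm η) = η := by
        apply Subtype.ext
        simp [rotate]
      refine ⟨r, hr, _, ⟨rotate g.symm η, by rwa [e], rfl⟩, ?_⟩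
      apply g.injective
      rw [← h]
      simp [rotate]
  rw [key, g.measurePreserving.measure_preimage_emb g.toHomeomorph.measurableEmbedding]

/-! ### Legendre polynomials and spherical harmonics -/

/-- The Legendre polynomial `P_ℓ`, normalized by `P_ℓ(1) = 1` (Rodrigues' formula). -/
def legendre (l : ℕ) : Polynomial ℝ :=
  Polynomial.C ((2 ^ l * (l.factorial : ℝ))⁻¹) *
    Polynomial.derivative^[l] ((Polynomial.X ^ 2 - 1) ^ l)

/-- The spherical harmonic `Y_{ℓm}` for `m ≥ 0`:
`√((2ℓ+1)/(4π) · (ℓ-m)!/(ℓ+m)!) · P_{ℓm}(cos θ) e^{imφ}` with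
`P_{ℓm}(x) = (-1)^m (1-x²)^{m/2} (d/dx)^m P_ℓ(x)`.  In Cartesian coordinates `cos θ = ξ₂` and
`sin θ · e^{iφ} = ξ₀ + i ξ₁`, so `(1 - cos² θ)^{m/2} e^{imφ} = (ξ₀ + i ξ₁)^m`.
It vanishes for `m > ℓ`. -/
def harmonicNonneg (l m : ℕ) (ξ : S2) : ℂ :=
  ((Real.sqrt ((2 * l + 1) / (4 * Real.pi) * ((l - m).factorial / (l + m).factorial)) *
      ((-1) ^ m * (Polynomial.derivative^[m] (legendre l)).eval (ξ.1 2)) : ℝ) : ℂ) *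
    ((ξ.1 0 : ℂ) + (ξ.1 1 : ℂ) * Complex.I) ^ m

/-- The complex spherical harmonic `Y_{ℓm}`, with `Y_{ℓ,-m} = (-1)^m Y_{ℓm}^*`.
It vanishes for `|m| > ℓ`. -/
def Y (l : ℕ) (m : ℤ) (ξ : S2) : ℂ :=
  if 0 ≤ m then harmonicNonneg l m.natAbs ξ
  else (-1) ^ m.natAbs * conj (harmonicNonneg l m.natAbs ξ)

/-- The multipole coefficient `⟨f, Y_{ℓm}⟩ = ∫ f Y_{ℓm}^* dξ`. -/
def multipole (f : S2 → ℂ) (l : ℕ) (m : ℤ) : ℂ :=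
  ∫ ξ, f ξ * conj (Y l m ξ) ∂surf

/-- The Gaunt integral `∫ Y_{ℓ₁m₁} Y_{ℓ₂m₂} Y_{ℓ₃m₃}^* dξ`. -/
def gaunt (l₁ l₂ l₃ : ℕ) (m₁ m₂ m₃ : ℤ) : ℂ :=
  ∫ ξ, Y l₁ m₁ ξ * Y l₂ m₂ ξ * conj (Y l₃ m₃ ξ) ∂surf

/-- The pairs `(ℓ, m)` with `ℓ ∈ ℕ` and `-ℓ ≤ m ≤ ℓ`. -/
abbrev HIdx : Type := Σ l : ℕ, ↥(Finset.Icc (-(l : ℤ)) (l : ℤ))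

/-- The harmonic projection `Π_ℓ f(ξ) = ∑_m ⟨f, Y_{ℓm}⟩ Y_{ℓm}(ξ)`. -/
def proj (l : ℕ) (f : S2 → ℂ) (ξ : S2) : ℂ :=
  ∑ m ∈ Finset.Icc (-(l : ℤ)) (l : ℤ), multipole f l m * Y l m ξ

/-- The multipole numbers of the band `[ℓ_min, ℓ_max]`. -/
abbrev Band (lmin lmax : ℕ) : Type := ↥(Finset.Icc lmin lmax)

/-- The smoothing operator `Φ = ∑_{ℓ_min ≤ ℓ ≤ ℓ_max} b_ℓ Π_ℓ` of the spectral window `b`. -/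
def smooth {lmin lmax : ℕ} (b : Band lmin lmax → ℝ) (f : S2 → ℂ) (ξ : S2) : ℂ :=
  ∑ l : Band lmin lmax, (b l : ℂ) * proj l.1 f ξ

/-- The function depends on the colatitude only (almost everywhere). -/
def IsAxisymmetric (f : S2 → ℂ) : Prop :=
  ∃ h : ℝ → ℂ, ∀ᵐ ξ ∂surf, f ξ = h (ξ.1 2)

/-! ### Isotropic Gaussian fields -/

/-- Real-valued square integrable functions on the sphere. -/
abbrev RealL2 : Type := Lp ℝ 2 surf

/-- Complex-valued square integrable functions on the sphere. -/
abbrev ComplexL2 : Type := Lp ℂ 2 surf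

instance : MeasurableSpace RealL2 := borel RealL2

instance : BorelSpace RealL2 := ⟨rfl⟩

variable {Ω : Type*} [MeasurableSpace Ω]

/-- The realization `ω` of the real field `X`, as a complex-valued function. -/
def sample (X : Ω → RealL2) (ω : Ω) (ξ : S2) : ℂ := ((X ω ξ : ℝ) : ℂ)

/-- `X` is a real-valued zero mean Gaussian isotropic square integrable random field on the
sphere, with power spectrum `C`: a random element of `L²` whose law is a centered Gaussian measure
invariant under the rotations of the sphere, and `C_ℓ` is the mean of `𝔼|a_{ℓm}|²` over the
`2ℓ+1` values of `m`, where `a_{ℓm} = ⟨X, Y_{ℓm}⟩`. -/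
structure IsGaussianIsotropicField (P : Measure Ω) (X : Ω → RealL2) (C : ℕ → ℝ) : Prop where
  measurable : Measurable X
  gaussian : IsGaussian (P.map X)
  centered : ∫ ω, X ω ∂P = 0
  isotropic : ∀ g : R3 ≃ₗᵢ[ℝ] R3, LinearMap.det (g.toLinearEquiv : R3 →ₗ[ℝ] R3) = 1 →
    P.map (fun ω => Lp.compMeasurePreserving (rotate g) (measurePreserving_rotate g) (X ω))
      = P.map X
  spectrum : ∀ l : ℕ, C l = (2 * l + 1 : ℝ)⁻¹ *
    ∑ m ∈ Finset.Icc (-(l : ℤ)) (l : ℤ), ∫ ω, ‖multipole (sample X ω) l m‖ ^ 2 ∂P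

/-! ### The normalized error due to the weight, and its mean integrated square -/

/-- `𝔼[Φ X(ξ)²]`; the random variable `Φ X(ξ)` is real. -/
def smoothVariance {lmin lmax : ℕ} (P : Measure Ω) (X : Ω → RealL2) (b : Band lmin lmax → ℝ)
    (ξ : S2) : ℝ :=
  ∫ ω, ‖smooth b (sample X ω) ξ‖ ^ 2 ∂P

/-- The normalized difference field `ε(ξ) = (Φ X(ξ) - Φ(XW)(ξ)) / 𝔼[Φ X(ξ)²]^{1/2}`. -/
def errorField {lmin lmax : ℕ} (P : Measure Ω) (X : Ω → RealL2) (W : S2 → ℂ)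
    (b : Band lmin lmax → ℝ) (ω : Ω) (ξ : S2) : ℂ :=
  (smooth b (sample X ω) ξ - smooth b (fun η => sample X ω η * W η) ξ) /
    (Real.sqrt (smoothVariance P X b ξ) : ℂ)

/-- The mean integrated square error `R(b) = 𝔼 ∫ D(ξ) |ε(ξ)|² dξ`. -/
def mise {lmin lmax : ℕ} (P : Measure Ω) (X : Ω → RealL2) (W D : S2 → ℂ)
    (b : Band lmin lmax → ℝ) : ℂ :=
  ∫ ω, ∫ ξ, D ξ * (‖errorField P X W b ω ξ‖ ^ 2 : ℝ) ∂surf ∂P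

/-! ### The matrices of the Rayleigh quotient -/

/-- The multipole coefficients of `1 - W`. -/
def wbar (W : S2 → ℂ) (l : ℕ) (m : ℤ) : ℂ := multipole (fun ξ => 1 - W ξ) l m

/-- The diagonal matrix of the `σ_ℓ² = (2ℓ+1) C_ℓ`. -/
def sigmaMatrix (C : ℕ → ℝ) (lmin lmax : ℕ) : Matrix (Band lmin lmax) (Band lmin lmax) ℝ :=
  Matrix.diagonal fun l => (2 * (l.1 : ℝ) + 1) * C l.1

/-- The general term of the sum that defines `Q_{ℓℓ'}`, at the indices `m, m'` and
`(ℓ₁,m₁), …, (ℓ₄,m₄)`. -/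
def qTerm (C : ℕ → ℝ) (W D : S2 → ℂ) (l l' : ℕ) (m m' : ℤ)
    (p : HIdx × HIdx × HIdx × HIdx) : ℂ :=
  (C p.1.1 : ℂ) * wbar W p.2.1.1 p.2.1.2 * conj (wbar W p.2.2.1.1 p.2.2.1.2) *
    multipole D p.2.2.2.1 p.2.2.2.2 *
    gaunt p.1.1 p.2.1.1 l p.1.2 p.2.1.2 m *
    conj (gaunt p.1.1 p.2.2.1.1 l' p.1.2 p.2.2.1.2 m') *
    gaunt l p.2.2.2.1 l' m p.2.2.2.2 m'

/-- The entry `Q_{ℓℓ'}`. -/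
def qEntry (C : ℕ → ℝ) (W D : S2 → ℂ) (l l' : ℕ) : ℂ :=
  ∑ m ∈ Finset.Icc (-(l : ℤ)) (l : ℤ), ∑ m' ∈ Finset.Icc (-(l' : ℤ)) (l' : ℤ),
    ∑' p : HIdx × HIdx × HIdx × HIdx, qTerm C W D l l' m m' p

/-- The matrix `Q`. -/
def qMatrix (C : ℕ → ℝ) (W D : S2 → ℂ) (lmin lmax : ℕ) :
    Matrix (Band lmin lmax) (Band lmin lmax) ℂ :=
  Matrix.of fun l l' => qEntry C W D l.1 l'.1

/-- The general term of the sum that defines `A_{ℓℓ'm}`, at the indices `(ℓ₁, ℓ₂, ℓ₃)`. -/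
def aTerm (C : ℕ → ℝ) (W : S2 → ℂ) (l l' : ℕ) (m : ℤ) (k : ℕ × ℕ × ℕ) : ℂ :=
  (C k.1 : ℂ) * wbar W k.2.1 0 * wbar W k.2.2 0 *
    gaunt k.1 k.2.1 l m 0 m * gaunt k.1 k.2.2 l' m 0 m

/-- The general term of the sum that defines `D_{ℓℓ'm}`, at the index `ℓ₄`. -/
def dTerm (D : S2 → ℂ) (l l' : ℕ) (m : ℤ) (l₄ : ℕ) : ℂ :=
  multipole D l₄ 0 * gaunt l l₄ l' m 0 m

/-- The general term of the reduced sum for axisymmetric weights, at the indices `m` and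
`(ℓ₁, ℓ₂, ℓ₃, ℓ₄)`. -/
def axiTerm (C : ℕ → ℝ) (W D : S2 → ℂ) (l l' : ℕ) (m : ℤ) (k : ℕ × ℕ × ℕ × ℕ) : ℂ :=
  (C k.1 : ℂ) * wbar W k.2.1 0 * wbar W k.2.2.1 0 * multipole D k.2.2.2 0 *
    gaunt k.1 k.2.1 l m 0 m * gaunt k.1 k.2.2.1 l' m 0 m * gaunt l k.2.2.2 l' m 0 m

end

end NeedletMask

/-! Everything rests on one fact: the coefficients `a_{ℓm}` of an isotropic field satisfy `𝔼[a_{ℓm}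
a_{ℓ'm'}^*] = C_ℓ δ_{ℓℓ'} δ_{mm'}` (`IsGaussianIsotropicField.integral_coeff`). Hence the covariance
operator of the field is diagonal in the Hilbert basis of spherical harmonics, and covariances of
linear functionals of the field are sums over `(ℓ₁, m₁)` weighted by `C_{ℓ₁}`
(`integral_inner_complexify`).

The error is `Φ(X(1 - W))` up to normalization. It is a finite combination of the `Y_{ℓm}` whose
coefficients `⟨X(1 - W), Y_{ℓm}⟩` are the functionals of `X` given by the test functions `conj (1 -
W) Y_{ℓm}`. Integrating its squared modulus against `D` gives a finite quadratic form in these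
coefficients, weighted by the couplings `∫ D Y_{ℓm} Y_{ℓ'm'}^*`. Taking the expectation leaves `∑
C_{ℓ₁} w w'^*`, where `w`, `w'` are the couplings of `Y_{ℓ₁m₁}` to `Y_{ℓm}`, `Y_{ℓ'm'}` by `1 - W`.
By Parseval each coupling is a sum of multipole coefficients against Gaunt integrals, and the
product is `Q` (`qTerm_summable_and_tsum`). The denominator comes from the addition theorem on the
diagonal, `∑_m |Y_{ℓm}(ξ)|² = (2ℓ+1)/(4π)`.

Absolute convergence needs two bounds: `∑_{(ℓ,m)} C_ℓ ≤ 𝔼‖X‖² < ∞`, and a bound, uniform in `(ℓ₁,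
m₁)`, on the sums over `(ℓ₂, m₂)` and over `(ℓ₃, m₃)`. The sum over `(ℓ₄, m₄)` is independent of the
others and factors out.

For axisymmetric weights, rotations about the polar axis multiply the integrands by phases. This
kills the multipoles of nonzero order and the couplings between different orders, so only `m₁ = m =
m'` survives.

The facts used about harmonics are proved from Rodrigues' formula: orthonormality (Legendre's
equation and the uniform distribution of the height), completeness (Stone–Weierstrass), and rotation
invariance of each degree (polynomials of bounded degree on the sphere are rotation invariant, and
distinct degrees are orthogonal). -/

namespace NeedletMask

/-! ### Integration of zonal polynomials over the sphere -/

/-- Integration in polar coordinates of `u(x/‖x‖) v(‖x‖)`. -/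
theorem integral_polar (u : S2 → ℝ) (v : ℝ → ℝ) (f : R3 → ℝ)
    (hf : ∀ x : ({(0 : R3)}ᶜ : Set R3), f x =
      u (homeomorphUnitSphereProd R3 x).1 * v (homeomorphUnitSphereProd R3 x).2) :
    ∫ x, f x = (∫ ξ, u ξ ∂surf) * ∫ r in Set.Ioi (0 : ℝ), r ^ 2 * v r := by
  have hdim : Module.finrank ℝ R3 = 3 := by simp
  calc ∫ x, f x = ∫ x : ({(0 : R3)}ᶜ : Set R3), f x ∂((volume : Measure R3).comap (↑)) := by
        rw [integral_subtype_comap (measurableSet_singleton _).compl f,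
          restrict_compl_singleton]
    _ = ∫ p : S2 × Set.Ioi (0 : ℝ), u p.1 * v p.2
          ∂(surf.prod (Measure.volumeIoiPow (Module.finrank ℝ R3 - 1))) := by
        rw [← (volume : Measure R3).measurePreserving_homeomorphUnitSphereProd.integral_comp
          (Homeomorph.measurableEmbedding _)]
        exact integral_congr_ae (.of_forall hf)
    _ = (∫ ξ, u ξ ∂surf) * ∫ r : Set.Ioi (0 : ℝ), v r ∂(Measure.volumeIoiPow 2) := by
        rw [hdim]
        exact integral_prod_mul u (fun r : Set.Ioi (0 : ℝ) => v r)
    _ = _ := by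
        congr 1
        simp only [Measure.volumeIoiPow, ENNReal.ofReal]
        rw [integral_withDensity_eq_integral_smul,
          integral_subtype_comap measurableSet_Ioi fun a ↦ Real.toNNReal (a ^ 2) • v a]
        · refine setIntegral_congr_fun measurableSet_Ioi fun x hx ↦ ?_
          simp only [NNReal.smul_def, Real.coe_toNNReal _ (pow_nonneg (le_of_lt hx) 2), smul_eq_mul]
        · exact (measurable_subtype_coe.pow_const _).real_toNNReal

theorem integral_Ioi_pow_mul_exp (k : ℕ) :
    ∫ r in Set.Ioi (0 : ℝ), r ^ (2 * k) * Real.exp (-r ^ 2) = 1 / 2 * Real.Gamma (k + 1 / 2) := by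
  have h := integral_rpow_mul_exp_neg_rpow (p := 2) (q := 2 * k) (by norm_num)
    (by have : (0 : ℝ) ≤ k := k.cast_nonneg
        linarith)
  have e : ((2 * k : ℝ) + 1) / 2 = k + 1 / 2 := by ring
  rw [e] at h
  rw [← h]
  refine setIntegral_congr_fun measurableSet_Ioi fun x hx ↦ ?_
  have h1 : x ^ (2 * (k : ℝ)) = x ^ (2 * k) := by
    rw [← Real.rpow_natCast]; push_cast; rfl
  simp only [h1, Real.rpow_two]

theorem integral_pow_mul_exp (k : ℕ) :
    ∫ r : ℝ, r ^ (2 * k) * Real.exp (-r ^ 2) = Real.Gamma (k + 1 / 2) := by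
  have h := integral_comp_abs (f := fun r : ℝ => r ^ (2 * k) * Real.exp (-r ^ 2))
  simp only [sq_abs, pow_mul] at h
  simp only [← pow_mul] at h
  rw [h, integral_Ioi_pow_mul_exp]
  ring

/-- The integral of `x₂^{2k} e^{-‖x‖²}` over space is computed twice: Fubini gives `π Γ(k + 1/2)`,
polar coordinates give the surface integral times `Γ(k + 3/2) / 2`. The functional equation of `Γ`
leaves the quotient. -/
theorem integral_height_pow_even (k : ℕ) :
    ∫ ξ : S2, (ξ.1 2) ^ (2 * k) ∂surf = 4 * Real.pi / (2 * k + 1) := by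
  have hpol := integral_polar (fun ξ => (ξ.1 2) ^ (2 * k))
    (fun r => r ^ (2 * k) * Real.exp (-r ^ 2))
    (fun x => (x 2) ^ (2 * k) * Real.exp (-‖x‖ ^ 2)) (by
      intro x
      have hx : ‖(x : R3)‖ ≠ 0 := norm_ne_zero_iff.mpr x.2
      simp only [homeomorphUnitSphereProd_apply_fst_coe, homeomorphUnitSphereProd_apply_snd_coe,
        PiLp.smul_apply, smul_eq_mul]
      rw [← mul_assoc, ← mul_pow, mul_comm ‖(x : R3)‖⁻¹, mul_assoc, inv_mul_cancel₀ hx, mul_one])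
  have hgauss : ∫ x : R3, (x 2) ^ (2 * k) * Real.exp (-‖x‖ ^ 2)
      = Real.pi * Real.Gamma (k + 1 / 2) := by
    rw [← (PiLp.volume_preserving_toLp (Fin 3)).integral_comp
      (MeasurableEquiv.toLp 2 _).measurableEmbedding]
    have e : ∀ y : Fin 3 → ℝ, ((WithLp.toLp 2 y : R3) 2) ^ (2 * k) *
        Real.exp (-‖(WithLp.toLp 2 y : R3)‖ ^ 2)
        = ∏ i, (![fun t : ℝ => Real.exp (-t ^ 2), fun t : ℝ => Real.exp (-t ^ 2),
            fun t : ℝ => t ^ (2 * k) * Real.exp (-t ^ 2)] i) (y i) := by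
      intro y
      rw [EuclideanSpace.norm_sq_eq]
      simp only [Fin.prod_univ_three, Fin.sum_univ_three, Matrix.cons_val_zero,
        Matrix.cons_val_one, Matrix.cons_val, Real.norm_eq_abs, sq_abs, neg_add, Real.exp_add]
      ring
    simp only [e]
    rw [integral_fintype_prod_volume_eq_prod, Fin.prod_univ_three]
    have h0 := integral_pow_mul_exp 0
    simp only [mul_zero, pow_zero, one_mul, Nat.cast_zero, zero_add, Real.Gamma_one_half_eq] at h0
    simp only [Matrix.cons_val_zero, Matrix.cons_val_one, Matrix.cons_val]
    rw [h0, integral_pow_mul_exp, Real.mul_self_sqrt Real.pi_pos.le]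
  rw [hgauss] at hpol
  have e2 : ∀ r : ℝ, r ^ 2 * (r ^ (2 * k) * Real.exp (-r ^ 2))
      = r ^ (2 * (k + 1)) * Real.exp (-r ^ 2) := fun r => by ring
  simp only [e2] at hpol
  rw [integral_Ioi_pow_mul_exp] at hpol
  have hk : (k : ℝ) + 1 / 2 ≠ 0 := by positivity
  have hG : Real.Gamma (k + 1 / 2) ≠ 0 := (Real.Gamma_pos_of_pos (by positivity)).ne'
  have e3 : ((k + 1 : ℕ) : ℝ) + 1 / 2 = (k + 1 / 2) + 1 := by push_cast; ring
  rw [e3, Real.Gamma_add_one hk] at hpol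
  have h4 : Real.pi = (∫ ξ : S2, (ξ.1 2) ^ (2 * k) ∂surf) * ((k + 1 / 2) / 2) := by
    apply mul_right_cancel₀ hG
    rw [hpol]; ring
  rw [eq_div_iff (by positivity)]
  linear_combination (-4) * h4

/-! ### Invariance of surface integrals under isometries, and moments of the height -/

theorem continuous_rotate (g : R3 ≃ₗᵢ[ℝ] R3) : Continuous (rotate g) :=
  Continuous.subtype_mk (g.continuous.comp continuous_subtype_val) _

theorem rotate_symm_rotate (g : R3 ≃ₗᵢ[ℝ] R3) (ξ : S2) : rotate g.symm (rotate g ξ) = ξ := by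
  apply Subtype.ext; simp [rotate]

theorem rotate_rotate_symm (g : R3 ≃ₗᵢ[ℝ] R3) (ξ : S2) : rotate g (rotate g.symm ξ) = ξ := by
  apply Subtype.ext; simp [rotate]

/-- The homeomorphism of the sphere induced by a linear isometry. -/
noncomputable def rotateHomeomorph (g : R3 ≃ₗᵢ[ℝ] R3) : S2 ≃ₜ S2 where
  toFun := rotate g
  invFun := rotate g.symm
  left_inv := rotate_symm_rotate g
  right_inv := rotate_rotate_symm g
  continuous_toFun := continuous_rotate g
  continuous_invFun := continuous_rotate g.symm

theorem integral_comp_rotate {E : Type*} [NormedAddCommGroup E] [NormedSpace ℝ E]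
    (g : R3 ≃ₗᵢ[ℝ] R3) (f : S2 → E) : ∫ ξ, f (rotate g ξ) ∂surf = ∫ ξ, f ξ ∂surf :=
  (measurePreserving_rotate g).integral_comp (rotateHomeomorph g).measurableEmbedding f

theorem integral_height_pow_odd (k : ℕ) :
    ∫ ξ : S2, (ξ.1 2) ^ (2 * k + 1) ∂surf = 0 := by
  have h := integral_comp_rotate (LinearIsometryEquiv.neg ℝ) (fun ξ : S2 => (ξ.1 2) ^ (2 * k + 1))
  have e : ∀ ξ : S2, ((rotate (LinearIsometryEquiv.neg ℝ) ξ).1 2) ^ (2 * k + 1)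
      = -((ξ.1 2) ^ (2 * k + 1)) := fun ξ => by
    simp only [rotate, LinearIsometryEquiv.coe_neg, PiLp.neg_apply]
    exact Odd.neg_pow ⟨k, rfl⟩ _
  simp only [e, integral_neg] at h
  linarith

theorem continuous_coord (i : Fin 3) : Continuous fun ξ : S2 => ξ.1 i := by fun_prop

theorem integrable_of_continuous {E : Type*} [NormedAddCommGroup E] {f : S2 → E}
    (hf : Continuous f) : Integrable f surf :=
  hf.integrable_of_hasCompactSupport (HasCompactSupport.of_compactSpace f)

/-- Archimedes' theorem for polynomials: the height is uniformly distributed on the sphere. -/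
theorem integral_height_polynomial (p : Polynomial ℝ) :
    ∫ ξ : S2, p.eval (ξ.1 2) ∂surf = 2 * Real.pi * ∫ t in (-1 : ℝ)..1, p.eval t := by
  induction p using Polynomial.induction_on' with
  | add p q hp hq =>
    simp only [Polynomial.eval_add]
    rw [integral_add, intervalIntegral.integral_add, hp, hq, mul_add]
    · exact p.continuous.intervalIntegrable _ _
    · exact q.continuous.intervalIntegrable _ _
    · exact integrable_of_continuous (p.continuous.comp (continuous_coord 2))
    · exact integrable_of_continuous (q.continuous.comp (continuous_coord 2))
  | monomial n a =>
    simp only [Polynomial.eval_monomial]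
    rw [integral_const_mul, intervalIntegral.integral_const_mul, integral_pow]
    obtain ⟨k, rfl | rfl⟩ := Nat.even_or_odd' n
    · rw [integral_height_pow_even, Odd.neg_pow ⟨k, rfl⟩]
      push_cast; ring
    · rw [integral_height_pow_odd, Even.neg_pow ⟨k + 1, by ring⟩]
      simp

/-! ### Legendre polynomials -/

section Legendre

open Polynomial

/-- The polynomial `u = (X² - 1)^l` satisfies `(X² - 1) u' = 2 l X u`. Differentiating once gives
the case `n = 0`, and each further derivative raises `n` by one. -/
theorem rodrigues_ode (l n : ℕ) :
    (X ^ 2 - 1 : ℝ[X]) * derivative^[n + 2] ((X ^ 2 - 1) ^ l)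
      + C (2 * (n + 1) - 2 * l : ℝ) * X * derivative^[n + 1] ((X ^ 2 - 1) ^ l)
      + C ((n + 1) * n - 2 * l * (n + 1) : ℝ) * derivative^[n] ((X ^ 2 - 1) ^ l) = 0 := by
  induction n with
  | zero =>
    have h0 : (X ^ 2 - 1 : ℝ[X]) * derivative ((X ^ 2 - 1) ^ l)
        = C (2 * l : ℝ) * X * (X ^ 2 - 1) ^ l := by
      rcases l with _ | l
      · simp
      · simp only [derivative_pow, derivative_sub, derivative_X, derivative_one,
          Nat.cast_add, Nat.cast_one, C_mul, C_add, C_1, Nat.add_sub_cancel]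
        simp only [map_natCast, map_ofNat]
        ring
    have h1 := congrArg derivative h0
    simp only [derivative_mul, derivative_sub, derivative_X, derivative_one, derivative_X_pow,
      derivative_C] at h1
    simp only [Function.iterate_succ, Function.iterate_zero, Function.comp, id, Nat.cast_zero,
      zero_add, mul_one, mul_zero, zero_sub, C_sub, C_neg]
    simp only [C_mul, map_natCast, map_ofNat, Nat.cast_ofNat] at h1 ⊢
    linear_combination h1
  | succ n ih =>
    have h1 := congrArg derivative ih
    simp only [derivative_add, derivative_mul, derivative_sub, derivative_X, derivative_one,
      derivative_X_pow, derivative_C, derivative_zero, ← Function.iterate_succ_apply'] at h1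
    simp only [C_sub, C_mul, C_add, C_1, map_natCast, map_ofNat, Nat.cast_ofNat, Nat.cast_add,
      Nat.cast_one, Nat.succ_eq_add_one] at h1 ⊢
    linear_combination h1

/-- Legendre's differential equation, differentiated `k` times. -/
theorem legendre_ode (l k : ℕ) :
    (X ^ 2 - 1 : ℝ[X]) * derivative^[k + 2] (legendre l)
      + C (2 * (k + 1) : ℝ) * X * derivative^[k + 1] (legendre l)
      + C ((l + k + 1) * (k - l) : ℝ) * derivative^[k] (legendre l) = 0 := by
  have h := rodrigues_ode l (l + k)
  have e : ∀ n, derivative^[n] (legendre l) = C ((2 ^ l * (l.factorial : ℝ))⁻¹) *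
      derivative^[l + n] ((X ^ 2 - 1) ^ l) := fun n => by
    rw [legendre, iterate_derivative_C_mul, ← Function.iterate_add_apply, add_comm n l]
  rw [e, e, e, ← add_assoc, ← add_assoc]
  have c1 : (2 * ((l + k : ℕ) + 1) - 2 * l : ℝ) = 2 * (k + 1) := by push_cast; ring
  have c2 : (((l + k : ℕ) + 1) * (l + k : ℕ) - 2 * l * ((l + k : ℕ) + 1) : ℝ)
      = (l + k + 1) * (k - l) := by push_cast; ring
  rw [c1, c2] at h
  linear_combination (C ((2 ^ l * (l.factorial : ℝ))⁻¹)) * h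

theorem natDegree_rodrigues (l : ℕ) : ((X ^ 2 - 1 : ℝ[X]) ^ l).natDegree = 2 * l := by
  rw [natDegree_pow, show (X ^ 2 - 1 : ℝ[X]) = X ^ 2 - C 1 by simp, natDegree_X_pow_sub_C, mul_comm]

theorem monic_rodrigues (l : ℕ) : ((X ^ 2 - 1 : ℝ[X]) ^ l).Monic := by
  rw [show (X ^ 2 - 1 : ℝ[X]) = X ^ 2 - C 1 by simp]
  exact (monic_X_pow_sub_C _ two_ne_zero).pow l

theorem natDegree_derivative_legendre_le (l m : ℕ) :
    (derivative^[m] (legendre l)).natDegree ≤ l - m := by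
  refine (natDegree_iterate_derivative _ m).trans (Nat.sub_le_sub_right ?_ m)
  refine (natDegree_C_mul_le _ _).trans ((natDegree_iterate_derivative _ l).trans ?_)
  rw [natDegree_rodrigues]; omega

theorem derivative_legendre_eq_zero {l m : ℕ} (h : l < m) : derivative^[m] (legendre l) = 0 := by
  obtain ⟨k, rfl⟩ : ∃ k, m = k + 1 + l := ⟨m - l - 1, by omega⟩
  rw [Function.iterate_add_apply, eq_C_of_natDegree_le_zero
    ((natDegree_derivative_legendre_le l l).trans (by simp))]
  exact iterate_derivative_C (Nat.succ_pos k)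

theorem derivative_legendre_self (l : ℕ) :
    derivative^[l] (legendre l) = C ((2 * l).factorial / (2 ^ l * (l.factorial : ℝ))) := by
  rw [legendre, iterate_derivative_C_mul, ← Function.iterate_add_apply, ← two_mul]
  have h : derivative^[2 * l] ((X ^ 2 - 1 : ℝ[X]) ^ l) = C ((2 * l).factorial : ℝ) := by
    rw [eq_C_of_natDegree_le_zero (p := derivative^[2 * l] ((X ^ 2 - 1 : ℝ[X]) ^ l))
      ((natDegree_iterate_derivative _ _).trans (by rw [natDegree_rodrigues]; simp))]
    rw [coeff_iterate_derivative, zero_add, Nat.descFactorial_self]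
    have := (monic_rodrigues l).coeff_natDegree
    rw [natDegree_rodrigues] at this
    rw [this]; simp
  rw [h, ← C_mul]; congr 1; field_simp

/-- Differentiating `l - m` more times leaves a multiple of this coefficient as constant term, while
the `l`-th derivative of `P_l` is a nonzero constant. The exact degree is what allows leading terms
to be cancelled in `zonal_mul_horizontal_pow_mem`. -/
theorem coeff_derivative_legendre_ne_zero (l m : ℕ) (h : m ≤ l) :
    (derivative^[m] (legendre l)).coeff (l - m) ≠ 0 := by
  intro h0
  have h1 := coeff_iterate_derivative (p := derivative^[m] (legendre l)) (k := l - m) 0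
  rw [← Function.iterate_add_apply, Nat.sub_add_cancel h, derivative_legendre_self, zero_add, h0,
    smul_zero, coeff_C_zero] at h1
  have : (0 : ℝ) < (2 * l).factorial / (2 ^ l * (l.factorial : ℝ)) := by positivity
  exact this.ne' h1

theorem integral_eval_derivative (p : ℝ[X]) :
    ∫ t in (-1 : ℝ)..1, (derivative p).eval t = p.eval 1 - p.eval (-1) :=
  intervalIntegral.integral_eq_sub_of_hasDerivAt (fun t _ => p.hasDerivAt t)
    (p.derivative.continuous.intervalIntegrable _ _)

theorem integral_eval_add (p q : ℝ[X]) : ∫ t in (-1 : ℝ)..1, (p + q).eval t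
    = (∫ t in (-1 : ℝ)..1, p.eval t) + ∫ t in (-1 : ℝ)..1, q.eval t := by
  simp only [eval_add]
  exact intervalIntegral.integral_add (p.continuous.intervalIntegrable _ _)
    (q.continuous.intervalIntegrable _ _)

theorem integral_eval_C_mul (c : ℝ) (q : ℝ[X]) : ∫ t in (-1 : ℝ)..1, (C c * q).eval t
    = c * ∫ t in (-1 : ℝ)..1, q.eval t := by
  simp

/-- The integral of the product of two associated Legendre functions of the same order. -/
noncomputable def assocInner (m a b : ℕ) : ℝ :=
  ∫ t in (-1 : ℝ)..1, ((1 - X ^ 2) ^ m * derivative^[m] (legendre a) *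
    derivative^[m] (legendre b)).eval t

theorem assocInner_comm (m a b : ℕ) : assocInner m a b = assocInner m b a := by
  simp only [assocInner, mul_right_comm]

/-- Integration by parts: the boundary terms vanish because of the factor `(1 - X²)^(m+1)`, and
Legendre's equation in divergence form turns the remaining derivative into a multiple of the
integrand of order `m`. -/
theorem assocInner_succ (m a b : ℕ) :
    assocInner (m + 1) a b = (a + m + 1) * (a - m) * assocInner m a b := by
  have h := integral_eval_derivative ((1 - X ^ 2) ^ (m + 1) * derivative^[m + 1] (legendre a) *
    derivative^[m] (legendre b))
  have e : derivative ((1 - X ^ 2) ^ (m + 1) * derivative^[m + 1] (legendre a) *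
      derivative^[m] (legendre b)) =
      (1 - X ^ 2) ^ (m + 1) * derivative^[m + 1] (legendre a) * derivative^[m + 1] (legendre b)
      + C (-((a + m + 1) * (a - m) : ℝ)) * ((1 - X ^ 2) ^ m * derivative^[m] (legendre a) *
    derivative^[m] (legendre b)) := by
    have ode := legendre_ode a m
    simp only [derivative_mul, derivative_pow, derivative_sub, derivative_X, derivative_one,
      ← Function.iterate_succ_apply', Nat.add_sub_cancel, C_mul, C_add, C_sub, C_1,
      map_natCast, map_ofNat, Nat.cast_add, Nat.cast_one, Nat.succ_eq_add_one, C_neg] at ode ⊢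
    linear_combination (-(1 - X ^ 2) ^ m * derivative^[m] (legendre b)) * ode
  rw [e, integral_eval_add, integral_eval_C_mul] at h
  simp only [eval_mul, eval_pow, eval_sub, eval_one, eval_X] at h
  simp only [assocInner, eval_mul, eval_pow, eval_sub, eval_one, eval_X,
    Function.iterate_succ_apply]
  norm_num at h
  linear_combination h

/-- Self-adjointness of the Legendre operator: by symmetry, `assocInner 1 a b` is both `a(a+1)` and
`b(b+1)` times `assocInner 0 a b`, and `a(a+1) - b(b+1) = (a-b)(a+b+1)`. The recursion carries the
vanishing to higher orders. -/
theorem assocInner_eq_zero {a b : ℕ} (hab : a ≠ b) (m : ℕ) : assocInner m a b = 0 := by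
  induction m with
  | zero =>
    have h1 := assocInner_succ 0 a b
    have h2 := assocInner_succ 0 b a
    rw [assocInner_comm 1 b a, assocInner_comm 0 b a, h1] at h2
    have h3 : ((a : ℝ) - b) * (a + b + 1) * assocInner 0 a b = 0 := by
      push_cast at h2; linear_combination h2
    have h4 : (a : ℝ) - b ≠ 0 := sub_ne_zero.mpr (by exact_mod_cast hab)
    have h5 : (a : ℝ) + b + 1 ≠ 0 := by positivity
    simpa [h4, h5] using h3
  | succ m ih => rw [assocInner_succ, ih, mul_zero]

theorem integral_one_sub_sq_pow (l : ℕ) :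
    ∫ t in (-1 : ℝ)..1, ((1 - X ^ 2 : ℝ[X]) ^ l).eval t
      = 2 ^ (2 * l + 1) * (l.factorial : ℝ) ^ 2 / (2 * l + 1).factorial := by
  induction l with
  | zero => norm_num
  | succ l ih =>
    have h := integral_eval_derivative (X * (1 - X ^ 2) ^ (l + 1))
    have e : derivative (X * (1 - X ^ 2) ^ (l + 1) : ℝ[X])
        = C (2 * l + 3 : ℝ) * (1 - X ^ 2) ^ (l + 1) + C (-(2 * (l + 1)) : ℝ) * (1 - X ^ 2) ^ l := by
      simp only [derivative_mul, derivative_pow, derivative_sub, derivative_X, derivative_one,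
        Nat.add_sub_cancel, C_mul, C_add, C_1,
        map_natCast, map_ofNat, Nat.cast_add, Nat.cast_one, C_neg]
      ring
    rw [e, integral_eval_add, integral_eval_C_mul, integral_eval_C_mul, ih] at h
    simp only [eval_mul, eval_pow, eval_sub, eval_one, eval_X] at h ⊢
    norm_num at h
    have h3 : (2 * l + 3 : ℝ) ≠ 0 := by positivity
    have h4 : ∫ t in (-1 : ℝ)..1, (1 - t ^ 2) ^ (l + 1) = (2 * (l + 1)) / (2 * l + 3) *
        (2 ^ (2 * l + 1) * (l.factorial : ℝ) ^ 2 / (2 * l + 1).factorial) := by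
      field_simp
      field_simp at h
      linear_combination h
    rw [h4, show 2 * (l + 1) + 1 = (2 * l + 1) + 1 + 1 by ring, Nat.factorial_succ (2 * l + 1 + 1),
      Nat.factorial_succ (2 * l + 1), Nat.factorial_succ l]
    push_cast
    have h5 : ((2 * l + 1).factorial : ℝ) ≠ 0 := by positivity
    have h6 : (2 * (l : ℝ) + 1 + 1 + 1) ≠ 0 := by positivity
    field_simp
    ring

theorem assocInner_eq_mul (l m : ℕ) (h : m ≤ l) :
    assocInner m l l = (l + m).factorial / (l - m).factorial * assocInner 0 l l := by
  induction m with
  | zero =>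
    have : (l.factorial : ℝ) ≠ 0 := by positivity
    simp [this]
  | succ m ih =>
    rw [assocInner_succ, ih (by omega), ← add_assoc, Nat.factorial_succ]
    have e : (l - m).factorial = (l - m) * (l - (m + 1)).factorial := by
      rw [show l - m = (l - (m + 1)) + 1 by omega, Nat.factorial_succ]
    rw [e]
    push_cast [Nat.cast_sub (show m ≤ l by omega)]
    have h1 : ((l - (m + 1)).factorial : ℝ) ≠ 0 := by positivity
    have h2 : (l : ℝ) - m ≠ 0 := sub_ne_zero.mpr (by exact_mod_cast (show l ≠ m by omega))
    field_simp

/-- The recursion is used backwards first. At order `m = l` the derivatives are constants, so the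
integral is explicit; this determines the value at order `0`, and then at every order. -/
theorem assocInner_self (l m : ℕ) (h : m ≤ l) :
    assocInner m l l = 2 / (2 * l + 1) * ((l + m).factorial / (l - m).factorial) := by
  have h1 := assocInner_eq_mul l l le_rfl
  have h2 : assocInner l l l = ((2 * l).factorial / (2 ^ l * (l.factorial : ℝ))) ^ 2 *
      (2 ^ (2 * l + 1) * (l.factorial : ℝ) ^ 2 / (2 * l + 1).factorial) := by
    rw [← integral_one_sub_sq_pow, ← integral_eval_C_mul, assocInner, derivative_legendre_self, C_pow]
    congr 1; ext t; congr 1; ring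
  rw [h2, ← two_mul, Nat.sub_self, Nat.factorial_succ] at h1
  have h3 : ((2 * l).factorial : ℝ) ≠ 0 := by positivity
  have h4 : (l.factorial : ℝ) ≠ 0 := by positivity
  have h5 : (2 * (l : ℝ) + 1) ≠ 0 := by positivity
  have h6 : assocInner 0 l l = 2 / (2 * l + 1) := by
    apply mul_left_cancel₀ h3
    push_cast at h1
    simp only [Nat.factorial_zero, Nat.cast_one, div_one] at h1
    rw [← h1]
    field_simp
    ring
  rw [assocInner_eq_mul l m h, h6]; ring

end Legendre

/-! ### Rotations about the polar axis -/

/-- The matrix of the rotation by `φ` about the polar axis. -/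
noncomputable def axisMatrix (φ : ℝ) : Matrix (Fin 3) (Fin 3) ℝ :=
  !![Real.cos φ, -Real.sin φ, 0; Real.sin φ, Real.cos φ, 0; 0, 0, 1]

theorem toEuclideanLin_axisMatrix_apply (φ : ℝ) (x : R3) :
    Matrix.toEuclideanLin (axisMatrix φ) x 0 = Real.cos φ * x 0 - Real.sin φ * x 1 ∧
    Matrix.toEuclideanLin (axisMatrix φ) x 1 = Real.sin φ * x 0 + Real.cos φ * x 1 ∧
    Matrix.toEuclideanLin (axisMatrix φ) x 2 = x 2 := by
  refine ⟨?_, ?_, ?_⟩ <;>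
  (simp [axisMatrix, Matrix.toEuclideanLin, Matrix.mulVec, dotProduct, Fin.sum_univ_three]; try ring)

/-- The rotation by `φ` about the polar axis. -/
noncomputable def axisRotation (φ : ℝ) : R3 ≃ₗᵢ[ℝ] R3 :=
  LinearIsometry.toLinearIsometryEquiv
    { toLinearMap := Matrix.toEuclideanLin (axisMatrix φ)
      norm_map' := fun x => by
        obtain ⟨h0, h1, h2⟩ := toEuclideanLin_axisMatrix_apply φ x
        rw [EuclideanSpace.norm_eq, EuclideanSpace.norm_eq, Fin.sum_univ_three, Fin.sum_univ_three,
          h0, h1, h2]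
        congr 1
        simp only [Real.norm_eq_abs, sq_abs]
        linear_combination (x 0 ^ 2 + x 1 ^ 2) * Real.sin_sq_add_cos_sq φ } rfl

theorem det_axisRotation (φ : ℝ) :
    LinearMap.det ((axisRotation φ).toLinearEquiv : R3 →ₗ[ℝ] R3) = 1 := by
  have e : ((axisRotation φ).toLinearEquiv : R3 →ₗ[ℝ] R3)
      = Matrix.toEuclideanLin (axisMatrix φ) := by
    ext x; rfl
  rw [e, Matrix.toEuclideanLin, Matrix.toLpLin_eq_toLin, LinearMap.det_toLin, Matrix.det_fin_three]
  simp only [axisMatrix, Matrix.of_apply, Matrix.cons_val_zero, Matrix.cons_val_one,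
    Matrix.cons_val]
  linear_combination Real.sin_sq_add_cos_sq φ

/-- The complex number `ξ₀ + i ξ₁`. -/
noncomputable def horizontal (ξ : S2) : ℂ := (ξ.1 0 : ℂ) + (ξ.1 1 : ℂ) * Complex.I

theorem rotate_axisRotation_two (φ : ℝ) (ξ : S2) : (rotate (axisRotation φ) ξ).1 2 = ξ.1 2 :=
  (toEuclideanLin_axisMatrix_apply φ ξ.1).2.2

theorem horizontal_rotate (φ : ℝ) (ξ : S2) :
    horizontal (rotate (axisRotation φ) ξ) = Complex.exp (φ * Complex.I) * horizontal ξ := by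
  have h0 : (rotate (axisRotation φ) ξ).1 0 = _ := (toEuclideanLin_axisMatrix_apply φ ξ.1).1
  have h1 : (rotate (axisRotation φ) ξ).1 1 = _ := (toEuclideanLin_axisMatrix_apply φ ξ.1).2.1
  rw [horizontal, horizontal, h0, h1, Complex.exp_mul_I, ← Complex.ofReal_cos, ← Complex.ofReal_sin]
  push_cast
  linear_combination (-Complex.sin φ * (ξ.1 1 : ℂ)) * Complex.I_sq

theorem horizontal_mul_conj (ξ : S2) :
    horizontal ξ * conj (horizontal ξ) = ((1 - ξ.1 2 ^ 2 : ℝ) : ℂ) := by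
  have h := ξ.2
  rw [mem_sphere_zero_iff_norm] at h
  have h2 := EuclideanSpace.norm_sq_eq ξ.1
  rw [h, Fin.sum_univ_three] at h2
  simp only [Real.norm_eq_abs, sq_abs] at h2
  have h3 : (1 - ξ.1 2 ^ 2 : ℝ) = ξ.1 0 ^ 2 + ξ.1 1 ^ 2 := by linarith
  rw [h3, horizontal]
  simp only [map_add, map_mul, Complex.conj_ofReal, Complex.conj_I]
  push_cast
  linear_combination (-(ξ.1 1 : ℂ) ^ 2) * Complex.I_sq

/-! ### The spherical harmonics -/

/-- The polynomial in the height that multiplies `(ξ₀ + i ξ₁)^m` in `Y_{ℓm}`. -/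
noncomputable def heightPoly (l m : ℕ) : Polynomial ℝ :=
  Polynomial.C (Real.sqrt ((2 * l + 1) / (4 * Real.pi) * ((l - m).factorial / (l + m).factorial)) *
    (-1) ^ m) * Polynomial.derivative^[m] (legendre l)

theorem harmonicNonneg_eq (l m : ℕ) (ξ : S2) :
    harmonicNonneg l m ξ = (((heightPoly l m).eval (ξ.1 2) : ℝ) : ℂ) * horizontal ξ ^ m := by
  rw [harmonicNonneg, heightPoly, horizontal, Polynomial.eval_mul, Polynomial.eval_C, mul_assoc]

theorem Y_of_nonneg (l m : ℕ) (ξ : S2) :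
    Y l m ξ = (((heightPoly l m).eval (ξ.1 2) : ℝ) : ℂ) * horizontal ξ ^ m := by
  rw [Y, if_pos (Int.natCast_nonneg m), Int.natAbs_natCast, harmonicNonneg_eq]

theorem Y_neg (l m : ℕ) (ξ : S2) : Y l (-m) ξ = (-1) ^ m * conj (Y l m ξ) := by
  rcases Nat.eq_zero_or_pos m with rfl | hm
  · have h : Y l ((0 : ℕ) : ℤ) ξ = (((heightPoly l 0).eval (ξ.1 2) : ℝ) : ℂ) := by
      rw [Y_of_nonneg, pow_zero, mul_one]
    simp only [Nat.cast_zero, neg_zero, pow_zero, one_mul] at h ⊢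
    rw [h, Complex.conj_ofReal]
  · rw [Y, if_neg (by omega), Int.natAbs_neg, Int.natAbs_natCast, Y_of_nonneg, harmonicNonneg_eq]

theorem Y_neg_eq (l m : ℕ) (ξ : S2) :
    Y l (-m) ξ = (-1) ^ m * ((((heightPoly l m).eval (ξ.1 2) : ℝ) : ℂ) * conj (horizontal ξ) ^ m) := by
  rw [Y_neg, Y_of_nonneg, map_mul, Complex.conj_ofReal, map_pow]

theorem heightPoly_eq_zero {l m : ℕ} (h : l < m) : heightPoly l m = 0 := by
  rw [heightPoly, derivative_legendre_eq_zero h, mul_zero]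

theorem Y_eq_zero {l : ℕ} {m : ℤ} (h : m ∉ Finset.Icc (-(l : ℤ)) l) (ξ : S2) : Y l m ξ = 0 := by
  rw [Finset.mem_Icc] at h
  obtain ⟨k, rfl | rfl⟩ := Int.eq_nat_or_neg m
  · rw [Y_of_nonneg, heightPoly_eq_zero (show l < k by omega)]; simp
  · rw [Y_neg_eq, heightPoly_eq_zero (show l < k by omega)]; simp

theorem continuous_horizontal : Continuous horizontal := by unfold horizontal; fun_prop

theorem continuous_Y (l : ℕ) (m : ℤ) : Continuous (Y l m) := by
  have hp : ∀ k, Continuous fun ξ : S2 => (((heightPoly l k).eval (ξ.1 2) : ℝ) : ℂ) := fun k =>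
    Complex.continuous_ofReal.comp ((heightPoly l k).continuous.comp (continuous_coord 2))
  have hz := continuous_horizontal
  have hp' := hp m.natAbs
  obtain ⟨k, rfl | rfl⟩ := Int.eq_nat_or_neg m
  · rw [funext (Y_of_nonneg l k)]
    exact (hp k).mul (hz.pow k)
  · rw [funext (Y_neg_eq l k)]
    exact continuous_const.mul ((hp k).mul ((Complex.continuous_conj.comp hz).pow k))

theorem Y_rotate (φ : ℝ) (l : ℕ) (m : ℤ) (ξ : S2) :
    Y l m (rotate (axisRotation φ) ξ) = Complex.exp (m * φ * Complex.I) * Y l m ξ := by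
  have key : ∀ k : ℕ, Y l k (rotate (axisRotation φ) ξ)
      = Complex.exp (k * φ * Complex.I) * Y l k ξ := fun k => by
    rw [Y_of_nonneg, Y_of_nonneg, rotate_axisRotation_two, horizontal_rotate, mul_pow,
      ← Complex.exp_nat_mul, mul_assoc (k : ℂ)]
    ring
  obtain ⟨k, rfl | rfl⟩ := Int.eq_nat_or_neg m
  · exact key k
  · rw [Y_neg, Y_neg, key, map_mul, ← Complex.exp_conj]
    simp only [map_mul, Complex.conj_ofReal, Complex.conj_I, map_natCast, Int.cast_neg,
      Int.cast_natCast]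
    rw [show -(k : ℂ) * φ * Complex.I = k * φ * -Complex.I by ring]
    ring

theorem exists_exp_ne_one {k : ℤ} (hk : k ≠ 0) :
    ∃ φ : ℝ, Complex.exp (k * φ * Complex.I) ≠ 1 := by
  refine ⟨Real.pi / k, ?_⟩
  have hk' : (k : ℂ) ≠ 0 := by exact_mod_cast hk
  have : (k : ℂ) * ((Real.pi / k : ℝ) : ℂ) * Complex.I = Real.pi * Complex.I := by
    push_cast; field_simp
  rw [this, Complex.exp_pi_mul_I]
  norm_num

/-- The integral of a function that picks up the phase `e^{ikφ}` under rotations about the polar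
axis vanishes for `k ≠ 0`. -/
theorem integral_eq_zero_of_phase {f : S2 → ℂ} {k : ℤ} (hk : k ≠ 0)
    (hf : ∀ φ : ℝ, (fun ξ => f (rotate (axisRotation φ) ξ)) =ᵐ[surf]
      fun ξ => Complex.exp (k * φ * Complex.I) * f ξ) :
    ∫ ξ, f ξ ∂surf = 0 := by
  obtain ⟨φ, hφ⟩ := exists_exp_ne_one hk
  have h := integral_comp_rotate (axisRotation φ) f
  rw [integral_congr_ae (hf φ), integral_const_mul] at h
  have h2 : (Complex.exp (k * φ * Complex.I) - 1) * ∫ ξ, f ξ ∂surf = 0 := by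
    rw [sub_mul, h]; ring
  exact (mul_eq_zero.mp h2).resolve_left (sub_ne_zero.mpr hφ)

theorem exp_conj_phase (m : ℤ) (φ : ℝ) :
    conj (Complex.exp (m * φ * Complex.I)) = Complex.exp (-m * φ * Complex.I) := by
  rw [← Complex.exp_conj]
  simp only [map_mul, Complex.conj_ofReal, Complex.conj_I, map_intCast]
  congr 1; ring

theorem integral_Y_mul_conj_Y_of_ne {m m' : ℤ} (h : m ≠ m') (l l' : ℕ) :
    ∫ ξ, Y l m ξ * conj (Y l' m' ξ) ∂surf = 0 := by
  refine integral_eq_zero_of_phase (sub_ne_zero.mpr h) fun φ => .of_forall fun ξ => ?_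
  simp only [Y_rotate, map_mul, exp_conj_phase]
  rw [show ((m - m' : ℤ) : ℂ) * φ * Complex.I = m * φ * Complex.I + -m' * φ * Complex.I by
    push_cast; ring, Complex.exp_add]
  ring

/-- For equal orders the factors `ξ₀ + i ξ₁` combine into powers of `1 - ξ₂²`, so the integrand is a
polynomial in the height and the integral reduces to `assocInner`. -/
theorem integral_Y_mul_conj_Y_nonneg (l l' m : ℕ) :
    ∫ ξ, Y l m ξ * conj (Y l' m ξ) ∂surf = if l = l' ∧ m ≤ l then 1 else 0 := by
  have e : ∀ ξ : S2, Y l m ξ * conj (Y l' m ξ) =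
      (((heightPoly l m * heightPoly l' m * (1 - Polynomial.X ^ 2) ^ m).eval (ξ.1 2) : ℝ) : ℂ) := by
    intro ξ
    simp only [Polynomial.eval_mul, Polynomial.eval_pow, Polynomial.eval_sub, Polynomial.eval_one,
      Polynomial.eval_X]
    rw [Y_of_nonneg, Y_of_nonneg, map_mul, map_pow, Complex.conj_ofReal, Complex.ofReal_mul,
      Complex.ofReal_pow, ← horizontal_mul_conj]
    push_cast
    ring
  simp only [e]
  rw [integral_complex_ofReal, integral_height_polynomial]
  have e2 : heightPoly l m * heightPoly l' m * (1 - Polynomial.X ^ 2) ^ m =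
      Polynomial.C (
        Real.sqrt ((2 * l + 1) / (4 * Real.pi) * ((l - m).factorial / (l + m).factorial)) *
        Real.sqrt ((2 * l' + 1) / (4 * Real.pi) * ((l' - m).factorial / (l' + m).factorial))) *
      ((1 - Polynomial.X ^ 2) ^ m * Polynomial.derivative^[m] (legendre l) *
        Polynomial.derivative^[m] (legendre l')) := by
    have h1 : ((-1 : Polynomial ℝ) ^ m) * (-1) ^ m = 1 := by rw [← mul_pow]; simp
    simp only [heightPoly, Polynomial.C_mul, Polynomial.C_pow, Polynomial.C_neg, Polynomial.C_1]
    generalize Polynomial.C (√((2 * (l : ℝ) + 1) / (4 * Real.pi) *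
      (((l - m).factorial : ℝ) / ((l + m).factorial : ℝ)))) = c1
    generalize Polynomial.C (√((2 * (l' : ℝ) + 1) / (4 * Real.pi) *
      (((l' - m).factorial : ℝ) / ((l' + m).factorial : ℝ)))) = c2
    linear_combination (c1 * c2 * ((1 - Polynomial.X ^ 2) ^ m *
      Polynomial.derivative^[m] (legendre l) * Polynomial.derivative^[m] (legendre l'))) * h1
  rw [e2, integral_eval_C_mul]
  change ((2 * Real.pi * (_ * assocInner m l l') : ℝ) : ℂ) = _
  by_cases hl : l = l'
  · subst hl
    by_cases hm : m ≤ l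
    · rw [if_pos ⟨rfl, hm⟩, assocInner_self l m hm, Real.mul_self_sqrt (by positivity)]
      have h1 : ((l - m).factorial : ℝ) ≠ 0 := by positivity
      have h2 : ((l + m).factorial : ℝ) ≠ 0 := by positivity
      have h3 : (2 * (l : ℝ) + 1) ≠ 0 := by positivity
      rw [← Complex.ofReal_one]
      congr 1
      field_simp [Real.pi_ne_zero]
      ring
    · rw [if_neg (by tauto), assocInner, derivative_legendre_eq_zero (by omega)]
      simp
  · rw [if_neg (by tauto), assocInner_eq_zero hl]
    simp

theorem integral_Y_mul_conj_Y (l l' : ℕ) (m m' : ℤ) :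
    ∫ ξ, Y l m ξ * conj (Y l' m' ξ) ∂surf
      = if l = l' ∧ m = m' ∧ m ∈ Finset.Icc (-(l : ℤ)) l then 1 else 0 := by
  by_cases h : m = m'
  · subst h
    obtain ⟨k, rfl | rfl⟩ := Int.eq_nat_or_neg m
    · rw [integral_Y_mul_conj_Y_nonneg]
      congr 1
      simp only [Finset.mem_Icc, true_and, eq_iff_iff]
      omega
    · have e : ∀ ξ : S2, Y l (-k) ξ * conj (Y l' (-k) ξ) = Y l' k ξ * conj (Y l k ξ) := fun ξ => by
        rw [Y_neg, Y_neg, map_mul, Complex.conj_conj, map_pow, map_neg, map_one]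
        have h1 : ((-1 : ℂ) ^ k) * (-1) ^ k = 1 := by rw [← mul_pow]; simp
        linear_combination (Y l' k ξ * conj (Y l k ξ)) * h1
      simp only [e]
      rw [integral_Y_mul_conj_Y_nonneg]
      congr 1
      simp only [Finset.mem_Icc, true_and, eq_iff_iff]
      omega
  · rw [if_neg (by tauto), integral_Y_mul_conj_Y_of_ne h]

/-! ### Polynomial functions on the sphere -/

/-- The spherical harmonic as a continuous function. -/
noncomputable def contY (l : ℕ) (m : ℤ) : C(S2, ℂ) := ⟨Y l m, continuous_Y l m⟩

/-- A real polynomial in the height, as a continuous function on the sphere. -/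
noncomputable def zonal (p : Polynomial ℝ) : C(S2, ℂ) :=
  ⟨fun ξ => ((p.eval (ξ.1 2) : ℝ) : ℂ),
    Complex.continuous_ofReal.comp (p.continuous.comp (continuous_coord 2))⟩

/-- The function `ξ₀ + i ξ₁` as a continuous function. -/
noncomputable def contHorizontal : C(S2, ℂ) := ⟨horizontal, continuous_horizontal⟩

/-- The coordinates as continuous functions. -/
noncomputable def contCoord (i : Fin 3) : C(S2, ℂ) :=
  ⟨fun ξ => ((ξ.1 i : ℝ) : ℂ), Complex.continuous_ofReal.comp (continuous_coord i)⟩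

/-- The span of the spherical harmonics of degree at most `n`. -/
noncomputable def harmonicSpan (n : ℕ) : Submodule ℂ C(S2, ℂ) :=
  Submodule.span ℂ {f | ∃ k ≤ n, ∃ m : ℤ, f = contY k m}

/-- The restrictions to the sphere of the affine functions. -/
noncomputable def affineSpan : Submodule ℂ C(S2, ℂ) :=
  Submodule.span ℂ (insert 1 (Set.range contCoord))

theorem contY_mem {k n : ℕ} (h : k ≤ n) (m : ℤ) : contY k m ∈ harmonicSpan n :=
  Submodule.subset_span ⟨k, h, m, rfl⟩

theorem harmonicSpan_mono {k n : ℕ} (h : k ≤ n) : harmonicSpan k ≤ harmonicSpan n :=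
  Submodule.span_mono fun _ ⟨j, hj, m, e⟩ => ⟨j, hj.trans h, m, e⟩

theorem contY_natCast (l m : ℕ) : contY l m = zonal (heightPoly l m) * contHorizontal ^ m := by
  ext ξ; exact Y_of_nonneg l m ξ

theorem contY_neg (l m : ℕ) : contY l (-m) = (-1 : ℂ) ^ m • star (contY l m) := by
  ext ξ; exact Y_neg l m ξ

theorem star_contY (l m : ℕ) : star (contY l m) = (-1 : ℂ) ^ m • contY l (-m) := by
  rw [contY_neg, smul_smul, ← mul_pow]; simp

theorem contY_eq_zero {l m : ℕ} (h : l < m) : contY l m = 0 := by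
  ext ξ
  exact Y_eq_zero (m := (m : ℤ)) (l := l) (by rw [Finset.mem_Icc]; omega) ξ

theorem star_mem_harmonicSpan {n : ℕ} {f : C(S2, ℂ)} (hf : f ∈ harmonicSpan n) :
    star f ∈ harmonicSpan n := by
  induction hf using Submodule.span_induction with
  | mem f h =>
    obtain ⟨k, hk, m, rfl⟩ := h
    obtain ⟨j, rfl | rfl⟩ := Int.eq_nat_or_neg m
    · rw [star_contY]; exact Submodule.smul_mem _ _ (contY_mem hk _)
    · rw [contY_neg, star_smul, star_star]; exact Submodule.smul_mem _ _ (contY_mem hk _)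
  | zero => rw [star_zero]; exact Submodule.zero_mem _
  | add f g _ _ hf hg => rw [star_add]; exact Submodule.add_mem _ hf hg
  | smul c f _ hf => rw [star_smul]; exact Submodule.smul_mem _ _ hf

theorem zonal_add (p q : Polynomial ℝ) : zonal (p + q) = zonal p + zonal q := by
  ext ξ; simp [zonal]

theorem zonal_mul (p q : Polynomial ℝ) : zonal (p * q) = zonal p * zonal q := by
  ext ξ; simp [zonal]

theorem zonal_C_mul (c : ℝ) (q : Polynomial ℝ) :
    zonal (Polynomial.C c * q) = (c : ℂ) • zonal q := by
  ext ξ; simp [zonal]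

theorem contHorizontal_mul_star :
    contHorizontal * star contHorizontal = zonal (1 - Polynomial.X ^ 2) := by
  ext ξ
  simpa [zonal, contHorizontal] using! horizontal_mul_conj ξ

theorem natDegree_heightPoly_le (l m : ℕ) : (heightPoly l m).natDegree ≤ l - m :=
  (Polynomial.natDegree_C_mul_le _ _).trans (natDegree_derivative_legendre_le l m)

theorem coeff_heightPoly_ne_zero {l m : ℕ} (h : m ≤ l) : (heightPoly l m).coeff (l - m) ≠ 0 := by
  rw [heightPoly, Polynomial.coeff_C_mul]
  refine mul_ne_zero (mul_ne_zero ?_ (pow_ne_zero _ (by norm_num)))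
    (coeff_derivative_legendre_ne_zero l m h)
  exact (Real.sqrt_pos.mpr (by positivity)).ne'

/-- Induction on the degree: `heightPoly (d + b) b` has degree exactly `d`, so a multiple of it
cancels the leading term and the remainder is of lower degree. -/
theorem zonal_mul_horizontal_pow_mem (b d : ℕ) (p : Polynomial ℝ) (hp : p.natDegree ≤ d) :
    zonal p * contHorizontal ^ b ∈ harmonicSpan (d + b) := by
  induction d generalizing p with
  | zero =>
    have hq := coeff_heightPoly_ne_zero (le_refl b)
    have hq2 := natDegree_heightPoly_le b b
    rw [Nat.sub_self] at hq hq2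
    have e : p = Polynomial.C (p.coeff 0 / (heightPoly b b).coeff 0) * heightPoly b b := by
      rw [Polynomial.eq_C_of_natDegree_le_zero hp, Polynomial.eq_C_of_natDegree_le_zero hq2,
        ← Polynomial.C_mul]
      congr 1
      simp only [Polynomial.coeff_C_zero]
      field_simp
    rw [e, zonal_C_mul, smul_mul_assoc, ← contY_natCast]
    exact Submodule.smul_mem _ _ (contY_mem (by omega) _)
  | succ d ih =>
    have hq := coeff_heightPoly_ne_zero (show b ≤ d + 1 + b by omega)
    have hq2 := natDegree_heightPoly_le (d + 1 + b) b
    rw [Nat.add_sub_cancel] at hq hq2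
    set q := heightPoly (d + 1 + b) b with hqdef
    set c := p.coeff (d + 1) / q.coeff (d + 1)
    have hr : (p - Polynomial.C c * q).natDegree ≤ d := by
      refine Polynomial.natDegree_le_pred (n := d + 1) ?_ ?_
      · exact (Polynomial.natDegree_sub_le_of_le hp
          ((Polynomial.natDegree_C_mul_le c q).trans hq2)).trans (max_self _).le
      · rw [Polynomial.coeff_sub, Polynomial.coeff_C_mul, div_mul_cancel₀ _ hq, sub_self]
    have e : p = (p - Polynomial.C c * q) + Polynomial.C c * q := by ring
    rw [e, zonal_add, add_mul, zonal_C_mul, smul_mul_assoc, hqdef, ← contY_natCast]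
    refine Submodule.add_mem _ ?_ (Submodule.smul_mem _ _ (contY_mem le_rfl _))
    exact harmonicSpan_mono (by omega) (ih _ hr)

theorem zonal_X : zonal Polynomial.X = contCoord 2 := by
  ext ξ; simp [zonal, contCoord]

theorem zonal_one : zonal 1 = 1 := by
  ext ξ; simp [zonal]

theorem contY_mul_mem_aux (k m : ℕ) :
    contY k m * contCoord 2 ∈ harmonicSpan (k + 1) ∧
    contY k m * contHorizontal ∈ harmonicSpan (k + 1) ∧
    contY k m * star contHorizontal ∈ harmonicSpan (k + 1) := by
  rcases lt_or_ge k m with hkm | hkm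
  · simp [contY_eq_zero hkm]
  have hd := natDegree_heightPoly_le k m
  refine ⟨?_, ?_, ?_⟩
  · have e : contY k m * contCoord 2
        = zonal (heightPoly k m * Polynomial.X) * contHorizontal ^ m := by
      rw [contY_natCast, zonal_mul, zonal_X]; ring
    rw [e, show k + 1 = (k - m + 1) + m by omega]
    exact zonal_mul_horizontal_pow_mem _ _ _
      (Polynomial.natDegree_mul_le_of_le hd Polynomial.natDegree_X_le)
  · have e : contY k m * contHorizontal = zonal (heightPoly k m) * contHorizontal ^ (m + 1) := by
      rw [contY_natCast]; ring
    rw [e, show k + 1 = (k - m) + (m + 1) by omega]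
    exact zonal_mul_horizontal_pow_mem _ _ _ hd
  -- For positive order, one factor `ξ₀ + i ξ₁` is absorbed by its conjugate and yields `1 - ξ₂²`.
  -- For order zero there is none to absorb, and the product is the conjugate of an element already
  -- treated.
  · rcases m with _ | m
    · have e : contY k (0 : ℕ) * star contHorizontal
          = star (zonal (heightPoly k 0) * contHorizontal ^ 1) := by
        have hz : star (zonal (heightPoly k 0)) = zonal (heightPoly k 0) := by
          ext ξ; simp [zonal]
        rw [contY_natCast, star_mul, hz]; ring
      rw [e]
      exact star_mem_harmonicSpan (zonal_mul_horizontal_pow_mem _ _ _ hd)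
    · have e : contY k (m + 1 : ℕ) * star contHorizontal
          = zonal (heightPoly k (m + 1) * (1 - Polynomial.X ^ 2)) * contHorizontal ^ m := by
        rw [contY_natCast, zonal_mul, ← contHorizontal_mul_star]; ring
      rw [e, show k + 1 = (k - (m + 1) + 2) + m by omega]
      refine zonal_mul_horizontal_pow_mem _ _ _ (Polynomial.natDegree_mul_le_of_le hd ?_)
      refine (Polynomial.natDegree_sub_le _ _).trans ?_
      simp

theorem contY_mul_mem (k : ℕ) (m : ℤ) :
    contY k m * contCoord 2 ∈ harmonicSpan (k + 1) ∧
    contY k m * contHorizontal ∈ harmonicSpan (k + 1) ∧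
    contY k m * star contHorizontal ∈ harmonicSpan (k + 1) := by
  obtain ⟨j, rfl | rfl⟩ := Int.eq_nat_or_neg m
  · exact contY_mul_mem_aux k j
  · obtain ⟨h1, h2, h3⟩ := contY_mul_mem_aux k j
    have hz : star (contCoord 2) = contCoord 2 := by ext ξ; simp [contCoord]
    refine ⟨?_, ?_, ?_⟩
    · have := star_mem_harmonicSpan h1
      rw [star_mul, hz, mul_comm] at this
      rw [contY_neg, smul_mul_assoc]; exact Submodule.smul_mem _ _ this
    · have := star_mem_harmonicSpan h3
      rw [star_mul, star_star, mul_comm] at this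
      rw [contY_neg, smul_mul_assoc]; exact Submodule.smul_mem _ _ this
    · have := star_mem_harmonicSpan h2
      rw [star_mul, mul_comm] at this
      rw [contY_neg, smul_mul_assoc]; exact Submodule.smul_mem _ _ this

theorem contCoord_zero : contCoord 0 = (1 / 2 : ℂ) • (contHorizontal + star contHorizontal) := by
  ext ξ
  simp [contCoord, contHorizontal, horizontal]
  ring

theorem contCoord_one :
    contCoord 1 = (-Complex.I / 2 : ℂ) • (contHorizontal - star contHorizontal) := by
  ext ξ
  simp [contCoord, contHorizontal, horizontal]
  linear_combination (ξ.1 1 : ℂ) * Complex.I_sq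

theorem harmonicSpan_mul_affineSpan_le (n : ℕ) :
    harmonicSpan n * affineSpan ≤ harmonicSpan (n + 1) := by
  rw [harmonicSpan, affineSpan, Submodule.span_mul_span, Submodule.span_le]
  rintro _ ⟨_, ⟨k, hk, m, rfl⟩, v, hv, rfl⟩
  obtain ⟨h1, h2, h3⟩ := contY_mul_mem k m
  have hle : harmonicSpan (k + 1) ≤ harmonicSpan (n + 1) := harmonicSpan_mono (by omega)
  rcases hv with rfl | ⟨i, rfl⟩
  · simpa using! contY_mem (show k ≤ n + 1 by omega) m
  · refine hle ?_
    fin_cases i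
    · change contY k m * contCoord 0 ∈ _
      rw [contCoord_zero, mul_smul_comm, mul_add]
      exact Submodule.smul_mem _ _ (Submodule.add_mem _ h2 h3)
    · change contY k m * contCoord 1 ∈ _
      rw [contCoord_one, mul_smul_comm, mul_sub]
      exact Submodule.smul_mem _ _ (Submodule.sub_mem _ h2 h3)
    · exact h1

/-- Together with `contY_mem_affineSpan_pow`, this identifies the polynomial functions of degree at
most `n` with the span of the harmonics of degree at most `n`. The first description is visibly
stable under rotations and products, the second has an orthonormal spanning family. -/
theorem affineSpan_pow_le (n : ℕ) : affineSpan ^ n ≤ harmonicSpan n := by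
  induction n with
  | zero =>
    rw [Submodule.pow_zero, Submodule.one_le]
    have := zonal_mul_horizontal_pow_mem 0 0 1 (by simp)
    simpa [zonal_one] using this
  | succ n ih =>
    rw [Submodule.pow_succ]
    exact (mul_le_mul' ih le_rfl).trans (harmonicSpan_mul_affineSpan_le n)

theorem one_le_affineSpan : 1 ≤ affineSpan := by
  rw [Submodule.one_le]; exact Submodule.subset_span (Set.mem_insert _ _)

theorem contCoord_mem (i : Fin 3) : contCoord i ∈ affineSpan :=
  Submodule.subset_span (Set.mem_insert_of_mem _ ⟨i, rfl⟩)

theorem contHorizontal_mem : contHorizontal ∈ affineSpan := by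
  have e : contHorizontal = contCoord 0 + Complex.I • contCoord 1 := by
    ext ξ; simp [contHorizontal, horizontal, contCoord, mul_comm]
  rw [e]
  exact Submodule.add_mem _ (contCoord_mem 0) (Submodule.smul_mem _ _ (contCoord_mem 1))

theorem affineSpan_pow_mono {k n : ℕ} (h : k ≤ n) : affineSpan ^ k ≤ affineSpan ^ n := by
  induction n, h using Nat.le_induction with
  | base => exact le_rfl
  | succ n _ ih =>
    rw [Submodule.pow_succ]
    exact ih.trans ((Submodule.mul_one _).symm.le.trans
      (mul_le_mul' le_rfl one_le_affineSpan))

theorem mul_mem_affineSpan_pow {k n : ℕ} {f g : C(S2, ℂ)} (hf : f ∈ affineSpan ^ k)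
    (hg : g ∈ affineSpan ^ n) : f * g ∈ affineSpan ^ (k + n) := by
  rcases Nat.eq_zero_or_pos k with rfl | hk
  · rw [Submodule.pow_zero] at hf
    rw [Nat.zero_add, ← Submodule.one_mul (affineSpan ^ n)]
    exact Submodule.mul_mem_mul hf hg
  · rw [add_comm, mul_comm, Submodule.pow_add _ hk.ne']
    exact Submodule.mul_mem_mul hg hf

theorem zonal_mem {p : Polynomial ℝ} {d : ℕ} (hp : p.natDegree ≤ d) :
    zonal p ∈ affineSpan ^ d := by
  refine Polynomial.induction_with_natDegree_le (fun p => zonal p ∈ affineSpan ^ d) d ?_ ?_ ?_ p hp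
  · have e : zonal 0 = 0 := by ext ξ; simp [zonal]
    rw [e]; exact Submodule.zero_mem _
  · intro n r _ hn
    have e : ∀ n : ℕ, zonal (Polynomial.X ^ n) = contCoord 2 ^ n := fun n => by
      ext ξ; simp [zonal, contCoord]
    rw [zonal_C_mul, e]
    exact Submodule.smul_mem _ _ (affineSpan_pow_mono hn
      (Submodule.pow_mem_pow _ (contCoord_mem 2) n))
  · intro f g _ _ hf hg
    rw [zonal_add]; exact Submodule.add_mem _ hf hg

theorem star_mem_affineSpan_pow {n : ℕ} {f : C(S2, ℂ)} (hf : f ∈ affineSpan ^ n) :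
    star f ∈ affineSpan ^ n := by
  have h1 : ∀ f ∈ affineSpan, star f ∈ affineSpan := fun f hf => by
    induction hf using Submodule.span_induction with
    | mem f h =>
      rcases h with rfl | ⟨i, rfl⟩
      · rw [star_one]; exact Submodule.subset_span (Set.mem_insert _ _)
      · have e : star (contCoord i) = contCoord i := by ext ξ; simp [contCoord]
        rw [e]; exact contCoord_mem i
    | zero => rw [star_zero]; exact Submodule.zero_mem _
    | add f g _ _ hf hg => rw [star_add]; exact Submodule.add_mem _ hf hg
    | smul c f _ hf => rw [star_smul]; exact Submodule.smul_mem _ _ hf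
  induction n generalizing f with
  | zero =>
    rw [Submodule.pow_zero, Submodule.mem_one] at hf ⊢
    obtain ⟨c, rfl⟩ := hf
    exact ⟨star c, by ext ξ; simp⟩
  | succ n ih =>
    rw [Submodule.pow_succ] at hf ⊢
    induction hf using Submodule.mul_induction_on' with
    | mem_mul_mem f hf g hg =>
      rw [star_mul, mul_comm]; exact Submodule.mul_mem_mul (ih hf) (h1 g hg)
    | add f _ g _ hf hg => rw [star_add]; exact Submodule.add_mem _ hf hg

theorem contY_mem_affineSpan_pow (l : ℕ) (m : ℤ) : contY l m ∈ affineSpan ^ l := by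
  have key : ∀ k : ℕ, contY l k ∈ affineSpan ^ l := fun k => by
    rcases lt_or_ge l k with h | h
    · rw [contY_eq_zero h]; exact Submodule.zero_mem _
    · rw [contY_natCast, show affineSpan ^ l = affineSpan ^ ((l - k) + k) by
        rw [Nat.sub_add_cancel h]]
      exact mul_mem_affineSpan_pow (zonal_mem (natDegree_heightPoly_le l k))
        (Submodule.pow_mem_pow _ contHorizontal_mem k)
  obtain ⟨k, rfl | rfl⟩ := Int.eq_nat_or_neg m
  · exact key k
  · rw [contY_neg]; exact Submodule.smul_mem _ _ (star_mem_affineSpan_pow (key k))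

/-! ### Rotations of the spaces of polynomial functions -/

/-- Composition with a rotation, on continuous functions. -/
noncomputable def compRotate (g : R3 ≃ₗᵢ[ℝ] R3) (f : C(S2, ℂ)) : C(S2, ℂ) :=
  f.comp ⟨rotate g, continuous_rotate g⟩

theorem compRotate_mem_affineSpan_pow (g : R3 ≃ₗᵢ[ℝ] R3) {n : ℕ} {f : C(S2, ℂ)}
    (hf : f ∈ affineSpan ^ n) : compRotate g f ∈ affineSpan ^ n := by
  have h1 : ∀ f ∈ affineSpan, compRotate g f ∈ affineSpan := fun f hf => by
    induction hf using Submodule.span_induction with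
    | mem f h =>
      rcases h with rfl | ⟨i, rfl⟩
      · exact Submodule.subset_span (Set.mem_insert _ _)
      · have e : compRotate g (contCoord i)
            = ∑ j : Fin 3, ((g (EuclideanSpace.single j 1) i : ℝ) : ℂ) • contCoord j := by
          ext ξ
          have h : ξ.1 = ∑ j : Fin 3, ξ.1 j • EuclideanSpace.single j (1 : ℝ) := by
            ext k; simp [Fin.sum_univ_three]; fin_cases k <;> simp
          have h2 : (rotate g ξ).1 i = ∑ j : Fin 3, ξ.1 j * g (EuclideanSpace.single j 1) i := by
            change g ξ.1 i = _
            conv_lhs => rw [h]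
            simp [Fin.sum_univ_three]
          simp only [ContinuousMap.coe_sum, Finset.sum_apply, ContinuousMap.coe_smul, Pi.smul_apply]
          change (((rotate g ξ).1 i : ℝ) : ℂ) = ∑ j, _ * ((ξ.1 j : ℝ) : ℂ)
          rw [h2]; push_cast
          exact Finset.sum_congr rfl fun j _ => mul_comm _ _
        rw [e]
        exact Submodule.sum_mem _ fun j _ => Submodule.smul_mem _ _ (contCoord_mem j)
    | zero => exact Submodule.zero_mem _
    | add f g _ _ hf hg => exact Submodule.add_mem _ hf hg
    | smul c f _ hf => exact Submodule.smul_mem _ c hf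
  induction n generalizing f with
  | zero =>
    rw [Submodule.pow_zero, Submodule.mem_one] at hf ⊢
    obtain ⟨c, rfl⟩ := hf
    exact ⟨c, rfl⟩
  | succ n ih =>
    rw [Submodule.pow_succ] at hf ⊢
    induction hf using Submodule.mul_induction_on' with
    | mem_mul_mem f hf g hg => exact Submodule.mul_mem_mul (ih hf) (h1 g hg)
    | add f _ g _ hf hg => exact Submodule.add_mem _ hf hg

/-! ### Multipole coefficients and finite harmonic expansions -/

theorem integrable_mul_conj_Y {f : S2 → ℂ} (hf : Integrable f surf) (l : ℕ) (m : ℤ) :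
    Integrable (fun ξ => f ξ * conj (Y l m ξ)) surf := by
  have hc : Continuous fun ξ => conj (Y l m ξ) := Complex.continuous_conj.comp (continuous_Y l m)
  obtain ⟨c, hc'⟩ := isCompact_univ.exists_bound_of_continuousOn hc.continuousOn
  exact hf.mul_bdd (c := c) hc.aestronglyMeasurable (.of_forall fun ξ => hc' ξ (Set.mem_univ _))

theorem multipole_add {f g : S2 → ℂ} (hf : Integrable f surf) (hg : Integrable g surf) (l : ℕ)
    (m : ℤ) : multipole (fun ξ => f ξ + g ξ) l m = multipole f l m + multipole g l m := by
  simp only [multipole, add_mul]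
  exact integral_add (integrable_mul_conj_Y hf l m) (integrable_mul_conj_Y hg l m)

theorem multipole_sub {f g : S2 → ℂ} (hf : Integrable f surf) (hg : Integrable g surf) (l : ℕ)
    (m : ℤ) : multipole (fun ξ => f ξ - g ξ) l m = multipole f l m - multipole g l m := by
  simp only [multipole, sub_mul]
  exact integral_sub (integrable_mul_conj_Y hf l m) (integrable_mul_conj_Y hg l m)

theorem multipole_const_mul (c : ℂ) (f : S2 → ℂ) (l : ℕ) (m : ℤ) :
    multipole (fun ξ => c * f ξ) l m = c * multipole f l m := by
  simp only [multipole, mul_assoc]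
  exact integral_const_mul _ _

theorem multipole_Y (l l' : ℕ) (m m' : ℤ) : multipole (Y l m) l' m'
    = if l = l' ∧ m = m' ∧ m ∈ Finset.Icc (-(l : ℤ)) l then 1 else 0 :=
  integral_Y_mul_conj_Y l l' m m'

theorem integrable_contMap (f : C(S2, ℂ)) : Integrable f surf := integrable_of_continuous f.continuous

theorem eq_sum_of_mem_harmonicSpan {n : ℕ} {f : C(S2, ℂ)} (hf : f ∈ harmonicSpan n) (ξ : S2) :
    f ξ = ∑ k ∈ Finset.range (n + 1), ∑ m ∈ Finset.Icc (-(k : ℤ)) k,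
      multipole f k m * Y k m ξ := by
  induction hf using Submodule.span_induction with
  | mem f h =>
    obtain ⟨k, hk, m, rfl⟩ := h
    change Y k m ξ = ∑ k' ∈ Finset.range (n + 1), ∑ m' ∈ Finset.Icc (-(k' : ℤ)) k',
      multipole (Y k m) k' m' * Y k' m' ξ
    rw [Finset.sum_eq_single k]
    · by_cases hm : m ∈ Finset.Icc (-(k : ℤ)) k
      · rw [Finset.sum_eq_single m]
        · rw [multipole_Y, if_pos ⟨rfl, rfl, hm⟩, one_mul]
        · intro m' _ hne
          rw [multipole_Y, if_neg (fun h => hne h.2.1.symm), zero_mul]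
        · exact fun h => absurd hm h
      · rw [Y_eq_zero hm]
        refine (Finset.sum_eq_zero fun m' _ => ?_).symm
        rw [multipole_Y, if_neg (fun h => hm h.2.2), zero_mul]
    · intro k' _ hne
      refine Finset.sum_eq_zero fun m' _ => ?_
      rw [multipole_Y, if_neg (fun h => hne h.1.symm), zero_mul]
    · intro h; rw [Finset.mem_range] at h; omega
  | zero => simp [multipole]
  | add f g _ _ hf hg =>
    rw [ContinuousMap.add_apply, hf, hg, ← Finset.sum_add_distrib]
    refine Finset.sum_congr rfl fun k _ => ?_
    rw [← Finset.sum_add_distrib]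
    refine Finset.sum_congr rfl fun m _ => ?_
    have := multipole_add (integrable_contMap f) (integrable_contMap g) k m
    rw [show (⇑(f + g) : S2 → ℂ) = fun ξ => f ξ + g ξ from rfl, this, add_mul]
  | smul c f _ hf =>
    rw [ContinuousMap.smul_apply, hf, Finset.smul_sum]
    refine Finset.sum_congr rfl fun k _ => ?_
    rw [Finset.smul_sum]
    refine Finset.sum_congr rfl fun m _ => ?_
    rw [show (⇑(c • f) : S2 → ℂ) = fun ξ => c * f ξ from rfl, multipole_const_mul, smul_eq_mul,
      mul_assoc]

theorem multipole_eq_zero_of_mem_harmonicSpan {n : ℕ} {f : C(S2, ℂ)} (hf : f ∈ harmonicSpan n)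
    {l : ℕ} (hl : n < l) (m : ℤ) : multipole f l m = 0 := by
  induction hf using Submodule.span_induction with
  | mem f h =>
    obtain ⟨k, hk, m', rfl⟩ := h
    exact (multipole_Y k l m' m).trans (if_neg (by omega))
  | zero => simp [multipole]
  | add f g _ _ hf hg =>
    have := multipole_add (integrable_contMap f) (integrable_contMap g) l m
    rw [hf, hg, add_zero] at this
    exact this
  | smul c f _ hf =>
    have := multipole_const_mul c f l m
    rw [hf, mul_zero] at this
    exact this

/-- The spherical harmonics of a given degree span a rotation-invariant space. -/
theorem Y_rotate_eq_sum (g : R3 ≃ₗᵢ[ℝ] R3) (l : ℕ) (m : ℤ) (ξ : S2) :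
    Y l m (rotate g ξ) = ∑ m' ∈ Finset.Icc (-(l : ℤ)) l,
      multipole (fun η => Y l m (rotate g η)) l m' * Y l m' ξ := by
  have hmem : ∀ g k m, compRotate g (contY k m) ∈ harmonicSpan k := fun g k m =>
    affineSpan_pow_le k (compRotate_mem_affineSpan_pow g (contY_mem_affineSpan_pow k m))
  have h := eq_sum_of_mem_harmonicSpan (hmem g l m) ξ
  change Y l m (rotate g ξ) = _ at h
  rw [h, Finset.sum_range_succ, Finset.sum_eq_zero, zero_add]
  · rfl
  · intro k hk
    rw [Finset.mem_range] at hk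
    refine Finset.sum_eq_zero fun m' _ => ?_
    -- Components of degree `k < l` vanish: by change of variables they are conjugate to degree-`l`
    -- coefficients of a harmonic of degree `k` rotated by the inverse, which is a polynomial of
    -- degree at most `k`.
    have h0 := multipole_eq_zero_of_mem_harmonicSpan (hmem g.symm k m') hk m
    have h1 : multipole (compRotate g (contY l m)) k m' = conj (multipole
        (compRotate g.symm (contY k m')) l m) := by
      rw [multipole, multipole, ← integral_conj, ← integral_comp_rotate g.symm]
      refine integral_congr_ae (.of_forall fun η => ?_)
      change Y l m (rotate g (rotate g.symm η)) * conj (Y k m' (rotate g.symm η))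
        = conj (Y k m' (rotate g.symm η) * conj (Y l m η))
      rw [rotate_rotate_symm, map_mul, Complex.conj_conj, mul_comm]
    rw [h1, h0, map_zero, zero_mul]

/-! ### Rotation invariance of the reproducing kernel -/

/-- The reproducing kernel of the spherical harmonics of degree `l`. -/
noncomputable def zonalKernel (l : ℕ) (ξ η : S2) : ℂ :=
  ∑ m ∈ Finset.Icc (-(l : ℤ)) l, Y l m ξ * conj (Y l m η)

/-- A rotation acts on the harmonics of degree `l` through a matrix `U`, which is unitary because
rotations preserve the orthonormality relations; the kernel is the invariant Hermitian form. -/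
theorem zonalKernel_rotate (g : R3 ≃ₗᵢ[ℝ] R3) (l : ℕ) (ξ η : S2) :
    zonalKernel l (rotate g ξ) (rotate g η) = zonalKernel l ξ η := by
  let I := ↥(Finset.Icc (-(l : ℤ)) l)
  let U : Matrix I I ℂ := fun m m' => multipole (fun η => Y l m (rotate g η)) l m'
  have hY : ∀ (m : I) ξ, Y l m (rotate g ξ) = ∑ m' : I, U m m' * Y l m' ξ := fun m ξ => by
    rw [Y_rotate_eq_sum]
    exact (Finset.sum_coe_sort (Finset.Icc (-(l : ℤ)) l)
      (fun m' => multipole (fun η => Y l m (rotate g η)) l m' * Y l m' ξ)).symm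
  have hU : U * Uᴴ = 1 := by
    ext m n
    have h1 : ∫ ξ, Y l m (rotate g ξ) * conj (Y l n (rotate g ξ)) ∂surf = if m = n then 1 else 0 := by
      rw [integral_comp_rotate g (fun ξ => Y l m ξ * conj (Y l n ξ)), integral_Y_mul_conj_Y]
      congr 1
      simp only [true_and, eq_iff_iff, m.2, and_true]
      exact Subtype.ext_iff.symm
    rw [Matrix.one_apply, ← h1, Matrix.mul_apply]
    have hc : Continuous fun ξ => Y l m (rotate g ξ) := (continuous_Y l m).comp (continuous_rotate g)
    have e : ∀ ξ, Y l m (rotate g ξ) * conj (Y l n (rotate g ξ))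
        = ∑ m' : I, conj (U n m') * (Y l m (rotate g ξ) * conj (Y l m' ξ)) := fun ξ => by
      rw [hY n, map_sum, Finset.mul_sum]
      refine Finset.sum_congr rfl fun m' _ => ?_
      rw [map_mul]; ring
    simp only [e]
    rw [integral_finsetSum]
    · refine Finset.sum_congr rfl fun m' _ => ?_
      rw [integral_const_mul, Matrix.conjTranspose_apply, mul_comm]
      rfl
    · intro m' _
      exact (integrable_mul_conj_Y (integrable_of_continuous hc) l m').const_mul _
  -- Orthonormality of the rotated family gives `U Uᴴ = 1`. The kernel needs the other order, which
  -- follows since `U` is a finite square matrix.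
  have hU' : Uᴴ * U = 1 := mul_eq_one_comm.mp hU
  have hsum : ∀ ξ η, zonalKernel l ξ η = ∑ m : I, Y l m ξ * conj (Y l m η) := fun ξ η =>
    (Finset.sum_coe_sort (Finset.Icc (-(l : ℤ)) l) (fun m => Y l m ξ * conj (Y l m η))).symm
  have hent : ∀ a b : I, ∑ m, conj (U m a) * U m b = if a = b then 1 else 0 := fun a b => by
    have := congrFun (congrFun hU' a) b
    rw [Matrix.one_apply, Matrix.mul_apply] at this
    exact this
  rw [hsum, hsum]
  calc ∑ m : I, Y l m (rotate g ξ) * conj (Y l m (rotate g η))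
      = ∑ m : I, ∑ b : I, ∑ a : I, (conj (U m a) * U m b) * (Y l b ξ * conj (Y l a η)) := by
        refine Finset.sum_congr rfl fun m _ => ?_
        rw [hY, hY, map_sum, Finset.sum_mul_sum]
        refine Finset.sum_congr rfl fun b _ => Finset.sum_congr rfl fun a _ => ?_
        rw [map_mul]; ring
    _ = ∑ b : I, ∑ a : I, (∑ m : I, conj (U m a) * U m b) * (Y l b ξ * conj (Y l a η)) := by
        rw [Finset.sum_comm]
        refine Finset.sum_congr rfl fun b _ => ?_
        rw [Finset.sum_comm]
        exact Finset.sum_congr rfl fun a _ => (Finset.sum_mul _ _ _).symm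
    _ = _ := by
        refine Finset.sum_congr rfl fun b _ => ?_
        simp only [hent, ite_mul, one_mul, zero_mul, Finset.sum_ite_eq', Finset.mem_univ, if_true]

/-! ### Transitivity of the rotations and the diagonal of the reproducing kernel -/

theorem det_reflection_hyperplane {v : R3} (hv : v ≠ 0) :
    LinearMap.det ((Submodule.reflection (ℝ ∙ v)ᗮ).toLinearEquiv : R3 →ₗ[ℝ] R3) = -1 := by
  have h := Submodule.det_reflection (K := (ℝ ∙ v)ᗮ)
  rw [Submodule.orthogonal_orthogonal, finrank_span_singleton hv, pow_one] at h
  exact h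

/-- The reflection that exchanges `ξ` and `η` has determinant `-1`. A second reflection, in a plane
through `η`, fixes `η` and restores determinant `1`. -/
theorem exists_rotation (ξ η : S2) : ∃ g : R3 ≃ₗᵢ[ℝ] R3,
    LinearMap.det (g.toLinearEquiv : R3 →ₗ[ℝ] R3) = 1 ∧ rotate g ξ = η := by
  by_cases h : ξ = η
  · exact ⟨LinearIsometryEquiv.refl ℝ R3, LinearMap.det_id, by rw [h]; rfl⟩
  have hne : ξ.1 - η.1 ≠ 0 := sub_ne_zero.mpr fun e => h (Subtype.ext e)
  have hnorm : ∀ ζ : S2, ‖ζ.1‖ = 1 := fun ζ => mem_sphere_zero_iff_norm.mp ζ.2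
  have hη : η.1 ≠ 0 := fun e => by have := hnorm η; rw [e, norm_zero] at this; norm_num at this
  have : Fact (Module.finrank ℝ R3 = 2 + 1) := ⟨by simp⟩
  have hfr : Module.finrank ℝ (ℝ ∙ η.1)ᗮ = 2 := Submodule.finrank_orthogonal_span_singleton hη
  have hnt : Nontrivial (ℝ ∙ η.1)ᗮ := Module.nontrivial_of_finrank_pos (R := ℝ) (by omega)
  obtain ⟨w, hw⟩ := exists_ne (0 : (ℝ ∙ η.1)ᗮ)
  have hw0 : (w : R3) ≠ 0 := fun e => hw (Subtype.ext e)
  have hmem : η.1 ∈ (ℝ ∙ (w : R3))ᗮ := by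
    rw [Submodule.mem_orthogonal_singleton_iff_inner_right]
    exact Submodule.mem_orthogonal_singleton_iff_inner_left.mp w.2
  refine ⟨(Submodule.reflection (ℝ ∙ (ξ.1 - η.1))ᗮ).trans (Submodule.reflection (ℝ ∙ (w : R3))ᗮ),
    ?_, ?_⟩
  · have e : ((((Submodule.reflection (ℝ ∙ (ξ.1 - η.1))ᗮ).trans
        (Submodule.reflection (ℝ ∙ (w : R3))ᗮ)).toLinearEquiv : R3 ≃ₗ[ℝ] R3) : R3 →ₗ[ℝ] R3)
        = ((Submodule.reflection (ℝ ∙ (w : R3))ᗮ).toLinearEquiv : R3 →ₗ[ℝ] R3) ∘ₗ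
          ((Submodule.reflection (ℝ ∙ (ξ.1 - η.1))ᗮ).toLinearEquiv : R3 →ₗ[ℝ] R3) := rfl
    rw [e, LinearMap.det_comp, det_reflection_hyperplane hw0, det_reflection_hyperplane hne]
    norm_num
  · apply Subtype.ext
    change Submodule.reflection (ℝ ∙ (w : R3))ᗮ (Submodule.reflection (ℝ ∙ (ξ.1 - η.1))ᗮ ξ.1) = η.1
    rw [Submodule.reflection_sub ((hnorm ξ).trans (hnorm η).symm),
      Submodule.reflection_mem_subspace_eq_self hmem]

theorem surf_real_univ : surf.real Set.univ = 4 * Real.pi := by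
  have h := integral_height_pow_even 0
  simpa using h

/-- The diagonal is constant because rotations act transitively; its integral is the number `2l + 1`
of normalized harmonics, and the sphere has area `4π`. -/
theorem zonalKernel_self (l : ℕ) (ξ : S2) :
    zonalKernel l ξ ξ = (((2 * l + 1) / (4 * Real.pi) : ℝ) : ℂ) := by
  have hconst : ∀ η, zonalKernel l η η = zonalKernel l ξ ξ := fun η => by
    obtain ⟨g, -, rfl⟩ := exists_rotation ξ η
    exact zonalKernel_rotate g l ξ ξ
  have h1 : ∫ η, zonalKernel l η η ∂surf = (2 * l + 1 : ℂ) := by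
    simp only [zonalKernel]
    rw [integral_finsetSum]
    · rw [Finset.sum_congr rfl (g := fun _ => (1 : ℂ)) fun m hm => by
        rw [integral_Y_mul_conj_Y, if_pos ⟨rfl, rfl, hm⟩], Finset.sum_const, Int.card_Icc,
        nsmul_eq_mul, mul_one]
      have : ((l : ℤ) + 1 - -(l : ℤ)).toNat = 2 * l + 1 := by omega
      rw [this]; push_cast; ring
    · exact fun m _ => integrable_mul_conj_Y (integrable_of_continuous (continuous_Y l m)) l m
  simp only [hconst, integral_const, surf_real_univ, Complex.real_smul] at h1
  push_cast at h1 ⊢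
  rw [eq_div_iff (by simp), ← h1]; ring

/-! ### Completeness of the spherical harmonics -/

/-- The spherical harmonics as elements of `L²`. -/
noncomputable def lpY (i : HIdx) : ComplexL2 :=
  ContinuousMap.toLp (E := ℂ) 2 surf ℂ (contY i.1 i.2)

theorem orthonormal_lpY : Orthonormal ℂ lpY := by
  rw [orthonormal_iff_ite]
  rintro ⟨l, m⟩ ⟨l', m'⟩
  rw [lpY, lpY, ContinuousMap.inner_toLp]
  refine (integral_Y_mul_conj_Y l' l m' m).trans ?_
  congr 1
  rw [eq_iff_iff]
  constructor
  · rintro ⟨rfl, h, -⟩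
    rw [Subtype.ext h]
  · intro h
    cases h
    exact ⟨rfl, rfl, m.2⟩

/-- The star algebra of the polynomial functions on the sphere. -/
noncomputable def polynomialSubalgebra : StarSubalgebra ℂ C(S2, ℂ) where
  carrier := {f | ∃ n, f ∈ affineSpan ^ n}
  mul_mem' := fun ⟨k, hf⟩ ⟨n, hg⟩ => ⟨k + n, mul_mem_affineSpan_pow hf hg⟩
  add_mem' := fun ⟨k, hf⟩ ⟨n, hg⟩ => ⟨max k n, Submodule.add_mem _
    (affineSpan_pow_mono (le_max_left k n) hf) (affineSpan_pow_mono (le_max_right k n) hg)⟩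
  algebraMap_mem' := fun c => ⟨0, by
    rw [Submodule.pow_zero, Submodule.mem_one]; exact ⟨c, rfl⟩⟩
  star_mem' := fun ⟨n, hf⟩ => ⟨n, star_mem_affineSpan_pow hf⟩

theorem polynomialSubalgebra_separatesPoints : polynomialSubalgebra.SeparatesPoints := by
  intro x y hxy
  obtain ⟨i, hi⟩ : ∃ i, x.1 i ≠ y.1 i := by
    by_contra! h
    exact hxy (Subtype.ext (PiLp.ext h))
  refine ⟨_, ⟨contCoord i, ⟨1, by rw [Submodule.pow_one]; exact contCoord_mem i⟩, rfl⟩, ?_⟩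
  exact fun h => hi (Complex.ofReal_injective h)

theorem harmonicSpan_le_span (n : ℕ) : harmonicSpan n ≤
    Submodule.span ℂ (Set.range fun i : HIdx => contY i.1 i.2) := by
  rw [harmonicSpan, Submodule.span_le]
  rintro _ ⟨k, -, m, rfl⟩
  by_cases hm : m ∈ Finset.Icc (-(k : ℤ)) k
  · exact Submodule.subset_span ⟨⟨k, ⟨m, hm⟩⟩, rfl⟩
  · have e : contY k m = 0 := by ext ξ; exact Y_eq_zero hm ξ
    rw [e]; exact Submodule.zero_mem _

/-- Stone–Weierstrass for the star algebra of polynomial functions, all of which are combinations of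
harmonics. Uniform density then passes to `L²`. -/
theorem span_contY_closure_eq_top :
    (Submodule.span ℂ (Set.range fun i : HIdx => contY i.1 i.2)).topologicalClosure = ⊤ := by
  have h := ContinuousMap.starSubalgebra_topologicalClosure_eq_top_of_separatesPoints
    polynomialSubalgebra polynomialSubalgebra_separatesPoints
  have h2 : (Subalgebra.toSubmodule polynomialSubalgebra.toSubalgebra).topologicalClosure = ⊤ :=
    congr_arg (Subalgebra.toSubmodule <| StarSubalgebra.toSubalgebra ·) h
  refine top_le_iff.mp (h2 ▸ Submodule.topologicalClosure_mono ?_)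
  rintro f ⟨n, hf⟩
  exact harmonicSpan_le_span n (affineSpan_pow_le n hf)

theorem span_lpY_closure_eq_top :
    (Submodule.span ℂ (Set.range lpY)).topologicalClosure = ⊤ := by
  have h := (ContinuousMap.toLp_denseRange (p := 2) ℂ surf ℂ
    ENNReal.ofNat_ne_top).topologicalClosure_map_submodule span_contY_closure_eq_top
  rw [Submodule.map_span, ← Set.range_comp] at h
  exact h

/-- The Hilbert basis of the spherical harmonics. -/
noncomputable def harmonicBasis : HilbertBasis HIdx ℂ ComplexL2 :=
  HilbertBasis.mk orthonormal_lpY span_lpY_closure_eq_top.ge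

theorem harmonicBasis_apply (i : HIdx) : harmonicBasis i = lpY i := by
  rw [harmonicBasis, HilbertBasis.coe_mk]

theorem inner_toLp_toLp {f g : S2 → ℂ} (hf : MemLp f 2 surf) (hg : MemLp g 2 surf) :
    inner ℂ (hg.toLp g) (hf.toLp f) = ∫ ξ, f ξ * conj (g ξ) ∂surf := by
  rw [L2.inner_def]
  refine integral_congr_ae ?_
  filter_upwards [hf.coeFn_toLp, hg.coeFn_toLp] with ξ h1 h2
  rw [h1, h2]; rfl

theorem memLp_of_continuous {f : S2 → ℂ} (hf : Continuous f) (p : ENNReal) : MemLp f p surf := by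
  obtain ⟨c, hc⟩ := isCompact_univ.exists_bound_of_continuousOn hf.continuousOn
  exact MemLp.of_bound hf.aestronglyMeasurable c (.of_forall fun ξ => hc ξ (Set.mem_univ _))

theorem lpY_eq (i : HIdx) : lpY i = (memLp_of_continuous (continuous_Y i.1 i.2) 2).toLp _ := by
  refine Lp.ext ?_
  filter_upwards [ContinuousMap.coeFn_toLp (E := ℂ) (p := 2) (𝕜 := ℂ) surf (contY i.1 i.2),
    (memLp_of_continuous (continuous_Y i.1 i.2) 2).coeFn_toLp] with ξ h1 h2
  rw [h2]; exact h1

theorem inner_lpY {f : S2 → ℂ} (hf : MemLp f 2 surf) (i : HIdx) :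
    inner ℂ (harmonicBasis i) (hf.toLp f) = multipole f i.1 i.2 := by
  rw [harmonicBasis_apply, lpY_eq, inner_toLp_toLp]; rfl

/-- Parseval's identity. -/
theorem hasSum_multipole {f g : S2 → ℂ} (hf : MemLp f 2 surf) (hg : MemLp g 2 surf) :
    HasSum (fun i : HIdx => conj (multipole g i.1 i.2) * multipole f i.1 i.2)
      (∫ ξ, f ξ * conj (g ξ) ∂surf) := by
  have h := harmonicBasis.hasSum_inner_mul_inner (hg.toLp g) (hf.toLp f)
  rw [inner_toLp_toLp] at h
  refine h.congr_fun fun i => ?_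
  rw [inner_lpY, ← inner_conj_symm, inner_lpY]

theorem hasSum_norm_multipole_sq {f : S2 → ℂ} (hf : MemLp f 2 surf) :
    HasSum (fun i : HIdx => ‖multipole f i.1 i.2‖ ^ 2) (∫ ξ, ‖f ξ‖ ^ 2 ∂surf) := by
  have h := hasSum_multipole hf hf
  simp only [Complex.conj_mul', Complex.mul_conj'] at h
  have e : ∫ ξ, ((‖f ξ‖ : ℂ) ^ 2) ∂surf = ((∫ ξ, ‖f ξ‖ ^ 2 ∂surf : ℝ) : ℂ) := by
    rw [← integral_complex_ofReal]; push_cast; rfl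
  rw [e] at h
  exact_mod_cast h

/-! ### Absolutely convergent iterated sums -/

section Sums

variable {ι α β γ : Type*}

/-- For fixed `i` the two inner sums separate. As they are bounded uniformly in `i`, the series `K
K' ∑ ‖c i‖` dominates, and Fubini applies. -/
theorem hasSum_triple {c : ι → ℂ} {f : ι → α → ℂ} {g : ι → β → ℂ} (hc : Summable fun i => ‖c i‖)
    (hf : ∀ i, Summable fun a => ‖f i a‖) (hg : ∀ i, Summable fun b => ‖g i b‖) {K K' : ℝ}
    (hK : ∀ i, ∑' a, ‖f i a‖ ≤ K) (hK' : ∀ i, ∑' b, ‖g i b‖ ≤ K') :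
    Summable (fun p : ι × α × β => ‖c p.1 * f p.1 p.2.1 * g p.1 p.2.2‖) ∧
    ∑' p : ι × α × β, c p.1 * f p.1 p.2.1 * g p.1 p.2.2
      = ∑' i, c i * (∑' a, f i a) * ∑' b, g i b := by
  have hnn : ∀ i, 0 ≤ ∑' a, ‖f i a‖ := fun i => tsum_nonneg fun a => norm_nonneg _
  have hnn' : ∀ i, 0 ≤ ∑' b, ‖g i b‖ := fun i => tsum_nonneg fun a => norm_nonneg _
  have hprod : ∀ i, HasSum (fun q : α × β => ‖f i q.1‖ * ‖g i q.2‖)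
      ((∑' a, ‖f i a‖) * ∑' b, ‖g i b‖) := fun i =>
    (hf i).hasSum.mul (hg i).hasSum ((hf i).mul_of_nonneg (hg i) (fun _ => norm_nonneg _)
      (fun _ => norm_nonneg _))
  have hin : ∀ i, HasSum (fun q : α × β => ‖c i * f i q.1 * g i q.2‖)
      (‖c i‖ * ((∑' a, ‖f i a‖) * ∑' b, ‖g i b‖)) := fun i => by
    simpa only [norm_mul, mul_assoc] using (hprod i).mul_left ‖c i‖
  have hs : Summable (fun p : ι × α × β => ‖c p.1 * f p.1 p.2.1 * g p.1 p.2.2‖) := by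
    have hin' : ∀ i, ∑' q : α × β, ‖c i * f i q.1 * g i q.2‖
        = ‖c i‖ * ((∑' a, ‖f i a‖) * ∑' b, ‖g i b‖) := fun i => (hin i).tsum_eq
    have hin'' : ∀ i, Summable fun q : α × β => ‖c i * f i q.1 * g i q.2‖ :=
      fun i => (hin i).summable
    rw [summable_prod_of_nonneg fun _ => norm_nonneg _]
    dsimp only
    refine ⟨hin'', ?_⟩
    simp only [hin']
    have h0 : ∀ i, 0 ≤ ‖c i‖ * ((∑' a, ‖f i a‖) * ∑' b, ‖g i b‖) := fun i =>
      mul_nonneg (norm_nonneg _) (mul_nonneg (hnn i) (hnn' i))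
    have h1 : ∀ i, ‖c i‖ * ((∑' a, ‖f i a‖) * ∑' b, ‖g i b‖) ≤ ‖c i‖ * (K * K') := fun i =>
      mul_le_mul_of_nonneg_left (mul_le_mul (hK i) (hK' i) (hnn' i) ((hnn i).trans (hK i)))
        (norm_nonneg _)
    exact Summable.of_nonneg_of_le h0 h1 (hc.mul_right (K * K'))
  refine ⟨hs, ?_⟩
  have hfib : ∀ i, ∑' q : α × β, c i * f i q.1 * g i q.2
      = c i * (∑' a, f i a) * ∑' b, g i b := fun i => by
    simp only [mul_assoc]
    rw [tsum_mul_left, tsum_mul_tsum_of_summable_norm (hf i) (hg i)]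
  rw [hs.of_norm.tsum_prod]
  simp only [hfib]

theorem hasSum_quadruple {c : ι → ℂ} {f : ι → α → ℂ} {g : ι → β → ℂ} {h : γ → ℂ}
    (hc : Summable fun i => ‖c i‖)
    (hf : ∀ i, Summable fun a => ‖f i a‖) (hg : ∀ i, Summable fun b => ‖g i b‖) {K K' : ℝ}
    (hK : ∀ i, ∑' a, ‖f i a‖ ≤ K) (hK' : ∀ i, ∑' b, ‖g i b‖ ≤ K')
    (hh : Summable fun x => ‖h x‖) :
    Summable (fun p : ι × α × β × γ =>
      c p.1 * f p.1 p.2.1 * g p.1 p.2.2.1 * h p.2.2.2) ∧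
    ∑' p : ι × α × β × γ, c p.1 * f p.1 p.2.1 * g p.1 p.2.2.1 * h p.2.2.2
      = (∑' p : ι × α × β, c p.1 * f p.1 p.2.1 * g p.1 p.2.2) * ∑' x, h x := by
  obtain ⟨hs, -⟩ := hasSum_triple hc hf hg hK hK'
  let e : ι × α × β × γ ≃ (ι × α × β) × γ :=
    ⟨fun p => ((p.1, p.2.1, p.2.2.1), p.2.2.2), fun q => (q.1.1, q.1.2.1, q.1.2.2, q.2),
      fun _ => rfl, fun _ => rfl⟩
  have hs' := summable_mul_of_summable_norm hs hh
  have hs4 : Summable ((fun q : (ι × α × β) × γ =>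
      c q.1.1 * f q.1.1 q.1.2.1 * g q.1.1 q.1.2.2 * h q.2) ∘ e) := e.summable_iff.mpr hs'
  refine ⟨hs4, ?_⟩
  rw [tsum_mul_tsum_of_summable_norm hs hh, ← e.tsum_eq]
  rfl

end Sums

/-! ### Sums against Gaunt integrals -/

theorem exists_norm_Y_le (l : ℕ) (m : ℤ) : ∃ B, ∀ ξ, ‖Y l m ξ‖ ≤ B := by
  obtain ⟨c, hc⟩ := isCompact_univ.exists_bound_of_continuousOn (continuous_Y l m).continuousOn
  exact ⟨c, fun ξ => hc ξ (Set.mem_univ _)⟩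

theorem continuous_conj_Y_mul_Y (l₁ l : ℕ) (m₁ m : ℤ) :
    Continuous fun ξ => conj (Y l₁ m₁ ξ) * Y l m ξ :=
  (Complex.continuous_conj.comp (continuous_Y l₁ m₁)).mul (continuous_Y l m)

/-- Read as a function of `(ℓ₂, m₂)`, the Gaunt integral is a conjugated multipole coefficient of a
fixed continuous function, so Parseval evaluates the sums over these indices. -/
theorem gaunt_eq_conj_multipole (l₁ l₂ l : ℕ) (m₁ m₂ m : ℤ) :
    gaunt l₁ l₂ l m₁ m₂ m = conj (multipole (fun ξ => conj (Y l₁ m₁ ξ) * Y l m ξ) l₂ m₂) := by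
  rw [gaunt, multipole, ← integral_conj]
  refine integral_congr_ae (.of_forall fun ξ => ?_)
  simp only [map_mul, Complex.conj_conj]
  ring

/-- Only `Y l m` is bounded pointwise; `Y l₁ m₁` enters through its `L²` norm, which is `1` or `0`.
This makes the bound independent of `(l₁, m₁)`. -/
theorem integral_norm_conj_Y_mul_Y_sq_le (l₁ l : ℕ) (m₁ m : ℤ) {B : ℝ} (hB : ∀ ξ, ‖Y l m ξ‖ ≤ B) :
    ∫ ξ, ‖conj (Y l₁ m₁ ξ) * Y l m ξ‖ ^ 2 ∂surf ≤ B ^ 2 := by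
  have h1 : ∫ ξ, ‖Y l₁ m₁ ξ‖ ^ 2 ∂surf ≤ 1 := by
    have h := integral_Y_mul_conj_Y l₁ l₁ m₁ m₁
    simp only [Complex.mul_conj'] at h
    have e : ∫ ξ, ((‖Y l₁ m₁ ξ‖ : ℂ) ^ 2) ∂surf = ((∫ ξ, ‖Y l₁ m₁ ξ‖ ^ 2 ∂surf : ℝ) : ℂ) := by
      rw [← integral_complex_ofReal]; push_cast; rfl
    rw [e] at h
    split_ifs at h
    · exact (Complex.ofReal_eq_one.mp h).le
    · rw [Complex.ofReal_eq_zero.mp h]; exact zero_le_one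
  have hc1 : Continuous fun ξ => ‖Y l₁ m₁ ξ‖ ^ 2 * B ^ 2 :=
    ((continuous_Y l₁ m₁).norm.pow 2).mul continuous_const
  calc ∫ ξ, ‖conj (Y l₁ m₁ ξ) * Y l m ξ‖ ^ 2 ∂surf ≤ ∫ ξ, ‖Y l₁ m₁ ξ‖ ^ 2 * B ^ 2 ∂surf := by
        refine integral_mono (integrable_of_continuous
          ((continuous_conj_Y_mul_Y l₁ l m₁ m).norm.pow 2)) (integrable_of_continuous hc1)
          fun ξ => ?_
        simp only [norm_mul, mul_pow, RCLike.norm_conj]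
        exact mul_le_mul_of_nonneg_left (pow_le_pow_left₀ (norm_nonneg _) (hB ξ) 2) (by positivity)
    _ ≤ B ^ 2 := by
        rw [integral_mul_const]
        exact mul_le_of_le_one_left (by positivity) h1

/-- The sums of `f_{ℓ₂m₂}` against the Gaunt integrals are absolutely convergent, uniformly in the
first pair of indices. -/
theorem summable_multipole_mul_gaunt {f : S2 → ℂ} (hf : MemLp f 2 surf) (l : ℕ) (m : ℤ) :
    ∃ K, ∀ (l₁ : ℕ) (m₁ : ℤ),
      Summable (fun i : HIdx => ‖multipole f i.1 i.2 * gaunt l₁ i.1 l m₁ i.2 m‖) ∧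
      ∑' i : HIdx, ‖multipole f i.1 i.2 * gaunt l₁ i.1 l m₁ i.2 m‖ ≤ K := by
  obtain ⟨B, hB⟩ := exists_norm_Y_le l m
  -- By `|xy| ≤ |x|² + |y|²` and Parseval for each factor: the first term is the squared norm of
  -- `f`, the second bounds that of `conj (Y l₁ m₁) * Y l m`.
  refine ⟨(∫ ξ, ‖f ξ‖ ^ 2 ∂surf) + B ^ 2, fun l₁ m₁ => ?_⟩
  have h1 := hasSum_norm_multipole_sq hf
  have h2 := hasSum_norm_multipole_sq (memLp_of_continuous (continuous_conj_Y_mul_Y l₁ l m₁ m) 2)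
  have hle : ∀ i : HIdx, ‖multipole f i.1 i.2 * gaunt l₁ i.1 l m₁ i.2 m‖ ≤
      ‖multipole f i.1 i.2‖ ^ 2 + ‖multipole (fun ξ => conj (Y l₁ m₁ ξ) * Y l m ξ) i.1 i.2‖ ^ 2 :=
    fun i => by
      rw [norm_mul, gaunt_eq_conj_multipole, RCLike.norm_conj]
      nlinarith [sq_nonneg (‖multipole f i.1 i.2‖ -
        ‖multipole (fun ξ => conj (Y l₁ m₁ ξ) * Y l m ξ) i.1 i.2‖),
        sq_nonneg ‖multipole f i.1 i.2‖,
        sq_nonneg ‖multipole (fun ξ => conj (Y l₁ m₁ ξ) * Y l m ξ) i.1 i.2‖]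
  have hs := Summable.of_nonneg_of_le (fun _ => norm_nonneg _) hle (h1.add h2).summable
  refine ⟨hs, (hs.tsum_le_tsum hle (h1.add h2).summable).trans ?_⟩
  rw [(h1.add h2).tsum_eq]
  exact add_le_add le_rfl (integral_norm_conj_Y_mul_Y_sq_le l₁ l m₁ m hB)

theorem hasSum_multipole_mul_gaunt {f : S2 → ℂ} (hf : MemLp f 2 surf) (l₁ l : ℕ) (m₁ m : ℤ) :
    HasSum (fun i : HIdx => multipole f i.1 i.2 * gaunt l₁ i.1 l m₁ i.2 m)
      (∫ ξ, f ξ * Y l₁ m₁ ξ * conj (Y l m ξ) ∂surf) := by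
  have h := hasSum_multipole hf (memLp_of_continuous (continuous_conj_Y_mul_Y l₁ l m₁ m) 2)
  simp only [map_mul, Complex.conj_conj, ← mul_assoc] at h
  refine h.congr_fun fun i => ?_
  rw [gaunt_eq_conj_multipole, mul_comm]

/-! ### Evaluation of the quadruple sums -/

/-- The coupling `∫ f Y_{ℓ₁m₁} Y_{ℓm}^*` of two spherical harmonics by a weight. -/
noncomputable def coupling (f : S2 → ℂ) (l₁ l : ℕ) (m₁ m : ℤ) : ℂ :=
  ∫ ξ, f ξ * Y l₁ m₁ ξ * conj (Y l m ξ) ∂surf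

section Quadruple

variable {C : ℕ → ℝ} {W D : S2 → ℂ}

theorem memLp_one_sub {W : S2 → ℂ} (hW : MemLp W 2 surf) : MemLp (fun ξ => 1 - W ξ) 2 surf :=
  (memLp_const 1).sub hW

/-- Once `(ℓ₁, m₁)` is fixed, the sums over the second and third pairs separate and Parseval turns
each into a coupling by `1 - W`. The fourth pair interacts with none of the others and gives the
coupling by `D`. -/
theorem qTerm_summable_and_tsum (hC : Summable fun i : HIdx => C i.1) (hC0 : ∀ l, 0 ≤ C l)
    (hW : MemLp W 2 surf) (hD : MemLp D 2 surf) (l l' : ℕ) (m m' : ℤ) :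
    Summable (qTerm C W D l l' m m') ∧
    ∑' p, qTerm C W D l l' m m' p =
      (∑' i : HIdx, (C i.1 : ℂ) * coupling (fun ξ => 1 - W ξ) i.1 l i.2 m *
        conj (coupling (fun ξ => 1 - W ξ) i.1 l' i.2 m')) * coupling D l l' m m' := by
  obtain ⟨K, hK⟩ := summable_multipole_mul_gaunt (memLp_one_sub hW) l m
  obtain ⟨K', hK'⟩ := summable_multipole_mul_gaunt (memLp_one_sub hW) l' m'
  obtain ⟨K₄, hK₄⟩ := summable_multipole_mul_gaunt hD l' m'
  have hc : Summable fun i : HIdx => ‖(C i.1 : ℂ)‖ := by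
    simpa only [Complex.norm_real, Real.norm_of_nonneg (hC0 _)] using hC
  have hn : ∀ z : ℂ, ‖conj z‖ = ‖z‖ := fun z => RCLike.norm_conj z
  have h3 := hasSum_triple (c := fun i : HIdx => (C i.1 : ℂ))
    (f := fun i j : HIdx => wbar W j.1 j.2 * gaunt i.1 j.1 l i.2 j.2 m)
    (g := fun i j : HIdx => conj (wbar W j.1 j.2 * gaunt i.1 j.1 l' i.2 j.2 m')) hc
    (fun i => (hK i.1 i.2).1) (fun i => by simpa only [hn, wbar] using (hK' i.1 i.2).1)
    (fun i => (hK i.1 i.2).2) (fun i => by simpa only [hn, wbar] using (hK' i.1 i.2).2)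
  have h4 := hasSum_quadruple (c := fun i : HIdx => (C i.1 : ℂ))
    (f := fun i j : HIdx => wbar W j.1 j.2 * gaunt i.1 j.1 l i.2 j.2 m)
    (g := fun i j : HIdx => conj (wbar W j.1 j.2 * gaunt i.1 j.1 l' i.2 j.2 m'))
    (h := fun j : HIdx => multipole D j.1 j.2 * gaunt l j.1 l' m j.2 m') hc
    (fun i => (hK i.1 i.2).1) (fun i => by simpa only [hn, wbar] using (hK' i.1 i.2).1)
    (fun i => (hK i.1 i.2).2) (fun i => by simpa only [hn, wbar] using (hK' i.1 i.2).2) (hK₄ l m).1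
  have e : qTerm C W D l l' m m' = fun p : HIdx × HIdx × HIdx × HIdx => (C p.1.1 : ℂ) *
      (wbar W p.2.1.1 p.2.1.2 * gaunt p.1.1 p.2.1.1 l p.1.2 p.2.1.2 m) *
      conj (wbar W p.2.2.1.1 p.2.2.1.2 * gaunt p.1.1 p.2.2.1.1 l' p.1.2 p.2.2.1.2 m') *
      (multipole D p.2.2.2.1 p.2.2.2.2 * gaunt l p.2.2.2.1 l' m p.2.2.2.2 m') := by
    funext p
    rw [qTerm, map_mul]; ring
  rw [e]
  refine ⟨h4.1, ?_⟩
  rw [h4.2, h3.2, (hasSum_multipole_mul_gaunt hD l l' m m').tsum_eq]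
  congr 1
  refine tsum_congr fun i => ?_
  rw [← Complex.conj_tsum]
  simp only [wbar]
  rw [(hasSum_multipole_mul_gaunt (memLp_one_sub hW) i.1 l i.2 m).tsum_eq,
    (hasSum_multipole_mul_gaunt (memLp_one_sub hW) i.1 l' i.2 m').tsum_eq]
  rfl

end Quadruple

/-! ### Axisymmetric weights -/

theorem IsAxisymmetric.ae_rotate {f : S2 → ℂ} (hf : IsAxisymmetric f) (φ : ℝ) :
    (fun ξ => f (rotate (axisRotation φ) ξ)) =ᵐ[surf] f := by
  obtain ⟨h, hh⟩ := hf
  filter_upwards [hh, (measurePreserving_rotate (axisRotation φ)).quasiMeasurePreserving.ae hh]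
    with ξ h1 h2
  rw [h1, h2, rotate_axisRotation_two]

theorem IsAxisymmetric.one_sub {f : S2 → ℂ} (hf : IsAxisymmetric f) :
    IsAxisymmetric fun ξ => 1 - f ξ := by
  obtain ⟨h, hh⟩ := hf
  exact ⟨fun t => 1 - h t, by filter_upwards [hh] with ξ h1; rw [h1]⟩

/-- A rotation by `φ` about the axis fixes the weight and multiplies the integrand by `e^{i(m₁ -
m)φ}`. -/
theorem IsAxisymmetric.coupling_eq_zero {f : S2 → ℂ} (hf : IsAxisymmetric f) {m₁ m : ℤ}
    (hm : m₁ ≠ m) (l₁ l : ℕ) : coupling f l₁ l m₁ m = 0 := by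
  refine integral_eq_zero_of_phase (sub_ne_zero.mpr hm) fun φ => ?_
  filter_upwards [hf.ae_rotate φ] with ξ h1
  simp only [h1, Y_rotate, map_mul, exp_conj_phase]
  rw [show ((m₁ - m : ℤ) : ℂ) * φ * Complex.I = m₁ * φ * Complex.I + -m * φ * Complex.I by
    push_cast; ring, Complex.exp_add]
  ring

theorem IsAxisymmetric.multipole_eq_zero {f : S2 → ℂ} (hf : IsAxisymmetric f) {m : ℤ}
    (hm : m ≠ 0) (l : ℕ) : multipole f l m = 0 := by
  refine integral_eq_zero_of_phase (neg_ne_zero.mpr hm) fun φ => ?_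
  filter_upwards [hf.ae_rotate φ] with ξ h1
  simp only [h1, Y_rotate, map_mul, exp_conj_phase]
  push_cast
  ring

/-- The integrand is real at every point: `Y_{ℓ₂0}` is real, and the two factors of order `m` have
the same azimuthal phase, one of them conjugated. -/
theorem conj_gaunt_axial (l₁ l₂ l : ℕ) (m : ℤ) :
    conj (gaunt l₁ l₂ l m 0 m) = gaunt l₁ l₂ l m 0 m := by
  rw [gaunt, ← integral_conj]
  refine integral_congr_ae (.of_forall fun ξ => ?_)
  have h0 := Y_of_nonneg l₂ 0 ξ
  simp only [Nat.cast_zero, pow_zero, mul_one] at h0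
  obtain ⟨k, rfl | rfl⟩ := Int.eq_nat_or_neg m
  · simp only [h0, Y_of_nonneg, map_mul, map_pow, Complex.conj_conj, Complex.conj_ofReal]
    ring
  · simp only [h0, Y_neg_eq, map_mul, map_pow, Complex.conj_conj, Complex.conj_ofReal, map_neg,
      map_one]
    ring

theorem conj_multipole_zero {f : S2 → ℂ} (hf : ∀ᵐ ξ ∂surf, (f ξ).im = 0) (l : ℕ) :
    conj (multipole f l 0) = multipole f l 0 := by
  rw [multipole, ← integral_conj]
  refine integral_congr_ae ?_
  filter_upwards [hf] with ξ h1
  have h0 := Y_of_nonneg l 0 ξ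
  simp only [Nat.cast_zero, pow_zero, mul_one] at h0
  rw [h0, map_mul, Complex.conj_conj, Complex.conj_ofReal, Complex.conj_eq_iff_im.mpr h1]

/-- A sum over pairs `(ℓ, m)` that is supported on one value of `m`. -/
theorem tsum_slice {F : ℕ → ℤ → ℂ} (hF : Summable fun i : HIdx => F i.1 i.2) (m : ℤ)
    (h1 : ∀ l k, k ≠ m → F l k = 0) (h2 : ∀ l : ℕ, m ∉ Finset.Icc (-(l : ℤ)) l → F l m = 0) :
    ∑' i : HIdx, F i.1 i.2 = ∑' l : ℕ, F l m := by
  rw [hF.tsum_sigma]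
  refine tsum_congr fun l => ?_
  rw [tsum_fintype, Finset.sum_coe_sort (Finset.Icc (-(l : ℤ)) l) (fun k => F l k)]
  by_cases hm : m ∈ Finset.Icc (-(l : ℤ)) l
  · exact Finset.sum_eq_single_of_mem m hm fun k _ hk => h1 l k hk
  · rw [h2 l hm]
    exact Finset.sum_eq_zero fun k hk => h1 l k fun e => hm (e ▸ hk)

/-- The index `(ℓ, 0)`. -/
def zonalIdx (l : ℕ) : HIdx := ⟨l, ⟨0, by simp⟩⟩

theorem injective_zonalIdx : Function.Injective zonalIdx :=
  fun _ _ h => congrArg Sigma.fst h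

theorem zonal_multipole_mul_gaunt {f : S2 → ℂ} (hf : MemLp f 2 surf) (l : ℕ) (m : ℤ) :
    ∃ K, ∀ (l₁ : ℕ) (m₁ : ℤ),
      Summable (fun k : ℕ => ‖multipole f k 0 * gaunt l₁ k l m₁ 0 m‖) ∧
      ∑' k : ℕ, ‖multipole f k 0 * gaunt l₁ k l m₁ 0 m‖ ≤ K := by
  obtain ⟨K, hK⟩ := summable_multipole_mul_gaunt hf l m
  refine ⟨K, fun l₁ m₁ => ?_⟩
  obtain ⟨h1, h2⟩ := hK l₁ m₁
  have e : (fun k : ℕ => ‖multipole f k 0 * gaunt l₁ k l m₁ 0 m‖) =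
    (fun i : HIdx => ‖multipole f i.1 i.2 * gaunt l₁ i.1 l m₁ i.2 m‖) ∘ zonalIdx := rfl
  rw [e]
  exact ⟨h1.comp_injective injective_zonalIdx,
    (tsum_comp_le_tsum_of_inj h1 (fun _ => norm_nonneg _) injective_zonalIdx).trans h2⟩

theorem IsAxisymmetric.tsum_zonal {f : S2 → ℂ} (ha : IsAxisymmetric f) (hf : MemLp f 2 surf)
    (l₁ l : ℕ) (m₁ m : ℤ) :
    ∑' k : ℕ, multipole f k 0 * gaunt l₁ k l m₁ 0 m = coupling f l₁ l m₁ m := by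
  have h := hasSum_multipole_mul_gaunt hf l₁ l m₁ m
  rw [coupling, ← h.tsum_eq]
  refine (tsum_slice (F := fun k n => multipole f k n * gaunt l₁ k l m₁ n m) h.summable 0
    (fun k n hn => ?_) (fun k hk => absurd ?_ hk)).symm
  · rw [ha.multipole_eq_zero hn, zero_mul]
  · simp

section AxialSums

variable {C : ℕ → ℝ} {W D : S2 → ℂ}

/-- Keeping only the orders `0` extracts subfamilies of the absolutely convergent sums over all
pairs, so the uniform bounds persist and the same factorization applies. -/
theorem axial_sums (hC : Summable fun i : HIdx => C i.1) (hC0 : ∀ l, 0 ≤ C l)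
    (hW : MemLp W 2 surf) (hD : MemLp D 2 surf) (l l' : ℕ) (m : ℤ) :
    Summable (axiTerm C W D l l' m) ∧ Summable (aTerm C W l l' m) ∧ Summable (dTerm D l l' m) ∧
    ∑' k, axiTerm C W D l l' m k = (∑' k, aTerm C W l l' m k) * ∑' k, dTerm D l l' m k ∧
    ∑' k, aTerm C W l l' m k = ∑' k : ℕ, (C k : ℂ) *
      (∑' j : ℕ, wbar W j 0 * gaunt k j l m 0 m) * ∑' j : ℕ, wbar W j 0 * gaunt k j l' m 0 m := by
  obtain ⟨K, hK⟩ := zonal_multipole_mul_gaunt (memLp_one_sub hW) l m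
  obtain ⟨K', hK'⟩ := zonal_multipole_mul_gaunt (memLp_one_sub hW) l' m
  obtain ⟨K₄, hK₄⟩ := zonal_multipole_mul_gaunt hD l' m
  have hc : Summable fun k : ℕ => ‖(C k : ℂ)‖ := by
    simp only [Complex.norm_real, Real.norm_of_nonneg (hC0 _)]
    exact hC.comp_injective injective_zonalIdx
  have h3 := hasSum_triple (c := fun k : ℕ => (C k : ℂ))
    (f := fun k j : ℕ => wbar W j 0 * gaunt k j l m 0 m)
    (g := fun k j : ℕ => wbar W j 0 * gaunt k j l' m 0 m) hc
    (fun k => (hK k m).1) (fun k => (hK' k m).1) (fun k => (hK k m).2) (fun k => (hK' k m).2)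
  have h4 := hasSum_quadruple (c := fun k : ℕ => (C k : ℂ))
    (f := fun k j : ℕ => wbar W j 0 * gaunt k j l m 0 m)
    (g := fun k j : ℕ => wbar W j 0 * gaunt k j l' m 0 m)
    (h := fun j : ℕ => multipole D j 0 * gaunt l j l' m 0 m) hc
    (fun k => (hK k m).1) (fun k => (hK' k m).1) (fun k => (hK k m).2) (fun k => (hK' k m).2)
    (hK₄ l m).1
  have ea : aTerm C W l l' m = fun p : ℕ × ℕ × ℕ => (C p.1 : ℂ) *
      (wbar W p.2.1 0 * gaunt p.1 p.2.1 l m 0 m) *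
      (wbar W p.2.2 0 * gaunt p.1 p.2.2 l' m 0 m) := by
    funext p; rw [aTerm]; ring
  have ex : axiTerm C W D l l' m = fun p : ℕ × ℕ × ℕ × ℕ => (C p.1 : ℂ) *
      (wbar W p.2.1 0 * gaunt p.1 p.2.1 l m 0 m) *
      (wbar W p.2.2.1 0 * gaunt p.1 p.2.2.1 l' m 0 m) *
      (multipole D p.2.2.2 0 * gaunt l p.2.2.2 l' m 0 m) := by
    funext p; rw [axiTerm]; ring
  rw [ea, ex]
  exact ⟨h4.1, h3.1.of_norm, (hK₄ l m).1.of_norm, h4.2, h3.2⟩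

/-- The couplings by `1 - W` force `m₁ = m` and `m₁ = m'`. On the diagonal `m = m'` the sum over
`(ℓ₁, m₁)` reduces to a sum over `ℓ₁`, and the reality of `W` and of the axial Gaunt integrals
removes the conjugation. -/
theorem qTerm_tsum_axial (hC : Summable fun i : HIdx => C i.1) (hC0 : ∀ l, 0 ≤ C l)
    (hW : MemLp W 2 surf) (hD : MemLp D 2 surf) (haW : IsAxisymmetric W) (haD : IsAxisymmetric D)
    (hre : ∀ᵐ ξ ∂surf, (W ξ).im = 0) (l l' : ℕ) (m m' : ℤ) :
    ∑' p, qTerm C W D l l' m m' p = if m = m' then ∑' k, axiTerm C W D l l' m k else 0 := by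
  rw [(qTerm_summable_and_tsum hC hC0 hW hD l l' m m').2]
  split_ifs with hm
  · subst hm
    obtain ⟨-, -, -, h4, h5⟩ := axial_sums hC hC0 hW hD l l' m
    have hconj : ∀ k, conj (coupling (fun ξ => 1 - W ξ) k l' m m)
        = coupling (fun ξ => 1 - W ξ) k l' m m := fun k => by
      rw [← haW.one_sub.tsum_zonal (memLp_one_sub hW) k l' m m, Complex.conj_tsum]
      refine tsum_congr fun j => ?_
      rw [map_mul, conj_gaunt_axial, conj_multipole_zero]
      filter_upwards [hre] with ξ h1
      simp [h1]
    simp only [wbar] at h5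
    simp only [haW.one_sub.tsum_zonal (memLp_one_sub hW)] at h5
    rw [h4, h5]
    simp only [dTerm]
    rw [haD.tsum_zonal hD]
    congr 1
    -- Restricting to one order requires summability over all pairs; it holds because the couplings
    -- are bounded uniformly in `(ℓ₁, m₁)` and the spectrum is summable.
    have hsum : Summable fun i : HIdx => (C i.1 : ℂ) * coupling (fun ξ => 1 - W ξ) i.1 l i.2 m *
        conj (coupling (fun ξ => 1 - W ξ) i.1 l' i.2 m) := by
      obtain ⟨K, hK⟩ := summable_multipole_mul_gaunt (memLp_one_sub hW) l m
      obtain ⟨K', hK'⟩ := summable_multipole_mul_gaunt (memLp_one_sub hW) l' m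
      have hb : ∀ (l : ℕ) (K : ℝ) (i : HIdx), (Summable (fun j : HIdx =>
          ‖multipole (fun ξ => 1 - W ξ) j.1 j.2 * gaunt i.1 j.1 l i.2 j.2 m‖) ∧
          ∑' j : HIdx, ‖multipole (fun ξ => 1 - W ξ) j.1 j.2 * gaunt i.1 j.1 l i.2 j.2 m‖ ≤ K) →
          ‖coupling (fun ξ => 1 - W ξ) i.1 l i.2 m‖ ≤ K := fun l K i h => by
        rw [coupling, ← (hasSum_multipole_mul_gaunt (memLp_one_sub hW) i.1 l i.2 m).tsum_eq]
        exact (norm_tsum_le_tsum_norm h.1).trans h.2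
      refine Summable.of_norm_bounded (hC.mul_right (K * K')) fun i => ?_
      have hb1 := hb l K i (hK i.1 i.2)
      have hb2 := hb l' K' i (hK' i.1 i.2)
      rw [norm_mul, norm_mul, RCLike.norm_conj, Complex.norm_real, Real.norm_of_nonneg (hC0 _),
        mul_assoc]
      exact mul_le_mul_of_nonneg_left (mul_le_mul hb1 hb2 (norm_nonneg _)
        ((norm_nonneg _).trans hb1)) (hC0 _)
    refine (tsum_slice (F := fun k n => (C k : ℂ) * coupling (fun ξ => 1 - W ξ) k l n m *
      conj (coupling (fun ξ => 1 - W ξ) k l' n m)) hsum m (fun k n hn => ?_)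
      (fun k hk => ?_)).trans ?_
    · rw [haW.one_sub.coupling_eq_zero hn]; simp
    -- The reduced sum runs over every degree, including those with `|m| > k`, where `Y k m = 0`.
    · have : coupling (fun ξ => 1 - W ξ) k l m m = 0 := by
        simp [coupling, Y_eq_zero hk]
      rw [this]; simp
    · exact tsum_congr fun k => by rw [hconj]
  · have : ∀ i : HIdx, (C i.1 : ℂ) * coupling (fun ξ => 1 - W ξ) i.1 l i.2 m *
        conj (coupling (fun ξ => 1 - W ξ) i.1 l' i.2 m') = 0 := fun i => by
      by_cases h : (i.2 : ℤ) = m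
      · rw [haW.one_sub.coupling_eq_zero (show (i.2 : ℤ) ≠ m' by rwa [h])]; simp
      · rw [haW.one_sub.coupling_eq_zero h]; simp
    simp only [this, tsum_zero, zero_mul]

theorem qEntry_axial (hC : Summable fun i : HIdx => C i.1) (hC0 : ∀ l, 0 ≤ C l)
    (hW : MemLp W 2 surf) (hD : MemLp D 2 surf) (haW : IsAxisymmetric W) (haD : IsAxisymmetric D)
    (hre : ∀ᵐ ξ ∂surf, (W ξ).im = 0) (l l' : ℕ) :
    qEntry C W D l l' = ∑ m ∈ Finset.Icc (-(l : ℤ)) (l : ℤ),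
      ∑' k : ℕ × ℕ × ℕ × ℕ, axiTerm C W D l l' m k := by
  rw [qEntry]
  refine Finset.sum_congr rfl fun m _ => ?_
  simp only [qTerm_tsum_axial hC hC0 hW hD haW haD hre, Finset.sum_ite_eq]
  split_ifs with hm
  · rfl
  -- When `|m| > l'` no `m'` matches `m`; the reduced terms vanish too, since they contain `Y l' m =
  -- 0`.
  · have h0 : ∀ k, axiTerm C W D l l' m k = 0 := fun k => by
      have : gaunt l k.2.2.2 l' m 0 m = 0 := by simp [gaunt, Y_eq_zero hm]
      rw [axiTerm, this, mul_zero]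
    simp only [h0, tsum_zero]

end AxialSums

/-! ### Second moments of random elements of a Hilbert space -/

section SecondMoments

variable {Ω ι H : Type*} [MeasurableSpace Ω] {P : Measure Ω}
  [NormedAddCommGroup H] [InnerProductSpace ℂ H]

theorem integrable_inner_mul_conj_inner {Z : Ω → H} (hZ : MemLp Z 2 P) (f g : H) :
    Integrable (fun ω => inner ℂ f (Z ω) * conj (inner ℂ g (Z ω))) P := by
  have h1 : MemLp (fun ω => inner ℂ f (Z ω)) 2 P := hZ.const_inner f
  have h2 : MemLp (fun ω => conj (inner ℂ g (Z ω))) 2 P := by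
    simpa only [inner_conj_symm] using hZ.inner_const g
  exact h1.integrable_mul h2

/-- The second moments of a random element whose coordinates in a Hilbert basis are uncorrelated. -/
theorem integral_inner_mul_conj_inner [CompleteSpace H] (b : HilbertBasis ι ℂ H) {Z : Ω → H}
    (hZ : MemLp Z 2 P) (c : ι → ℝ)
    (hdiag : ∀ i, ∫ ω, inner ℂ (b i) (Z ω) * conj (inner ℂ (b i) (Z ω)) ∂P = c i)
    (hoff : ∀ i j, i ≠ j → ∫ ω, inner ℂ (b i) (Z ω) * conj (inner ℂ (b j) (Z ω)) ∂P = 0)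
    (f g : H) :
    ∫ ω, inner ℂ f (Z ω) * conj (inner ℂ g (Z ω)) ∂P
      = ∑' i, (c i : ℂ) * inner ℂ f (b i) * conj (inner ℂ g (b i)) := by
  -- `T` is the covariance operator. Uncorrelated coordinates make each `b i` an eigenvector with
  -- eigenvalue `c i`; self-adjointness of `T` and Parseval then give the series.
  let T : H → H := fun g => ∫ ω, conj (inner ℂ g (Z ω)) • Z ω ∂P
  have hint : ∀ g, Integrable (fun ω => conj (inner ℂ g (Z ω)) • Z ω) P := fun g => by
    have h2 : MemLp (fun ω => conj (inner ℂ g (Z ω))) 2 P := by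
      simpa only [inner_conj_symm] using hZ.inner_const g
    exact memLp_one_iff_integrable.mp (hZ.smul h2)
  have hT : ∀ f g, inner ℂ f (T g) = ∫ ω, inner ℂ f (Z ω) * conj (inner ℂ g (Z ω)) ∂P :=
    fun f g => by
      rw [← integral_inner (hint g) f]
      refine integral_congr_ae (.of_forall fun ω => ?_)
      simp only [inner_smul_right, mul_comm]
  have hsymm : ∀ f g, inner ℂ f (T g) = conj (inner ℂ g (T f)) := fun f g => by
    rw [hT, hT, ← integral_conj]
    refine integral_congr_ae (.of_forall fun ω => ?_)
    simp only [map_mul, Complex.conj_conj, mul_comm]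
  have hTb : ∀ i, T (b i) = (c i : ℂ) • b i := fun i => by
    classical
    apply b.repr.injective
    ext j
    rw [b.repr_apply_apply, b.repr_apply_apply, hT, inner_smul_right,
      orthonormal_iff_ite.mp b.orthonormal]
    by_cases hij : j = i
    · subst hij; rw [hdiag, if_pos rfl, mul_one]
    · rw [hoff j i hij, if_neg hij, mul_zero]
  rw [← hT, ← b.tsum_inner_mul_inner f (T g)]
  refine tsum_congr fun i => ?_
  rw [hsymm (b i) g, hTb, inner_smul_right, map_mul, Complex.conj_ofReal]
  ring

end SecondMoments

/-! ### The complexified field -/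

/-- Complexification of real square integrable functions. -/
noncomputable def complexify : RealL2 →L[ℝ] ComplexL2 := Complex.ofRealCLM.compLpL 2 surf

theorem coeFn_complexify (x : RealL2) : complexify x =ᵐ[surf] fun ξ => ((x ξ : ℝ) : ℂ) :=
  ContinuousLinearMap.coeFn_compLpL _ x

theorem memLp_ofReal (x : RealL2) : MemLp (fun ξ => ((x ξ : ℝ) : ℂ)) 2 surf :=
  (Lp.memLp x).ofReal

theorem complexify_eq (x : RealL2) : complexify x = (memLp_ofReal x).toLp _ := by
  refine Lp.ext ?_
  filter_upwards [coeFn_complexify x, (memLp_ofReal x).coeFn_toLp] with ξ h1 h2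
  rw [h1, h2]

theorem inner_complexify {f : S2 → ℂ} (hf : MemLp f 2 surf) (x : RealL2) :
    inner ℂ (hf.toLp f) (complexify x) = ∫ ξ, (x ξ : ℂ) * conj (f ξ) ∂surf := by
  rw [complexify_eq, inner_toLp_toLp]

/-- The multipole coefficient of a real square integrable function. -/
noncomputable def coeffLp (l : ℕ) (m : ℤ) (x : RealL2) : ℂ :=
  multipole (fun ξ => ((x ξ : ℝ) : ℂ)) l m

/-- The spherical harmonic as an element of `L²`, without restriction on the order. -/
noncomputable def toLpY (l : ℕ) (m : ℤ) : ComplexL2 :=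
  (memLp_of_continuous (continuous_Y l m) 2).toLp _

theorem inner_toLpY (l : ℕ) (m : ℤ) (x : RealL2) :
    inner ℂ (toLpY l m) (complexify x) = coeffLp l m x := inner_complexify _ x

theorem continuous_coeffLp (l : ℕ) (m : ℤ) : Continuous (coeffLp l m) := by
  have h : coeffLp l m = fun x => inner ℂ (toLpY l m) (complexify x) :=
    funext fun x => (inner_toLpY l m x).symm
  rw [h]
  exact continuous_const.inner complexify.continuous

/-- Composition with a linear isometry, on real square integrable functions. -/
noncomputable def rotateLp (g : R3 ≃ₗᵢ[ℝ] R3) (x : RealL2) : RealL2 :=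
  Lp.compMeasurePreserving (rotate g) (measurePreserving_rotate g) x

theorem continuous_rotateLp (g : R3 ≃ₗᵢ[ℝ] R3) : Continuous (rotateLp g) :=
  (Lp.isometry_compMeasurePreserving (measurePreserving_rotate g)).continuous

theorem coeFn_rotateLp (g : R3 ≃ₗᵢ[ℝ] R3) (x : RealL2) :
    rotateLp g x =ᵐ[surf] fun ξ => x (rotate g ξ) :=
  Lp.coeFn_compMeasurePreserving x (measurePreserving_rotate g)

theorem integral_rotateLp_mul (g : R3 ≃ₗᵢ[ℝ] R3) (x : RealL2) (f : S2 → ℂ) :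
    ∫ ξ, (rotateLp g x ξ : ℂ) * f (rotate g ξ) ∂surf = ∫ ξ, (x ξ : ℂ) * f ξ ∂surf := by
  rw [← integral_comp_rotate g fun ξ => (x ξ : ℂ) * f ξ]
  refine integral_congr_ae ?_
  filter_upwards [coeFn_rotateLp g x] with ξ h
  rw [h]

theorem coeffLp_axisRotation (φ : ℝ) (l : ℕ) (m : ℤ) (x : RealL2) :
    coeffLp l m (rotateLp (axisRotation φ) x) = Complex.exp (m * φ * Complex.I) * coeffLp l m x := by
  have h := integral_rotateLp_mul (axisRotation φ) x fun ξ => conj (Y l m ξ)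
  have hne : Complex.exp (m * φ * Complex.I) * Complex.exp (-m * φ * Complex.I) = 1 := by
    rw [← Complex.exp_add, ← Complex.exp_zero]; congr 1; ring
  have e : ∀ ξ, (rotateLp (axisRotation φ) x ξ : ℂ) * conj (Y l m (rotate (axisRotation φ) ξ)) =
      Complex.exp (-m * φ * Complex.I) *
        ((rotateLp (axisRotation φ) x ξ : ℂ) * conj (Y l m ξ)) := fun ξ => by
    rw [Y_rotate, map_mul, exp_conj_phase]; ring
  simp only [e, integral_const_mul] at h
  change Complex.exp (-m * φ * Complex.I) * coeffLp l m (rotateLp (axisRotation φ) x)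
    = coeffLp l m x at h
  rw [← h, ← mul_assoc, hne, one_mul]

/-- The harmonic projection of a real square integrable function. -/
noncomputable def projLp (l : ℕ) (ξ : S2) (x : RealL2) : ℂ :=
  ∑ m ∈ Finset.Icc (-(l : ℤ)) l, coeffLp l m x * Y l m ξ

theorem integrable_ofReal (x : RealL2) : Integrable (fun ξ => ((x ξ : ℝ) : ℂ)) surf :=
  (memLp_ofReal x).integrable one_le_two

theorem projLp_eq_integral (l : ℕ) (ξ : S2) (x : RealL2) :
    projLp l ξ x = ∫ η, (x η : ℂ) * zonalKernel l ξ η ∂surf := by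
  simp only [zonalKernel, Finset.mul_sum]
  rw [integral_finsetSum]
  · refine Finset.sum_congr rfl fun m _ => ?_
    rw [coeffLp, multipole, ← integral_mul_const]
    refine integral_congr_ae (.of_forall fun η => ?_)
    simp only; ring
  · intro m _
    have h := (integrable_mul_conj_Y (integrable_ofReal x) l m).mul_const (Y l m ξ)
    refine h.congr (.of_forall fun η => ?_)
    simp only; ring

/-- Invariance of the kernel makes harmonic projection commute with rotations. This transfers the
invariance of the law to the values of the projections at points. -/
theorem projLp_rotateLp (g : R3 ≃ₗᵢ[ℝ] R3) (l : ℕ) (ξ : S2) (x : RealL2) :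
    projLp l ξ (rotateLp g x) = projLp l (rotate g ξ) x := by
  rw [projLp_eq_integral, projLp_eq_integral,
    ← integral_rotateLp_mul g x fun η => zonalKernel l (rotate g ξ) η]
  simp only [zonalKernel_rotate]

theorem continuous_projLp (l : ℕ) (ξ : S2) : Continuous (projLp l ξ) :=
  continuous_finsetSum _ fun m _ => (continuous_coeffLp l m).mul continuous_const

theorem multipole_sum (l : ℕ) (A : ℤ → ℂ) {m : ℤ} (hm : m ∈ Finset.Icc (-(l : ℤ)) l) :
    multipole (fun ξ => ∑ k ∈ Finset.Icc (-(l : ℤ)) l, A k * Y l k ξ) l m = A m := by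
  simp only [multipole, Finset.sum_mul]
  rw [integral_finsetSum]
  · rw [Finset.sum_eq_single_of_mem m hm]
    · simp only [mul_assoc]
      rw [integral_const_mul, integral_Y_mul_conj_Y, if_pos ⟨rfl, rfl, hm⟩, mul_one]
    · intro k _ hk
      simp only [mul_assoc]
      rw [integral_const_mul, integral_Y_mul_conj_Y, if_neg (fun h => hk h.2.1), mul_zero]
  · intro k _
    simp only [mul_assoc]
    exact (integrable_mul_conj_Y (integrable_of_continuous (continuous_Y l k)) l m).const_mul _

/-- The north pole. -/
noncomputable def northPole : S2 := ⟨EuclideanSpace.single 2 1, by simp⟩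

theorem Y_northPole {m : ℤ} (hm : m ≠ 0) (l : ℕ) : Y l m northPole = 0 := by
  have h0 : horizontal northPole = 0 := by simp [horizontal, northPole]
  obtain ⟨k, rfl | rfl⟩ := Int.eq_nat_or_neg m
  · rw [Y_of_nonneg, h0, zero_pow (by omega), mul_zero]
  · rw [Y_neg_eq, h0, map_zero, zero_pow (by omega), mul_zero, mul_zero]

theorem zonalKernel_northPole (l : ℕ) (ξ : S2) :
    zonalKernel l ξ northPole = Y l 0 ξ * conj (Y l 0 northPole) := by
  rw [zonalKernel, Finset.sum_eq_single_of_mem 0 (by simp)]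
  intro m _ hm
  rw [Y_northPole hm, map_zero, mul_zero]

/-- At the pole only the order `0` contributes to the kernel, whose diagonal is positive. -/
theorem Y_zero_northPole_ne_zero (l : ℕ) : Y l 0 northPole ≠ 0 := by
  intro h
  have h1 := zonalKernel_self l northPole
  rw [zonalKernel_northPole, h, zero_mul] at h1
  have h2 : (0 : ℝ) < (2 * l + 1) / (4 * Real.pi) := by positivity
  exact h2.ne (by exact_mod_cast h1)

/-! ### Covariance structure of an isotropic field -/

section Field

variable {Ω : Type*} [MeasurableSpace Ω] {P : Measure Ω} {X : Ω → RealL2} {C : ℕ → ℝ}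

namespace IsGaussianIsotropicField

/-- Gaussian measures on a separable Banach space have finite moments of all orders; `L²` of the
sphere is separable. Every covariance below relies on this second moment. -/
theorem memLp (hX : IsGaussianIsotropicField P X C) : MemLp (fun ω => complexify (X ω)) 2 P := by
  have := hX.gaussian
  have : Fact ((2 : ENNReal) ≠ ⊤) := ⟨ENNReal.ofNat_ne_top⟩
  have : MeasureTheory.IsSeparable surf := isSeparable_of_sigmaFinite surf
  have : SecondCountableTopology RealL2 := Lp.SecondCountableTopology
  have h1 : MemLp id 2 (P.map X) := IsGaussian.memLp_id _ 2 ENNReal.ofNat_ne_top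
  have h2 : MemLp X 2 P := (memLp_map_measure_iff h1.1 hX.measurable.aemeasurable).mp h1
  exact complexify.comp_memLp' h2

theorem integral_rotateLp (hX : IsGaussianIsotropicField P X C) {g : R3 ≃ₗᵢ[ℝ] R3}
    (hg : LinearMap.det (g.toLinearEquiv : R3 →ₗ[ℝ] R3) = 1) {F : RealL2 → ℂ} (hF : Continuous F) :
    ∫ ω, F (rotateLp g (X ω)) ∂P = ∫ ω, F (X ω) ∂P := by
  have h1 : AEMeasurable (fun ω => rotateLp g (X ω)) P :=
    ((continuous_rotateLp g).measurable.comp hX.measurable).aemeasurable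
  have h := hX.isotropic g hg
  rw [← integral_map h1 hF.aestronglyMeasurable,
    ← integral_map hX.measurable.aemeasurable hF.aestronglyMeasurable, ← h]
  rfl

theorem integrable_coeff_mul_conj (hX : IsGaussianIsotropicField P X C) (l l' : ℕ) (m m' : ℤ) :
    Integrable (fun ω => coeffLp l m (X ω) * conj (coeffLp l' m' (X ω))) P := by
  simpa only [inner_toLpY] using
    integrable_inner_mul_conj_inner hX.memLp (toLpY l m) (toLpY l' m')

/-- A rotation by `φ` about the polar axis preserves the law and multiplies the product by `e^{i(m -
m')φ}`. -/
theorem integral_coeff_eq_zero (hX : IsGaussianIsotropicField P X C) {m m' : ℤ} (hm : m ≠ m')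
    (l l' : ℕ) : ∫ ω, coeffLp l m (X ω) * conj (coeffLp l' m' (X ω)) ∂P = 0 := by
  obtain ⟨φ, hφ⟩ := exists_exp_ne_one (sub_ne_zero.mpr hm)
  have h := hX.integral_rotateLp (det_axisRotation φ)
    (F := fun x => coeffLp l m x * conj (coeffLp l' m' x))
    ((continuous_coeffLp l m).mul (Complex.continuous_conj.comp (continuous_coeffLp l' m')))
  have e : ∀ ω, coeffLp l m (rotateLp (axisRotation φ) (X ω)) *
      conj (coeffLp l' m' (rotateLp (axisRotation φ) (X ω))) =
      Complex.exp ((m - m' : ℤ) * φ * Complex.I) *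
        (coeffLp l m (X ω) * conj (coeffLp l' m' (X ω))) := fun ω => by
    rw [coeffLp_axisRotation, coeffLp_axisRotation, map_mul, exp_conj_phase,
      show ((m - m' : ℤ) : ℂ) * φ * Complex.I = m * φ * Complex.I + -m' * φ * Complex.I by
        push_cast; ring, Complex.exp_add]
    ring
  simp only [e, integral_const_mul] at h
  have h2 : (Complex.exp ((m - m' : ℤ) * φ * Complex.I) - 1) *
      ∫ ω, coeffLp l m (X ω) * conj (coeffLp l' m' (X ω)) ∂P = 0 := by
    rw [sub_mul, h]; ring
  exact (mul_eq_zero.mp h2).resolve_left (sub_ne_zero.mpr hφ)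

/-- The covariance kernel of two harmonic projections. -/
theorem integral_proj_mul_conj_proj (hX : IsGaussianIsotropicField P X C) (l l' : ℕ) (ξ η : S2) :
    ∫ ω, projLp l ξ (X ω) * conj (projLp l' η (X ω)) ∂P =
      ∑ m ∈ Finset.Icc (-(l : ℤ)) l, (∑ m' ∈ Finset.Icc (-(l' : ℤ)) l',
        (∫ ω, coeffLp l m (X ω) * conj (coeffLp l' m' (X ω)) ∂P) * conj (Y l' m' η)) * Y l m ξ := by
  have e : ∀ ω, projLp l ξ (X ω) * conj (projLp l' η (X ω)) =
      ∑ m ∈ Finset.Icc (-(l : ℤ)) l, ∑ m' ∈ Finset.Icc (-(l' : ℤ)) l',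
        (coeffLp l m (X ω) * conj (coeffLp l' m' (X ω))) * (conj (Y l' m' η) * Y l m ξ) :=
    fun ω => by
      rw [projLp, projLp, map_sum, Finset.sum_mul_sum]
      refine Finset.sum_congr rfl fun m _ => Finset.sum_congr rfl fun m' _ => ?_
      rw [map_mul]; ring
  simp only [e]
  rw [integral_finsetSum]
  · refine Finset.sum_congr rfl fun m _ => ?_
    rw [integral_finsetSum, Finset.sum_mul]
    · refine Finset.sum_congr rfl fun m' _ => ?_
      rw [integral_mul_const, mul_assoc]
    · exact fun m' _ => (hX.integrable_coeff_mul_conj l l' m m').mul_const _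
  · exact fun m _ => integrable_finsetSum _ fun m' _ =>
      (hX.integrable_coeff_mul_conj l l' m m').mul_const _

/-- The covariance kernel `F` of the projections of degrees `l` and `l'` is rotation invariant. With
one argument at the pole, only the orders `0` survive, so `F` is there a multiple of the reproducing
kernel. Transitivity of the rotations extends this to all arguments, and comparing coefficients
gives the claim. -/
theorem exists_integral_coeff (hX : IsGaussianIsotropicField P X C) (l l' : ℕ) :
    ∃ c : ℂ, ∀ m ∈ Finset.Icc (-(l : ℤ)) l, ∀ m' ∈ Finset.Icc (-(l' : ℤ)) l',
      ∫ ω, coeffLp l m (X ω) * conj (coeffLp l' m' (X ω)) ∂P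
        = if l = l' ∧ m = m' then c else 0 := by
  set M : ℤ → ℤ → ℂ := fun m m' => ∫ ω, coeffLp l m (X ω) * conj (coeffLp l' m' (X ω)) ∂P with hM
  -- The constant is the ratio of `F` to the kernel when the second argument is the pole.
  set c : ℂ := M 0 0 * conj (Y l' 0 northPole) / conj (Y l 0 northPole) with hc
  have hy : conj (Y l 0 northPole) ≠ 0 := by
    rw [Ne, map_eq_zero]; exact Y_zero_northPole_ne_zero l
  let F : S2 → S2 → ℂ := fun ξ η => ∫ ω, projLp l ξ (X ω) * conj (projLp l' η (X ω)) ∂P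
  have hFdef : ∀ ξ η, F ξ η = ∑ m ∈ Finset.Icc (-(l : ℤ)) l,
      (∑ m' ∈ Finset.Icc (-(l' : ℤ)) l', M m m' * conj (Y l' m' η)) * Y l m ξ := fun ξ η =>
    hX.integral_proj_mul_conj_proj l l' ξ η
  have hpole : ∀ ξ, F ξ northPole = c * zonalKernel l ξ northPole := fun ξ => by
    have h0 : ∀ m, ∑ m' ∈ Finset.Icc (-(l' : ℤ)) l', M m m' * conj (Y l' m' northPole)
        = M m 0 * conj (Y l' 0 northPole) := fun m => by
      rw [Finset.sum_eq_single_of_mem 0 (by simp)]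
      intro m' _ hm'
      rw [Y_northPole hm', map_zero, mul_zero]
    rw [hFdef, zonalKernel_northPole, Finset.sum_eq_single_of_mem 0 (by simp), h0, hc]
    · field_simp
    · intro m _ hm
      rw [h0, hM]
      simp only
      rw [hX.integral_coeff_eq_zero hm, zero_mul, zero_mul]
  -- A rotation taking the pole to `η` reduces the second argument to the pole; both `F` and the
  -- kernel are unchanged when it acts on both arguments.
  have hF : ∀ ξ η, F ξ η = c * zonalKernel l ξ η := fun ξ η => by
    obtain ⟨g, hg, hgη⟩ := exists_rotation northPole η
    have h1 := hX.integral_rotateLp hg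
      (F := fun x => projLp l (rotate g.symm ξ) x * conj (projLp l' northPole x))
      ((continuous_projLp l _).mul (Complex.continuous_conj.comp (continuous_projLp l' _)))
    simp only [projLp_rotateLp, rotate_rotate_symm, hgη] at h1
    change F ξ η = F (rotate g.symm ξ) northPole at h1
    rw [h1, hpole, ← zonalKernel_rotate g, rotate_rotate_symm, hgη]
  refine ⟨c, fun m hm m' hm' => ?_⟩
  -- The identity of kernels is projected on `Y l m` in the first variable; what remains is
  -- conjugated and projected on `Y l' m'` in the second.
  have h1 : ∀ η, ∑ k ∈ Finset.Icc (-(l' : ℤ)) l', M m k * conj (Y l' k η) = c * conj (Y l m η) :=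
    fun η => by
      have e1 : (fun ξ => F ξ η) = fun ξ => ∑ k ∈ Finset.Icc (-(l : ℤ)) l,
          (c * conj (Y l k η)) * Y l k ξ := by
        funext ξ
        rw [hF, zonalKernel, Finset.mul_sum]
        exact Finset.sum_congr rfl fun k _ => by ring
      have e2 : (fun ξ => F ξ η) = fun ξ => ∑ k ∈ Finset.Icc (-(l : ℤ)) l,
          (∑ k' ∈ Finset.Icc (-(l' : ℤ)) l', M k k' * conj (Y l' k' η)) * Y l k ξ :=
        funext fun ξ => hFdef ξ η
      have h2 := multipole_sum l (fun k => c * conj (Y l k η)) hm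
      have h3 := multipole_sum l (fun k => ∑ k' ∈ Finset.Icc (-(l' : ℤ)) l',
        M k k' * conj (Y l' k' η)) hm
      rw [← e1] at h2
      rw [← e2] at h3
      rw [← h2, ← h3]
  have h2 : (fun η => ∑ k ∈ Finset.Icc (-(l' : ℤ)) l', conj (M m k) * Y l' k η)
      = fun η => conj c * Y l m η := by
    funext η
    have := congrArg conj (h1 η)
    simpa only [map_sum, map_mul, Complex.conj_conj] using this
  have h3 := multipole_sum l' (fun k => conj (M m k)) hm'
  rw [h2, multipole_const_mul, multipole_Y] at h3
  have h4 := congrArg conj h3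
  rw [Complex.conj_conj] at h4
  change M m m' = _
  rw [← h4, map_mul, Complex.conj_conj]
  by_cases h : l = l' ∧ m = m'
  · rw [if_pos h, if_pos ⟨h.1, h.2, hm⟩, map_one, mul_one]
  · rw [if_neg h, if_neg (fun h' => h ⟨h'.1, h'.2.1⟩), map_zero, mul_zero]

/-- The multipole coefficients of an isotropic field are uncorrelated, with variance `C_ℓ`. -/
theorem integral_coeff (hX : IsGaussianIsotropicField P X C) {l l' : ℕ} {m m' : ℤ}
    (hm : m ∈ Finset.Icc (-(l : ℤ)) l) (hm' : m' ∈ Finset.Icc (-(l' : ℤ)) l') :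
    ∫ ω, coeffLp l m (X ω) * conj (coeffLp l' m' (X ω)) ∂P
      = if l = l' ∧ m = m' then (C l : ℂ) else 0 := by
  obtain ⟨c, hc⟩ := hX.exists_integral_coeff l l'
  rw [hc m hm m' hm']
  by_cases h : l = l' ∧ m = m'
  · rw [if_pos h, if_pos h]
    obtain ⟨rfl, rfl⟩ := h
    -- All orders have the same variance `c`, so their mean, which is `C l` by definition, equals
    -- `c`.
    have h1 : ∀ k ∈ Finset.Icc (-(l : ℤ)) l,
        ((∫ ω, ‖multipole (sample X ω) l k‖ ^ 2 ∂P : ℝ) : ℂ) = c := fun k hk => by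
      have h2 := hc k hk k hk
      rw [if_pos ⟨rfl, rfl⟩] at h2
      rw [← h2, ← integral_complex_ofReal]
      refine integral_congr_ae (.of_forall fun ω => ?_)
      simp only [Complex.mul_conj', Complex.ofReal_pow]
      rfl
    have hcard : ((l : ℤ) + 1 - -(l : ℤ)).toNat = 2 * l + 1 := by omega
    rw [hX.spectrum l]
    push_cast
    rw [Finset.sum_congr rfl h1, Finset.sum_const, Int.card_Icc, hcard, nsmul_eq_mul]
    push_cast
    rw [inv_mul_cancel_left₀]
    exact_mod_cast (show (2 * l + 1) ≠ 0 by omega)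
  · rw [if_neg h, if_neg h]

theorem integral_norm_coeff_sq (hX : IsGaussianIsotropicField P X C) (i : HIdx) :
    ∫ ω, ‖coeffLp i.1 i.2 (X ω)‖ ^ 2 ∂P = C i.1 := by
  have h := hX.integral_coeff i.2.2 i.2.2
  rw [if_pos ⟨rfl, rfl⟩] at h
  have e : ∫ ω, coeffLp i.1 i.2 (X ω) * conj (coeffLp i.1 i.2 (X ω)) ∂P
      = ((∫ ω, ‖coeffLp i.1 i.2 (X ω)‖ ^ 2 ∂P : ℝ) : ℂ) := by
    rw [← integral_complex_ofReal]
    refine integral_congr_ae (.of_forall fun ω => ?_)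
    simp only [Complex.mul_conj', Complex.ofReal_pow]
  rw [e] at h
  exact_mod_cast h

theorem spectrum_nonneg (hX : IsGaussianIsotropicField P X C) (l : ℕ) : 0 ≤ C l := by
  have h := hX.integral_norm_coeff_sq (zonalIdx l)
  exact h ▸ integral_nonneg fun ω => by positivity

theorem inner_harmonicBasis (x : RealL2) (i : HIdx) :
    inner ℂ (harmonicBasis i) (complexify x) = coeffLp i.1 i.2 x := by
  rw [complexify_eq, inner_lpY]; rfl

/-- Bessel's inequality under the expectation bounds all finite sums by `𝔼‖X‖²`. Over pairs `(ℓ, m)`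
the series is `∑ (2ℓ+1) C_ℓ`. -/
theorem summable_spectrum (hX : IsGaussianIsotropicField P X C) :
    Summable fun i : HIdx => C i.1 := by
  refine summable_of_sum_le (c := ∫ ω, ‖complexify (X ω)‖ ^ 2 ∂P)
    (fun i => hX.spectrum_nonneg i.1) fun s => ?_
  have hint : ∀ i : HIdx, Integrable (fun ω => ‖coeffLp i.1 i.2 (X ω)‖ ^ 2) P := fun i => by
    have h : MemLp (fun ω => inner ℂ (harmonicBasis i) (complexify (X ω))) 2 P :=
      hX.memLp.const_inner _
    simpa only [inner_harmonicBasis] using h.integrable_norm_pow (p := 2) two_ne_zero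
  calc ∑ i ∈ s, C i.1 = ∫ ω, ∑ i ∈ s, ‖coeffLp i.1 i.2 (X ω)‖ ^ 2 ∂P := by
        rw [integral_finsetSum _ fun i _ => hint i]
        exact Finset.sum_congr rfl fun i _ => (hX.integral_norm_coeff_sq i).symm
    _ ≤ ∫ ω, ‖complexify (X ω)‖ ^ 2 ∂P := by
        refine integral_mono (integrable_finsetSum _ fun i _ => hint i)
          (hX.memLp.integrable_norm_pow two_ne_zero) fun ω => ?_
        simpa only [inner_harmonicBasis] using
          harmonicBasis.orthonormal.sum_inner_products_le (complexify (X ω)) (s := s)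

/-- The covariance of two linear functionals of the field. -/
theorem integral_inner_complexify (hX : IsGaussianIsotropicField P X C) (f g : ComplexL2) :
    ∫ ω, inner ℂ f (complexify (X ω)) * conj (inner ℂ g (complexify (X ω))) ∂P
      = ∑' i : HIdx, (C i.1 : ℂ) * inner ℂ f (harmonicBasis i) *
          conj (inner ℂ g (harmonicBasis i)) := by
  refine integral_inner_mul_conj_inner harmonicBasis hX.memLp (fun i : HIdx => C i.1) ?_ ?_ f g
  · intro i
    simp only [inner_harmonicBasis]
    rw [hX.integral_coeff i.2.2 i.2.2, if_pos ⟨rfl, rfl⟩]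
  · rintro ⟨l, m⟩ ⟨l', m'⟩ hij
    simp only [inner_harmonicBasis]
    rw [hX.integral_coeff m.2 m'.2, if_neg]
    rintro ⟨rfl, h⟩
    exact hij (by rw [Subtype.ext h])

end IsGaussianIsotropicField

end Field

/-! ### The variance of the smoothed field -/

section Window

variable {Ω : Type*} {mΩ : MeasurableSpace Ω} {P : Measure Ω} {X : Ω → RealL2} {C : ℕ → ℝ}
  {lmin lmax : ℕ}

theorem window_quadratic (C : ℕ → ℝ) (b : Band lmin lmax → ℝ) :
    b ⬝ᵥ (sigmaMatrix C lmin lmax *ᵥ b) = ∑ l, b l ^ 2 * ((2 * (l.1 : ℝ) + 1) * C l.1) := by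
  simp only [dotProduct, sigmaMatrix, Matrix.mulVec_diagonal]
  exact Finset.sum_congr rfl fun l _ => by ring

theorem IsGaussianIsotropicField.integral_proj (hX : IsGaussianIsotropicField P X C) (l l' : ℕ)
    (ξ η : S2) : ∫ ω, projLp l ξ (X ω) * conj (projLp l' η (X ω)) ∂P
      = if l = l' then C l * zonalKernel l ξ η else 0 := by
  rw [hX.integral_proj_mul_conj_proj]
  split_ifs with h
  · subst h
    rw [zonalKernel, Finset.mul_sum]
    refine Finset.sum_congr rfl fun m hm => ?_
    rw [Finset.sum_eq_single_of_mem m hm, hX.integral_coeff hm hm, if_pos ⟨rfl, rfl⟩]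
    · ring
    · intro m' hm' hne
      rw [hX.integral_coeff hm hm', if_neg (fun e => hne e.2.symm), zero_mul]
  · refine Finset.sum_eq_zero fun m hm => ?_
    rw [Finset.sum_eq_zero, zero_mul]
    intro m' hm'
    rw [hX.integral_coeff hm hm', if_neg (fun e => h e.1), zero_mul]

theorem IsGaussianIsotropicField.integrable_proj (hX : IsGaussianIsotropicField P X C) (l l' : ℕ)
    (ξ η : S2) : Integrable (fun ω => projLp l ξ (X ω) * conj (projLp l' η (X ω))) P := by
  have e : ∀ ω, projLp l ξ (X ω) * conj (projLp l' η (X ω)) =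
      ∑ m ∈ Finset.Icc (-(l : ℤ)) l, ∑ m' ∈ Finset.Icc (-(l' : ℤ)) l',
        (coeffLp l m (X ω) * conj (coeffLp l' m' (X ω))) * (conj (Y l' m' η) * Y l m ξ) :=
    fun ω => by
      rw [projLp, projLp, map_sum, Finset.sum_mul_sum]
      refine Finset.sum_congr rfl fun m _ => Finset.sum_congr rfl fun m' _ => ?_
      rw [map_mul]; ring
  simp only [e]
  exact integrable_finsetSum _ fun m _ => integrable_finsetSum _ fun m' _ =>
    (hX.integrable_coeff_mul_conj l l' m m').mul_const _

theorem norm_smooth_sq (b : Band lmin lmax → ℝ) (ω : Ω) (ξ : S2) :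
    ((‖smooth b (sample X ω) ξ‖ ^ 2 : ℝ) : ℂ) = ∑ l, ∑ l', ((b l : ℂ) * b l') *
      (projLp l.1 ξ (X ω) * conj (projLp l'.1 ξ (X ω))) := by
  have e : smooth b (sample X ω) ξ = ∑ l, (b l : ℂ) * projLp l.1 ξ (X ω) := rfl
  rw [Complex.ofReal_pow, ← Complex.mul_conj', e, map_sum, Finset.sum_mul_sum]
  refine Finset.sum_congr rfl fun l _ => Finset.sum_congr rfl fun l' _ => ?_
  rw [map_mul, Complex.conj_ofReal]; ring

theorem IsGaussianIsotropicField.integrable_norm_smooth_sq (hX : IsGaussianIsotropicField P X C)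
    (b : Band lmin lmax → ℝ) (ξ : S2) :
    Integrable (fun ω => ‖smooth b (sample X ω) ξ‖ ^ 2) P := by
  have h : Integrable (fun ω => ((‖smooth b (sample X ω) ξ‖ ^ 2 : ℝ) : ℂ)) P := by
    simp only [norm_smooth_sq]
    exact integrable_finsetSum _ fun l _ => integrable_finsetSum _ fun l' _ =>
      (hX.integrable_proj l.1 l'.1 ξ ξ).const_mul _
  simpa only [Complex.ofReal_re] using! h.re

/-- Projections of different degrees are uncorrelated, and degree `ℓ` contributes `b_ℓ² C_ℓ` times
the diagonal of the kernel, `(2ℓ+1)/(4π)`. -/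
theorem IsGaussianIsotropicField.smoothVariance_eq (hX : IsGaussianIsotropicField P X C)
    (b : Band lmin lmax → ℝ) (ξ : S2) :
    smoothVariance P X b ξ
      = (4 * Real.pi)⁻¹ * (b ⬝ᵥ (sigmaMatrix C lmin lmax *ᵥ b)) := by
  have h : ((smoothVariance P X b ξ : ℝ) : ℂ) =
      (((4 * Real.pi)⁻¹ * (b ⬝ᵥ (sigmaMatrix C lmin lmax *ᵥ b)) : ℝ) : ℂ) := by
    rw [smoothVariance, ← integral_complex_ofReal]
    simp only [norm_smooth_sq]
    rw [integral_finsetSum _ fun l _ => integrable_finsetSum _ fun l' _ =>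
      (hX.integrable_proj l.1 l'.1 ξ ξ).const_mul _, window_quadratic, Finset.mul_sum]
    push_cast
    refine Finset.sum_congr rfl fun l _ => ?_
    rw [integral_finsetSum _ fun l' _ => (hX.integrable_proj l.1 l'.1 ξ ξ).const_mul _,
      Finset.sum_eq_single_of_mem l (Finset.mem_univ l)]
    · rw [integral_const_mul, hX.integral_proj, if_pos rfl, zonalKernel_self]
      push_cast
      have : (Real.pi : ℂ) ≠ 0 := by exact_mod_cast Real.pi_ne_zero
      field_simp
    · intro l' _ hne
      rw [integral_const_mul, hX.integral_proj, if_neg (fun e => hne (Subtype.ext e.symm)),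
        mul_zero]
  exact_mod_cast h

/-! ### The masked field -/

theorem memLp_conj_mul_Y {V : S2 → ℂ} (hV : MemLp V 2 surf) (l : ℕ) (m : ℤ) :
    MemLp (fun ξ => conj (V ξ) * Y l m ξ) 2 surf := by
  have h1 : MemLp (Y l m) ⊤ surf := memLp_of_continuous (continuous_Y l m) ⊤
  have h2 : MemLp (fun ξ => conj (V ξ)) 2 surf := hV.star
  exact h1.mul h2

/-- The multipole coefficients of the product of a weight and the field. -/
noncomputable def maskedCoeff (V : S2 → ℂ) (l : ℕ) (m : ℤ) (x : RealL2) : ℂ :=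
  multipole (fun η => ((x η : ℝ) : ℂ) * V η) l m

/-- A product of two `L²` functions is in general only integrable, so the weight is moved onto the
test function `conj V * Y l m`, which is in `L²` because `Y l m` is bounded. The coefficient thus
becomes a continuous functional of the field. -/
theorem inner_memLp_conj_mul_Y {V : S2 → ℂ} (hV : MemLp V 2 surf) (l : ℕ) (m : ℤ) (x : RealL2) :
    inner ℂ ((memLp_conj_mul_Y hV l m).toLp _) (complexify x) = maskedCoeff V l m x := by
  rw [inner_complexify, maskedCoeff, multipole]
  refine integral_congr_ae (.of_forall fun ξ => ?_)
  simp only [map_mul, Complex.conj_conj, mul_assoc]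

theorem inner_memLp_conj_mul_Y_basis {V : S2 → ℂ} (hV : MemLp V 2 surf) (l : ℕ) (m : ℤ)
    (i : HIdx) : inner ℂ ((memLp_conj_mul_Y hV l m).toLp _) (harmonicBasis i)
      = coupling V i.1 l i.2 m := by
  rw [harmonicBasis_apply, lpY_eq, inner_toLp_toLp, coupling]
  refine integral_congr_ae (.of_forall fun ξ => ?_)
  simp only [map_mul, Complex.conj_conj]; ring

theorem IsGaussianIsotropicField.integrable_maskedCoeff (hX : IsGaussianIsotropicField P X C)
    {V : S2 → ℂ} (hV : MemLp V 2 surf) (l l' : ℕ) (m m' : ℤ) :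
    Integrable (fun ω => maskedCoeff V l m (X ω) * conj (maskedCoeff V l' m' (X ω))) P := by
  simpa only [inner_memLp_conj_mul_Y hV] using integrable_inner_mul_conj_inner hX.memLp
    ((memLp_conj_mul_Y hV l m).toLp _) ((memLp_conj_mul_Y hV l' m').toLp _)

theorem IsGaussianIsotropicField.integral_maskedCoeff (hX : IsGaussianIsotropicField P X C)
    {V : S2 → ℂ} (hV : MemLp V 2 surf) (l l' : ℕ) (m m' : ℤ) :
    ∫ ω, maskedCoeff V l m (X ω) * conj (maskedCoeff V l' m' (X ω)) ∂P
      = ∑' i : HIdx, (C i.1 : ℂ) * coupling V i.1 l i.2 m * conj (coupling V i.1 l' i.2 m') := by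
  simpa only [inner_memLp_conj_mul_Y hV, inner_memLp_conj_mul_Y_basis hV] using
    hX.integral_inner_complexify ((memLp_conj_mul_Y hV l m).toLp _)
      ((memLp_conj_mul_Y hV l' m').toLp _)

/-! ### Expansion and expectation of the integrated square error -/

theorem smooth_masked (b : Band lmin lmax → ℝ) (V : S2 → ℂ) (ω : Ω) (ξ : S2) :
    smooth b (fun η => sample X ω η * V η) ξ = ∑ l, ∑ m ∈ Finset.Icc (-(l.1 : ℤ)) l.1,
      ((b l : ℂ) * maskedCoeff V l.1 m (X ω)) * Y l.1 m ξ := by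
  rw [smooth]
  refine Finset.sum_congr rfl fun l _ => ?_
  rw [proj, Finset.mul_sum]
  exact Finset.sum_congr rfl fun m _ => (mul_assoc _ _ _).symm

theorem integrable_sample_mul {V : S2 → ℂ} (hV : MemLp V 2 surf) (ω : Ω) :
    Integrable (fun η => sample X ω η * V η) surf :=
  (memLp_ofReal (X ω)).integrable_mul hV

theorem smooth_sub_smooth {W : S2 → ℂ} (hW : MemLp W 2 surf) (b : Band lmin lmax → ℝ) (ω : Ω)
    (ξ : S2) : smooth b (sample X ω) ξ - smooth b (fun η => sample X ω η * W η) ξ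
      = smooth b (fun η => sample X ω η * (1 - W η)) ξ := by
  simp only [smooth, proj, ← Finset.sum_sub_distrib, ← mul_sub, ← sub_mul]
  refine Finset.sum_congr rfl fun l _ => ?_
  congr 1
  refine Finset.sum_congr rfl fun m _ => ?_
  congr 1
  have h := multipole_sub (f := sample X ω) (integrable_ofReal (X ω))
    (integrable_sample_mul (X := X) hW ω) l.1 m
  rw [← h]
  simp only [mul_sub, mul_one]

/-- The pointwise expansion of the integrand of the mean integrated square error. -/
theorem weight_mul_norm_smooth_sq (b : Band lmin lmax → ℝ) (V : S2 → ℂ) (D : S2 → ℂ) (ω : Ω)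
    (ξ : S2) :
    D ξ * ((‖smooth b (fun η => sample X ω η * V η) ξ‖ ^ 2 : ℝ) : ℂ) =
      ∑ l, ∑ m ∈ Finset.Icc (-(l.1 : ℤ)) l.1, ∑ l', ∑ m' ∈ Finset.Icc (-(l'.1 : ℤ)) l'.1,
        ((b l : ℂ) * b l' * (maskedCoeff V l.1 m (X ω) * conj (maskedCoeff V l'.1 m' (X ω)))) *
          (D ξ * Y l.1 m ξ * conj (Y l'.1 m' ξ)) := by
  rw [Complex.ofReal_pow, ← Complex.mul_conj', smooth_masked, map_sum, Finset.sum_mul,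
    Finset.mul_sum]
  refine Finset.sum_congr rfl fun l _ => ?_
  rw [Finset.sum_mul, Finset.mul_sum]
  refine Finset.sum_congr rfl fun m _ => ?_
  rw [Finset.mul_sum, Finset.mul_sum]
  refine Finset.sum_congr rfl fun l' _ => ?_
  rw [map_sum, Finset.mul_sum, Finset.mul_sum]
  refine Finset.sum_congr rfl fun m' _ => ?_
  simp only [map_mul, Complex.conj_ofReal]
  ring

theorem integrable_weight_mul_Y_mul_conj_Y {D : S2 → ℂ} (hD : MemLp D 2 surf) (l l' : ℕ)
    (m m' : ℤ) : Integrable (fun ξ => D ξ * Y l m ξ * conj (Y l' m' ξ)) surf := by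
  refine integrable_mul_conj_Y ?_ l' m'
  exact hD.integrable_mul (memLp_of_continuous (continuous_Y l m) 2)

theorem integrable_weight_mul_norm_smooth_sq {D : S2 → ℂ} (hD : MemLp D 2 surf)
    (b : Band lmin lmax → ℝ) (V : S2 → ℂ) (ω : Ω) :
    Integrable (fun ξ => D ξ * ((‖smooth b (fun η => sample X ω η * V η) ξ‖ ^ 2 : ℝ) : ℂ)) surf := by
  simp only [weight_mul_norm_smooth_sq]
  exact integrable_finsetSum _ fun l _ => integrable_finsetSum _ fun m _ =>
    integrable_finsetSum _ fun l' _ => integrable_finsetSum _ fun m' _ =>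
      (integrable_weight_mul_Y_mul_conj_Y hD l.1 l'.1 m m').const_mul _

theorem integral_weight_mul_norm_smooth_sq {D : S2 → ℂ} (hD : MemLp D 2 surf)
    (b : Band lmin lmax → ℝ) (V : S2 → ℂ) (ω : Ω) :
    ∫ ξ, D ξ * ((‖smooth b (fun η => sample X ω η * V η) ξ‖ ^ 2 : ℝ) : ℂ) ∂surf =
      ∑ l, ∑ m ∈ Finset.Icc (-(l.1 : ℤ)) l.1, ∑ l', ∑ m' ∈ Finset.Icc (-(l'.1 : ℤ)) l'.1,
        ((b l : ℂ) * b l' * coupling D l.1 l'.1 m m') *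
          (maskedCoeff V l.1 m (X ω) * conj (maskedCoeff V l'.1 m' (X ω))) := by
  have hi := fun (l l' : ℕ) (m m' : ℤ) => integrable_weight_mul_Y_mul_conj_Y hD l l' m m'
  simp only [weight_mul_norm_smooth_sq]
  rw [integral_finsetSum _ fun l _ => integrable_finsetSum _ fun m _ =>
    integrable_finsetSum _ fun l' _ => integrable_finsetSum _ fun m' _ => (hi _ _ _ _).const_mul _]
  refine Finset.sum_congr rfl fun l _ => ?_
  rw [integral_finsetSum _ fun m _ => integrable_finsetSum _ fun l' _ =>
    integrable_finsetSum _ fun m' _ => (hi _ _ _ _).const_mul _]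
  refine Finset.sum_congr rfl fun m _ => ?_
  rw [integral_finsetSum _ fun l' _ => integrable_finsetSum _ fun m' _ => (hi _ _ _ _).const_mul _]
  refine Finset.sum_congr rfl fun l' _ => ?_
  rw [integral_finsetSum _ fun m' _ => (hi _ _ _ _).const_mul _]
  refine Finset.sum_congr rfl fun m' _ => ?_
  rw [integral_const_mul, coupling]
  ring

theorem IsGaussianIsotropicField.integrable_integral_weight (hX : IsGaussianIsotropicField P X C)
    {D V : S2 → ℂ} (hD : MemLp D 2 surf) (hV : MemLp V 2 surf) (b : Band lmin lmax → ℝ) :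
    Integrable (fun ω => ∫ ξ, D ξ *
      ((‖smooth b (fun η => sample X ω η * V η) ξ‖ ^ 2 : ℝ) : ℂ) ∂surf) P := by
  simp only [integral_weight_mul_norm_smooth_sq hD]
  exact integrable_finsetSum _ fun l _ => integrable_finsetSum _ fun m _ =>
    integrable_finsetSum _ fun l' _ => integrable_finsetSum _ fun m' _ =>
      (hX.integrable_maskedCoeff hV l.1 l'.1 m m').const_mul _

theorem quadratic_qMatrix (C : ℕ → ℝ) (W D : S2 → ℂ) (b : Band lmin lmax → ℝ) :
    (fun l => (b l : ℂ)) ⬝ᵥ (qMatrix C W D lmin lmax *ᵥ fun l => (b l : ℂ)) =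
      ∑ l, ∑ m ∈ Finset.Icc (-(l.1 : ℤ)) l.1, ∑ l', ∑ m' ∈ Finset.Icc (-(l'.1 : ℤ)) l'.1,
        ((b l : ℂ) * b l') * ∑' p, qTerm C W D l.1 l'.1 m m' p := by
  simp only [dotProduct, Matrix.mulVec, qMatrix, Matrix.of_apply, qEntry]
  refine Finset.sum_congr rfl fun l _ => ?_
  rw [Finset.sum_comm, Finset.mul_sum]
  refine Finset.sum_congr rfl fun l' _ => ?_
  rw [Finset.sum_mul, Finset.mul_sum]
  refine Finset.sum_congr rfl fun m _ => ?_
  rw [Finset.sum_mul, Finset.mul_sum]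
  exact Finset.sum_congr rfl fun m' _ => by ring

/-- The mean integrated square of the smoothed masked field is the quadratic form of `Q`. -/
theorem IsGaussianIsotropicField.integral_integral_weight (hX : IsGaussianIsotropicField P X C)
    {D W : S2 → ℂ} (hD : MemLp D 2 surf) (hW : MemLp W 2 surf) (b : Band lmin lmax → ℝ) :
    ∫ ω, ∫ ξ, D ξ * ((‖smooth b (fun η => sample X ω η * (1 - W η)) ξ‖ ^ 2 : ℝ) : ℂ) ∂surf ∂P =
      (fun l => (b l : ℂ)) ⬝ᵥ (qMatrix C W D lmin lmax *ᵥ fun l => (b l : ℂ)) := by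
  have hi := fun (l l' : ℕ) (m m' : ℤ) =>
    hX.integrable_maskedCoeff (memLp_one_sub hW) l l' m m'
  simp only [fun ω => integral_weight_mul_norm_smooth_sq (X := X) hD b (fun η => 1 - W η) ω]
  rw [quadratic_qMatrix, integral_finsetSum _ fun l _ => integrable_finsetSum _ fun m _ =>
    integrable_finsetSum _ fun l' _ => integrable_finsetSum _ fun m' _ => (hi _ _ _ _).const_mul _]
  refine Finset.sum_congr rfl fun l _ => ?_
  rw [integral_finsetSum _ fun m _ => integrable_finsetSum _ fun l' _ =>
    integrable_finsetSum _ fun m' _ => (hi _ _ _ _).const_mul _]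
  refine Finset.sum_congr rfl fun m _ => ?_
  rw [integral_finsetSum _ fun l' _ => integrable_finsetSum _ fun m' _ => (hi _ _ _ _).const_mul _]
  refine Finset.sum_congr rfl fun l' _ => ?_
  rw [integral_finsetSum _ fun m' _ => (hi _ _ _ _).const_mul _]
  refine Finset.sum_congr rfl fun m' _ => ?_
  -- The covariance of the masked coefficients is the first factor in the evaluation of the `qTerm`
  -- series; the coupling by `D` left by the integral over the sphere is the second.
  rw [integral_const_mul, hX.integral_maskedCoeff (memLp_one_sub hW),
    (qTerm_summable_and_tsum hX.summable_spectrum hX.spectrum_nonneg hW hD l.1 l'.1 m m').2]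
  ring

end Window

end NeedletMask

/-! ### The Rayleigh quotient and its axisymmetric reduction -/

open NeedletMask in
theorem proposition4 {Ω : Type*} [MeasurableSpace Ω] (P : Measure Ω) [IsProbabilityMeasure P]
    (X : Ω → RealL2) (C : ℕ → ℝ) (hX : IsGaussianIsotropicField P X C)
    (W D : ComplexL2) :
    -- the multiple series that define the entries of `Q` converge absolutely
    (∀ (l l' : ℕ) (m m' : ℤ), Summable (qTerm C W D l l' m m')) ∧
    -- the mean integrated square error is a generalized Rayleigh quotient
    (∀ (lmin lmax : ℕ) (b : Band lmin lmax → ℝ), b ⬝ᵥ (sigmaMatrix C lmin lmax *ᵥ b) ≠ 0 →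
      (∀ ξ : S2, Integrable (fun ω => ‖smooth b (sample X ω) ξ‖ ^ 2) P ∧
        smoothVariance P X b ξ
          = (4 * Real.pi)⁻¹ * (b ⬝ᵥ (sigmaMatrix C lmin lmax *ᵥ b))) ∧
      (∀ ω, Integrable (fun ξ => D ξ * ((‖errorField P X W b ω ξ‖ ^ 2 : ℝ) : ℂ)) surf) ∧
      Integrable (fun ω => ∫ ξ, D ξ * ((‖errorField P X W b ω ξ‖ ^ 2 : ℝ) : ℂ) ∂surf) P ∧
      mise P X W D b = 4 * (Real.pi : ℂ) *
        (((fun l => (b l : ℂ)) ⬝ᵥ (qMatrix C W D lmin lmax *ᵥ fun l => (b l : ℂ))) /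
          ((b ⬝ᵥ (sigmaMatrix C lmin lmax *ᵥ b) : ℝ) : ℂ)) ∧
      -- equivalently, with `ε` written as `(∑ σ_ℓ² b_ℓ²)^{-1/2} Φ(X(1 - W))`
      (∫ ω, ∫ ξ, D ξ * ((‖((Real.sqrt (b ⬝ᵥ (sigmaMatrix C lmin lmax *ᵥ b)))⁻¹ : ℂ) *
          smooth b (fun η => sample X ω η * (1 - W η)) ξ‖ ^ 2 : ℝ) : ℂ) ∂surf ∂P) =
        ((fun l => (b l : ℂ)) ⬝ᵥ (qMatrix C W D lmin lmax *ᵥ fun l => (b l : ℂ))) /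
          ((b ⬝ᵥ (sigmaMatrix C lmin lmax *ᵥ b) : ℝ) : ℂ)) ∧
    -- the reduced five-fold sum for axisymmetric weights
    (IsAxisymmetric W → IsAxisymmetric D → (∀ᵐ ξ ∂surf, (W ξ).im = 0) →
      ∀ l l' : ℕ,
        (∀ m : ℤ, Summable (axiTerm C W D l l' m) ∧ Summable (aTerm C W l l' m) ∧
          Summable (dTerm D l l' m)) ∧
        qEntry C W D l l' = ∑ m ∈ Finset.Icc (-(l : ℤ)) (l : ℤ),
          ∑' k : ℕ × ℕ × ℕ × ℕ, axiTerm C W D l l' m k ∧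
        qEntry C W D l l' = ∑ m ∈ Finset.Icc (-(l : ℤ)) (l : ℤ),
          (∑' k : ℕ × ℕ × ℕ, aTerm C W l l' m k) * ∑' l₄ : ℕ, dTerm D l l' m l₄) := by
  have hW : MemLp W 2 surf := Lp.memLp W
  have hD : MemLp D 2 surf := Lp.memLp D
  have hC := hX.summable_spectrum
  have hC0 := hX.spectrum_nonneg
  refine ⟨fun l l' m m' => (qTerm_summable_and_tsum hC hC0 hW hD l l' m m').1, ?_, ?_⟩
  · intro lmin lmax b hb
    set s := b ⬝ᵥ (sigmaMatrix C lmin lmax *ᵥ b) with hs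
    -- The spectrum is nonnegative, so `s` is positive once it is nonzero and its square root is a
    -- genuine normalization.
    have hs0 : 0 ≤ s := by
      rw [hs, window_quadratic]
      exact Finset.sum_nonneg fun l _ => mul_nonneg (sq_nonneg _)
        (mul_nonneg (by positivity) (hC0 l.1))
    -- The variance does not depend on `ξ`, so the normalization leaves the integrals as the
    -- constant `1 / ((4π)⁻¹ s) = 4π / s`.
    have herr : ∀ ω ξ, D ξ * ((‖errorField P X W b ω ξ‖ ^ 2 : ℝ) : ℂ) =
        ((4 * Real.pi / s : ℝ) : ℂ) * (D ξ *
          ((‖smooth b (fun η => sample X ω η * (1 - W η)) ξ‖ ^ 2 : ℝ) : ℂ)) := fun ω ξ => by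
      have hv : (0 : ℝ) ≤ (4 * Real.pi)⁻¹ * s := by positivity
      rw [errorField, smooth_sub_smooth hW, hX.smoothVariance_eq, ← hs, norm_div,
        Complex.norm_real, Real.norm_of_nonneg (Real.sqrt_nonneg _), div_pow, Real.sq_sqrt hv]
      push_cast
      have h1 : (Real.pi : ℂ) ≠ 0 := by exact_mod_cast Real.pi_ne_zero
      have h2 : (s : ℂ) ≠ 0 := by exact_mod_cast hb
      field_simp
    have hnrm : ∀ ω ξ, D ξ * ((‖((Real.sqrt s)⁻¹ : ℂ) *
          smooth b (fun η => sample X ω η * (1 - W η)) ξ‖ ^ 2 : ℝ) : ℂ) =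
        ((s⁻¹ : ℝ) : ℂ) * (D ξ *
          ((‖smooth b (fun η => sample X ω η * (1 - W η)) ξ‖ ^ 2 : ℝ) : ℂ)) := fun ω ξ => by
      rw [norm_mul, norm_inv, Complex.norm_real, Real.norm_of_nonneg (Real.sqrt_nonneg _), mul_pow,
        inv_pow, Real.sq_sqrt hs0]
      push_cast
      ring
    refine ⟨fun ξ => ⟨hX.integrable_norm_smooth_sq b ξ, hX.smoothVariance_eq b ξ⟩, ?_, ?_, ?_, ?_⟩
    · intro ω
      simp only [herr]
      exact (integrable_weight_mul_norm_smooth_sq hD b (fun η => 1 - W η) ω).const_mul _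
    · simp only [herr, integral_const_mul]
      exact (hX.integrable_integral_weight hD (memLp_one_sub hW) b).const_mul _
    · simp only [mise, herr, integral_const_mul]
      rw [hX.integral_integral_weight hD hW]
      push_cast
      ring
    · simp only [hnrm, integral_const_mul]
      rw [hX.integral_integral_weight hD hW]
      push_cast
      ring
  · intro haW haD hre l l'
    have h := fun m => axial_sums hC hC0 hW hD l l' m
    have hq := qEntry_axial hC hC0 hW hD haW haD hre l l'
    refine ⟨fun m => ⟨(h m).1, (h m).2.1, (h m).2.2.1⟩, hq, ?_⟩
    rw [hq]
    exact Finset.sum_congr rfl fun m _ => (h m).2.2.2.1
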